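/- **Notation.** For $p\in\mathbb N=\{0,1,\dots\}$ and $1\le m\le 2^p$ put $t^0_{pm}=\frac{m-1}{2^p}$, $t^1_{pm}=\frac{2m-1}{2^{p+1}}$, $t^2_{pm}=\frac m{2^p}$. Let $\chi_{pm}=2^p$ on $[t^0_{pm},t^1_{pm})$, $\chi_{pm}=-2^p$ on $[t^1_{pm},t^2_{pm})$ and $\chi_{pm}=0$ elsewhere, $\chi_{00}=1$, $\chi_{p0}=0$ for $p\ge1$, and let $\varphi_{pm}(t)=\int_0^t\chi_{pm}(s)\,ds$ and $\varphi_{-10}=1$. For a continuous function $f$ on $[0,1]$ with values in a finite-dimensional normed space put $f_{pm}=2f(t^1_{pm})-f(t^0_{pm})-f(t^2_{pm})$ for $p\ge 0$, $1\le m\le 2^p$, $f_{-10}=f(0)$, $f_{00}=f(1)-f(0)$ and $f_{p0}=0$ for $p\ge 1$, and $$\Delta_pf=\sum_{0\le m\le 2^p}f_{pm}\varphi_{pm},\qquad S_pf=\sum_{-1\le q\le p}\Delta_qf,\qquad \|f\|_\gamma=\sup_{p\ge-1,\ 0\le m\le 2^p}2^{p\gamma}|f_{pm}| .$$ $\mathcal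 C^\gamma$ is the space of continuous functions on $[0,1]$ with $\|f\|_\gamma<\infty$. Write $\mathcal L(X,Y)$ for the space of linear maps from $X$ to $Y$, and define $$\pi_<(f,w)=\sum_{p\ge0}S_{p-1}f\,\Delta_pw,\qquad I(f,dw)=\sum_{p,q\ge -1}\int_0^\cdot\Delta_pf\,d\Delta_qw,$$ and, for real-valued $v,w$, $$L(v,w)=\sum_{p}\Big(\int_0^\cdot\Delta_pv\,dS_{p-1}w-\int_0^\cdot \Delta_pw\,dS_{p-1}v\Big);$$ below, $I$ and $L$ are applied only to functions with finitely many non-zero blocks $\Delta_p$. For $v\in\mathcal C^\alpha(\mathbb R^d)$ and $\beta\in(0,\alpha]$, write $(f,f^v)\in\mathcal D^\beta_v(E)$ if $f\in\mathcal C^\alpha(E)$, $f^v\in\mathcal C^\beta(\mathcal L(\mathbb R^d,E))$ and $f^\sharp:=f-\pi_<(f^v,v)\in\mathcal C^{\alpha+\beta}(E)$; then $f$ is said to be paracontrolled by $v$ with derivative $f^v$, and $\|f\|_{v,\beta}:=\|f^v\|_\beta+\|f^\sharp\|_{\alpha+\beta}$. **Theorem 4.6.** Let $\alpha\in(1/3,1)$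 and $\beta\in(0,\alpha]$ with $2\alpha+\beta>1$ and $\alpha+\beta\ne1$. Then there is a constant $C$ depending only on $\alpha,\beta$ and the dimensions $d,m$ such that the following holds. Let $v\in\mathcal C^\alpha(\mathbb R^d)$, assume that the Lévy area $$L(v,v):=\lim_{N\to\infty}\big(L(S_Nv^k,S_Nv^\ell)\big)_{1\le k,\ell\le d}$$ converges uniformly on $[0,1]$ and that $\sup_N\|L(S_Nv,S_Nv)\|_{2\alpha}<\infty$, where $L(S_Nv,S_Nv)$ denotes this matrix. Let $(f,f^v)\in\mathcal D^\beta_v(\mathcal L(\mathbb R^d,\mathbb R^m))$. Then there is a function $I(f,dv)$ such that $I(S_Nf,dS_Nv)$ converges to $I(f,dv)$ in $\mathcal C^{\alpha-\varepsilon}$ for every $\varepsilon>0$, and $$\|I(f,dv)\|_\alpha\le C\,\|f\|_{v,\beta}\big(\|v\|_\alpha+\|v\|_\alpha^2+\|L(v,v)\|_{2\alpha}\big).$$ Moreover $(I(f,dv),f)\in\mathcal D^\alpha_v(\mathbb R^m)$, that is, $I(f,dv)$ is paracontrolled by $v$ with derivative $f$, and $$\|I(f,dv)\|_{v,\alpha}\le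 C\,\|f\|_{v,\beta}\big(1+\|v\|_\alpha^2+\|L(v,v)\|_{2\alpha}\big).$$ -/

import Mathlib

open Set Filter Topology MeasureTheory
open scoped NNReal ENNReal

noncomputable section

namespace Schauder

/-! Paths are functions `ℝ → E` of which only the values on `[0,1]` matter. -/

/-- The dyadic points `t⁰_{pm} = (m-1)/2^p`, `t¹_{pm} = (2m-1)/2^(p+1)`, `t²_{pm} = m/2^p`
(used for `1 ≤ m ≤ 2^p`). -/
def t0 (p m : ℕ) : ℝ := ((m : ℝ) - 1) / 2 ^ p

/-- See `t0`. -/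
def t1 (p m : ℕ) : ℝ := (2 * (m : ℝ) - 1) / 2 ^ (p + 1)

/-- See `t0`. -/
def t2 (p m : ℕ) : ℝ := (m : ℝ) / 2 ^ p

/-- The rescaled Haar functions `χ_{pm} = 2^(p/2) H_{pm}`, for `p ≥ 0` and `0 ≤ m ≤ 2^p`; in
particular `χ_{00} = 1` and `χ_{p0} = 0` for `p ≥ 1`. -/
def chi (p m : ℕ) (t : ℝ) : ℝ :=
  if m = 0 then (if p = 0 then 1 else 0)
  else if t ∈ Ico (t0 p m) (t1 p m) then 2 ^ p
  else if t ∈ Ico (t1 p m) (t2 p m) then -2 ^ p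
  else 0

/-- The rescaled Schauder functions `φ_{pm} = ∫₀ χ_{pm}` for `p ≥ 0` and `0 ≤ m ≤ 2^p`:
`φ_{00}(t) = t`, `φ_{p0} = 0` for `p ≥ 1`, and for `m ≥ 1` the tent function which is
`2^p (t - t⁰_{pm})` on `[t⁰_{pm}, t¹_{pm}]`, `-2^p (t - t²_{pm})` on `[t¹_{pm}, t²_{pm}]` and `0`
elsewhere. -/
def phi (p m : ℕ) (t : ℝ) : ℝ :=
  if m = 0 then (if p = 0 then t else 0)
  else max 0 (min (2 ^ p * (t - t0 p m)) (-2 ^ p * (t - t2 p m)))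

section Basic

variable {E : Type*} [NormedAddCommGroup E] [NormedSpace ℝ E]

/-- The Schauder coefficients `f_{pm}` for `p ≥ 0`, `0 ≤ m ≤ 2^p`. (The remaining coefficient is
`f_{-10} = f 0`.) -/
def coeff (f : ℝ → E) (p m : ℕ) : E :=
  if m = 0 then (if p = 0 then f 1 - f 0 else 0)
  else (2 : ℝ) • f (t1 p m) - f (t0 p m) - f (t2 p m)

/-- The Schauder blocks `Δ_p f = ∑_{0 ≤ m ≤ 2^p} f_{pm} φ_{pm}` for `p ≥ -1`, where
`Δ_{-1} f` is the constant `f 0`. The value for `p < -1` is `0`. -/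
def block (f : ℝ → E) : ℤ → ℝ → E
  | Int.ofNat p => fun t => ∑ m ∈ Finset.range (2 ^ p + 1), phi p m t • coeff f p m
  | Int.negSucc 0 => fun _ => f 0
  | Int.negSucc (_ + 1) => fun _ => 0

/-- The density of `d(Δ_p f)`, i.e. `∑_{0 ≤ m ≤ 2^p} f_{pm} χ_{pm}` for `p ≥ 0`, and `0` for
`p = -1`. -/
def dblock (f : ℝ → E) : ℤ → ℝ → E
  | Int.ofNat p => fun t => ∑ m ∈ Finset.range (2 ^ p + 1), chi p m t • coeff f p m
  | Int.negSucc _ => fun _ => 0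

/-- The partial sums `S_p f = ∑_{-1 ≤ q ≤ p} Δ_q f`. -/
def partialSum (p : ℤ) (f : ℝ → E) (t : ℝ) : E :=
  ∑ q ∈ Finset.Icc (-1) p, block f q t

/-- The density of `d(S_p f)`. -/
def dpartialSum (p : ℤ) (f : ℝ → E) (t : ℝ) : E :=
  ∑ q ∈ Finset.Icc (-1) p, dblock f q t

/-- The norm `‖f‖_γ = sup_{p ≥ -1, 0 ≤ m ≤ 2^p} 2^(pγ) |f_{pm}|`, with values in `[0,∞]`. -/
def cnorm (γ : ℝ) (f : ℝ → E) : ℝ≥0∞ :=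
  (ENNReal.ofReal ((2 : ℝ) ^ (-γ)) * ‖f 0‖ₑ) ⊔
    ⨆ (p : ℕ) (m ∈ Finset.range (2 ^ p + 1)),
      ENNReal.ofReal ((2 : ℝ) ^ ((p : ℝ) * γ)) * ‖coeff f p m‖ₑ

/-- Membership in the space `𝒞^γ` of continuous functions on `[0,1]` with finite norm. -/
def MemC (γ : ℝ) (f : ℝ → E) : Prop :=
  ContinuousOn f (Icc 0 1) ∧ cnorm γ f < ⊤

/-- Convergence of the sequence `F` to `g` in the space `𝒞^γ`. -/
def TendstoC (γ : ℝ) (F : ℕ → ℝ → E) (g : ℝ → E) : Prop :=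
  (∀ N, MemC γ (F N)) ∧ MemC γ g ∧
    Tendsto (fun N => cnorm γ (fun t => F N t - g t)) atTop (𝓝 0)

end Basic

section Operators

variable {E F : Type*} [NormedAddCommGroup E] [NormedSpace ℝ E]
  [NormedAddCommGroup F] [NormedSpace ℝ F]

/-- The paraproduct `π_<(f,w) = ∑_{p ≥ 0} S_{p-1} f Δ_p w`. -/
def paraproduct (f : ℝ → E →L[ℝ] F) (w : ℝ → E) (t : ℝ) : F :=
  ∑' p : ℕ, (partialSum ((p : ℤ) - 1) f t) (block w p t)

/-- The integral `I(f,dw) = ∑_{p,q} ∫₀ Δ_p f dΔ_q w`. It is only applied to functions with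
finitely many non-zero blocks, for which the double series is a finite sum. -/
def integral (f : ℝ → E →L[ℝ] F) (w : ℝ → E) (t : ℝ) : F :=
  ∑' pq : ℤ × ℤ, ∫ s in (0 : ℝ)..t, (block f pq.1 s) (dblock w pq.2 s)

/-- The Lévy area `L(v,w) = ∑_p (∫₀ Δ_p v d(S_{p-1} w) - ∫₀ d(S_{p-1} v) Δ_p w)` of two
real-valued functions. It is only applied to functions with finitely many non-zero blocks, for which
the series is a finite sum; the term with `p = -1` is zero. -/
def levyArea (v w : ℝ → ℝ) (t : ℝ) : ℝ :=
  ∑' p : ℕ,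
    ((∫ s in (0 : ℝ)..t, block v p s * dpartialSum ((p : ℤ) - 1) w s) -
      ∫ s in (0 : ℝ)..t, dpartialSum ((p : ℤ) - 1) v s * block w p s)

/-- The matrix `(L(v^k, w^ℓ))_{k,ℓ}`, as an element of `ℝ^(d × d)`. -/
def levyMatrix {d : ℕ} (v w : ℝ → EuclideanSpace ℝ (Fin d)) (t : ℝ) :
    EuclideanSpace ℝ (Fin d × Fin d) :=
  WithLp.toLp 2 fun kl => levyArea (fun s => v s kl.1) (fun s => w s kl.2) t

/-- The remainder `f^♯ = f - π_<(f^v, v)`. -/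
def remainder (v : ℝ → E) (f : ℝ → F) (fv : ℝ → E →L[ℝ] F) (t : ℝ) : F :=
  f t - paraproduct fv v t

/-- `(f, f^v) ∈ 𝒟^β_v`: the path `f` is paracontrolled by `v ∈ 𝒞^α` with derivative `f^v`. -/
def MemD (α β : ℝ) (v : ℝ → E) (f : ℝ → F) (fv : ℝ → E →L[ℝ] F) : Prop :=
  MemC α f ∧ MemC β fv ∧ MemC (α + β) (remainder v f fv)

/-- The norm `‖f‖_{v,β} = ‖f^v‖_β + ‖f^♯‖_{α+β}`. -/
def dnorm (α β : ℝ) (v : ℝ → E) (f : ℝ → F) (fv : ℝ → E →L[ℝ] F) : ℝ≥0∞ :=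
  cnorm β fv + cnorm (α + β) (remainder v f fv)

end Operators

end Schauder

end

noncomputable section

set_option linter.unusedSectionVars false

namespace Schauder

/-! Everything is read off dyadic intervals. Put `x = 2 ^ (-α)` and `y = 2 ^ (-β)`. Schauder
coefficients are second differences `sd`, partial sums are polygonal interpolations, and a norm
bound in `𝒞^α` says that second differences at level `q` are `O(x ^ q)`. The second differences of a
paraproduct satisfy `sd (π_<(f', v)) = f'(left endpoint) (sd v) + O((x * y) ^ q)`
(`norm_sd_paraproduct_sub_le`). So being paracontrolled by `v` with derivative `f'` becomes a
statement about coefficients: `sd f = f'(left endpoint) (sd v)` up to `O((x * y) ^ q)`.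

The integral is obtained by a dyadic sewing argument. Over an interval of level `q` the germ `X` is
the trapezoid rule for `∫ f dv`, corrected if necessary by `f'(left endpoint)` contracted with the
area that the levels `≥ q` of `v` contribute on that interval. Its additivity defect is `O(θ ^ q)`
with `θ < 1 / 2`, uniformly when `f`, `v` and the area are replaced by their truncations. For
truncated data and fine intervals the area vanishes and the trapezoid rule is exact, so the germ is
the integral itself. Hence increments of the truncated integrals stay within `O(θ ^ q)` of the germ
and converge (`exists_sewing_limit`). The limit `J` inherits from the germ `sd J = f(left endpoint)
(sd v) + O(x ^ (2 * q))`, which says that `J` is paracontrolled by `v` with derivative `f`.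

The hypothesis `2α + β > 1` is `x ^ 2 * y < 1 / 2`. If `2α > 1`, the trapezoid rule alone has a
summable defect with `θ = x ^ 2`. Otherwise its leading defect is antisymmetric and is exactly
cancelled by the area. In that case `α + β ≤ 1`, and `α + β ≠ 1` gives `x * y > 1 / 2`, which the
expansion of increments of `f` (`Controlled.norm_inc_sub_le`) requires. -/

/-- The dyadic point `k / 2 ^ q`. -/
def dy (q k : ℕ) : ℝ := (k : ℝ) / 2 ^ q

lemma dy_zero (q : ℕ) : dy q 0 = 0 := by simp [dy]

lemma dy_zero_one : dy 0 1 = 1 := by simp [dy]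

lemma dy_succ_two_mul (q k : ℕ) : dy (q + 1) (2 * k) = dy q k := by
  unfold dy; push_cast; rw [pow_succ]; field_simp

lemma dy_succ_two_mul_add_two (q k : ℕ) : dy (q + 1) (2 * k + 1 + 1) = dy q (k + 1) := by
  exact dy_succ_two_mul q (k + 1)

lemma dy_mid (q k : ℕ) : dy (q + 1) (2 * k + 1) = (dy q k + dy q (k + 1)) / 2 := by
  unfold dy; push_cast; rw [pow_succ]; field_simp; ring

lemma dy_add (q j k : ℕ) : dy (q + j) (2 ^ j * k) = dy q k := by
  unfold dy; push_cast; rw [pow_add]; field_simp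

lemma dy_lt_succ (q k : ℕ) : dy q k < dy q (k + 1) := by
  unfold dy; push_cast; gcongr; linarith

lemma dy_le_dy {q k l : ℕ} (h : k ≤ l) : dy q k ≤ dy q l := by
  unfold dy; gcongr

lemma dy_mem {q k : ℕ} (h : k ≤ 2 ^ q) : dy q k ∈ Icc (0 : ℝ) 1 := by
  constructor
  · unfold dy; positivity
  · unfold dy; rw [div_le_one (by positivity)]; exact_mod_cast h

lemma t0_succ (p k : ℕ) : t0 p (k + 1) = dy p k := by simp [t0, dy]

lemma t1_succ (p k : ℕ) : t1 p (k + 1) = dy (p + 1) (2 * k + 1) := by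
  unfold t1 dy; push_cast; ring

lemma t2_succ (p k : ℕ) : t2 p (k + 1) = dy p (k + 1) := by simp [t2, dy]

lemma exists_half {q k : ℕ} (h : k < 2 ^ (q + 1)) :
    ∃ l < 2 ^ q, k = 2 * l ∨ k = 2 * l + 1 := by
  refine ⟨k / 2, ?_, by omega⟩
  rw [pow_succ] at h; omega

lemma two_mul_lt_pow {q k : ℕ} (h : k < 2 ^ q) : 2 * k + 1 < 2 ^ (q + 1) := by
  rw [pow_succ]; omega

/-! ### Increments, second differences and piecewise affine functions -/

section Basic

variable {E : Type*} [NormedAddCommGroup E] [NormedSpace ℝ E]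

/-- The increment of `f` over the dyadic interval `[k / 2 ^ q, (k + 1) / 2 ^ q]`. -/
def inc (f : ℝ → E) (q k : ℕ) : E := f (dy q (k + 1)) - f (dy q k)

/-- The second difference of `f` over the dyadic interval `[k / 2 ^ q, (k + 1) / 2 ^ q]`. -/
def sd (f : ℝ → E) (q k : ℕ) : E :=
  (2 : ℝ) • f (dy (q + 1) (2 * k + 1)) - f (dy q k) - f (dy q (k + 1))

lemma coeff_succ (f : ℝ → E) (q k : ℕ) : coeff f q (k + 1) = sd f q k := by
  simp [coeff, sd, t0_succ, t1_succ, t2_succ]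

lemma coeff_zero_zero (f : ℝ → E) : coeff f 0 0 = inc f 0 0 := by
  simp [coeff, inc, dy]

lemma coeff_succ_zero (f : ℝ → E) (q : ℕ) : coeff f (q + 1) 0 = 0 := by
  simp [coeff]

lemma inc_left (f : ℝ → E) (q k : ℕ) :
    inc f (q + 1) (2 * k) = (1 / 2 : ℝ) • (inc f q k + sd f q k) := by
  unfold inc sd; rw [dy_succ_two_mul]; module

lemma inc_right (f : ℝ → E) (q k : ℕ) :
    inc f (q + 1) (2 * k + 1) = (1 / 2 : ℝ) • (inc f q k - sd f q k) := by
  unfold inc sd; rw [dy_succ_two_mul_add_two]; module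

lemma inc_split (f : ℝ → E) (q k : ℕ) :
    inc f q k = inc f (q + 1) (2 * k) + inc f (q + 1) (2 * k + 1) := by
  rw [inc_left, inc_right]; module

lemma sd_eq (f : ℝ → E) (q k : ℕ) :
    sd f q k = inc f (q + 1) (2 * k) - inc f (q + 1) (2 * k + 1) := by
  rw [inc_left, inc_right]; module

lemma apply_mid (f : ℝ → E) (q k : ℕ) :
    f (dy (q + 1) (2 * k + 1)) =
      (1 / 2 : ℝ) • (f (dy q k) + f (dy q (k + 1)) + sd f q k) := by
  unfold sd; module

lemma inc_add (f g : ℝ → E) (q k : ℕ) :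
    inc (fun t => f t + g t) q k = inc f q k + inc g q k := by unfold inc; module

lemma inc_sub (f g : ℝ → E) (q k : ℕ) :
    inc (fun t => f t - g t) q k = inc f q k - inc g q k := by unfold inc; module

lemma sd_add (f g : ℝ → E) (q k : ℕ) :
    sd (fun t => f t + g t) q k = sd f q k + sd g q k := by unfold sd; module

lemma sd_sub (f g : ℝ → E) (q k : ℕ) :
    sd (fun t => f t - g t) q k = sd f q k - sd g q k := by unfold sd; module

lemma inc_const (c : E) (q k : ℕ) : inc (fun _ => c) q k = 0 := by simp [inc]

lemma sd_const (c : E) (q k : ℕ) : sd (fun _ => c) q k = 0 := by unfold sd; module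

lemma inc_sum {ι : Type*} (s : Finset ι) (f : ι → ℝ → E) (q k : ℕ) :
    inc (fun t => ∑ i ∈ s, f i t) q k = ∑ i ∈ s, inc (f i) q k := by
  simp [inc, Finset.sum_sub_distrib]

lemma sd_sum {ι : Type*} (s : Finset ι) (f : ι → ℝ → E) (q k : ℕ) :
    sd (fun t => ∑ i ∈ s, f i t) q k = ∑ i ∈ s, sd (f i) q k := by
  simp [sd, Finset.sum_sub_distrib, Finset.smul_sum]

/-- `g` is affine, with slope given by `dg`, on every dyadic interval of level `q` in `[0,1]`. -/
def PiecewiseAffine (q : ℕ) (g dg : ℝ → E) : Prop :=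
  ∀ k < 2 ^ q, ∃ a b : E, (∀ t ∈ Icc (dy q k) (dy q (k + 1)), g t = t • a + b) ∧
    ∀ t ∈ Ico (dy q k) (dy q (k + 1)), dg t = a

lemma PiecewiseAffine.succ {q : ℕ} {g dg : ℝ → E} (h : PiecewiseAffine q g dg) :
    PiecewiseAffine (q + 1) g dg := by
  intro k hk
  obtain ⟨l, hl, hkl⟩ := exists_half hk
  obtain ⟨a, b, h1, h2⟩ := h l hl
  have hlt := dy_lt_succ q l
  have hlow : dy q l ≤ dy (q + 1) k := by
    rw [← dy_succ_two_mul]; exact dy_le_dy (by omega : 2 * l ≤ k)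
  have hup : dy (q + 1) (k + 1) ≤ dy q (l + 1) := by
    rw [← dy_succ_two_mul_add_two q l]; exact dy_le_dy (by omega)
  exact ⟨a, b, fun t ht => h1 t ⟨hlow.trans ht.1, ht.2.trans hup⟩,
    fun t ht => h2 t ⟨hlow.trans ht.1, ht.2.trans_le hup⟩⟩

lemma PiecewiseAffine.mono {q r : ℕ} {g dg : ℝ → E} (h : PiecewiseAffine q g dg) (hqr : q ≤ r) :
    PiecewiseAffine r g dg := by
  induction r, hqr using Nat.le_induction with
  | base => exact h
  | succ r _ ih => exact ih.succ

lemma PiecewiseAffine.add {q : ℕ} {g dg g' dg' : ℝ → E} (h : PiecewiseAffine q g dg)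
    (h' : PiecewiseAffine q g' dg') :
    PiecewiseAffine q (fun t => g t + g' t) (fun t => dg t + dg' t) := by
  intro k hk
  obtain ⟨a, b, h1, h2⟩ := h k hk
  obtain ⟨a', b', h1', h2'⟩ := h' k hk
  refine ⟨a + a', b + b', fun t ht => ?_, fun t ht => ?_⟩
  · simp only [h1 t ht, h1' t ht]; module
  · simp only [h2 t ht, h2' t ht]

lemma piecewiseAffine_const (q : ℕ) (c : E) :
    PiecewiseAffine q (fun _ => c) (fun _ => 0) :=
  fun _ _ => ⟨0, c, by simp, by simp⟩

lemma PiecewiseAffine.sum {ι : Type*} {q : ℕ} (s : Finset ι) {g dg : ι → ℝ → E}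
    (h : ∀ i ∈ s, PiecewiseAffine q (g i) (dg i)) :
    PiecewiseAffine q (fun t => ∑ i ∈ s, g i t) (fun t => ∑ i ∈ s, dg i t) := by
  classical
  induction s using Finset.induction_on with
  | empty => simpa using piecewiseAffine_const q (0 : E)
  | insert i s hi ih =>
    simp only [Finset.sum_insert hi]
    exact (h i (by simp)).add (ih fun j hj => h j (by simp [hj]))

lemma PiecewiseAffine.smul_const {q : ℕ} {g dg : ℝ → ℝ} (h : PiecewiseAffine q g dg) (c : E) :
    PiecewiseAffine q (fun t => g t • c) (fun t => dg t • c) := by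
  intro k hk
  obtain ⟨a, b, h1, h2⟩ := h k hk
  refine ⟨a • c, b • c, fun t ht => ?_, fun t ht => ?_⟩
  · simp only [h1 t ht, smul_eq_mul]; module
  · simp only [h2 t ht]

lemma PiecewiseAffine.sd_eq_zero {q : ℕ} {g dg : ℝ → E} (h : PiecewiseAffine q g dg) {k : ℕ}
    (hk : k < 2 ^ q) : sd g q k = 0 := by
  obtain ⟨a, b, h1, -⟩ := h k hk
  have hlt := dy_lt_succ q k
  unfold sd
  rw [h1 _ ⟨le_rfl, hlt.le⟩, h1 _ ⟨hlt.le, le_rfl⟩, dy_mid,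
    h1 _ ⟨by linarith, by linarith⟩]
  module

lemma exists_mem_dyadic (q : ℕ) {t : ℝ} (ht : t ∈ Icc (0 : ℝ) 1) :
    ∃ k < 2 ^ q, t ∈ Icc (dy q k) (dy q (k + 1)) := by
  have hpos : (0 : ℝ) < 2 ^ q := by positivity
  rcases ht.2.eq_or_lt with rfl | h1
  · have h2 : 0 < 2 ^ q := by positivity
    refine ⟨2 ^ q - 1, by omega, ?_, ?_⟩
    · unfold dy; rw [div_le_one hpos, Nat.cast_sub h2]; push_cast; linarith
    · rw [Nat.sub_add_cancel h2]; unfold dy; push_cast; rw [div_self hpos.ne']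
  · have h0 : 0 ≤ t * 2 ^ q := mul_nonneg ht.1 hpos.le
    refine ⟨⌊t * 2 ^ q⌋₊, ?_, ?_, ?_⟩
    · rw [Nat.floor_lt h0]; push_cast; nlinarith
    · unfold dy; rw [div_le_iff₀ hpos]; exact Nat.floor_le h0
    · unfold dy; rw [le_div_iff₀ hpos]; push_cast; exact (Nat.lt_floor_add_one _).le

/-- A piecewise affine function is bounded by its values at the nodes. -/
lemma PiecewiseAffine.norm_le {q : ℕ} {g dg : ℝ → E} (h : PiecewiseAffine q g dg) {M : ℝ}
    (hM : ∀ k ≤ 2 ^ q, ‖g (dy q k)‖ ≤ M) {t : ℝ} (ht : t ∈ Icc (0 : ℝ) 1) : ‖g t‖ ≤ M := by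
  obtain ⟨k, hk, htk⟩ := exists_mem_dyadic q ht
  obtain ⟨a, b, h1, -⟩ := h k hk
  have hlt := dy_lt_succ q k
  have hball := convex_closedBall (0 : E) M
  obtain ⟨u, w, hu, hw, huw, hut⟩ : t ∈ segment ℝ (dy q k) (dy q (k + 1)) := by
    rw [segment_eq_Icc hlt.le]; exact htk
  have hs := hball (x := g (dy q k)) (by simpa using hM k hk.le)
    (y := g (dy q (k + 1))) (by simpa using hM (k + 1) hk) hu hw huw
  have : u • g (dy q k) + w • g (dy q (k + 1)) = g t := by
    rw [h1 _ ⟨le_rfl, hlt.le⟩, h1 _ ⟨hlt.le, le_rfl⟩, h1 t htk, ← hut]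
    have : b = (u + w) • b := by rw [huw, one_smul]
    rw [smul_eq_mul, smul_eq_mul]
    nth_rw 3 [this]; module
  rw [this] at hs
  simpa using hs

end Basic

/-! ### Schauder and Haar functions on the dyadic grid -/

lemma phi_zero_zero (t : ℝ) : phi 0 0 t = t := by simp [phi]

lemma phi_succ_zero (p : ℕ) (t : ℝ) : phi (p + 1) 0 t = 0 := by simp [phi]

lemma phi_succ (p n : ℕ) (t : ℝ) :
    phi p (n + 1) t = max 0 (min (2 ^ p * t - n) (n + 1 - 2 ^ p * t)) := by
  have h : (2 : ℝ) ^ p ≠ 0 := by positivity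
  have h1 : (2 : ℝ) ^ p * (t - t0 p (n + 1)) = 2 ^ p * t - n := by
    rw [t0_succ]; unfold dy; field_simp
  have h2 : -(2 : ℝ) ^ p * (t - t2 p (n + 1)) = n + 1 - 2 ^ p * t := by
    rw [t2_succ]; unfold dy; push_cast; field_simp; ring
  rw [phi, if_neg (Nat.succ_ne_zero n), h1, h2]

lemma chi_succ (p n : ℕ) (t : ℝ) :
    chi p (n + 1) t = if (2 * n : ℝ) ≤ 2 ^ (p + 1) * t ∧ 2 ^ (p + 1) * t < 2 * n + 1 then 2 ^ p
      else if (2 * n + 1 : ℝ) ≤ 2 ^ (p + 1) * t ∧ 2 ^ (p + 1) * t < 2 * n + 2 then -2 ^ p else 0 := by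
  have h : (0 : ℝ) < 2 ^ (p + 1) := by positivity
  have h1 : t ∈ Ico (t0 p (n + 1)) (t1 p (n + 1)) ↔
      (2 * n : ℝ) ≤ 2 ^ (p + 1) * t ∧ 2 ^ (p + 1) * t < 2 * n + 1 := by
    rw [t0_succ, t1_succ, ← dy_succ_two_mul, mem_Ico, dy, dy, div_le_iff₀ h, lt_div_iff₀ h]
    push_cast; rw [mul_comm t]
  have h2 : t ∈ Ico (t1 p (n + 1)) (t2 p (n + 1)) ↔
      (2 * n + 1 : ℝ) ≤ 2 ^ (p + 1) * t ∧ 2 ^ (p + 1) * t < 2 * n + 2 := by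
    rw [t2_succ, t1_succ, ← dy_succ_two_mul_add_two p n, mem_Ico, dy, dy, div_le_iff₀ h,
      lt_div_iff₀ h]
    push_cast; rw [mul_comm t, add_assoc (2 * (n : ℝ)) 1 1]; norm_num
  simp only [chi, Nat.succ_ne_zero, if_false, h1, h2]

lemma phi_piecewiseAffine (p m : ℕ) : PiecewiseAffine (p + 1) (phi p m) (chi p m) := by
  intro r _
  rcases m with _ | n
  · rcases p with _ | p
    · exact ⟨1, 0, fun t _ => by simp [phi], fun t _ => by simp [chi]⟩
    · exact ⟨0, 0, fun t _ => by simp [phi], fun t _ => by simp [chi]⟩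
  have hpos : (0 : ℝ) < 2 ^ (p + 1) := by positivity
  have hp2 : (2 : ℝ) ^ (p + 1) = 2 * 2 ^ p := by ring
  have hI : ∀ t, dy (p + 1) r ≤ t ↔ (r : ℝ) ≤ 2 ^ (p + 1) * t := fun t => by
    unfold dy; rw [div_le_iff₀ hpos, mul_comm]
  have hI' : ∀ t, t ≤ dy (p + 1) (r + 1) ↔ 2 ^ (p + 1) * t ≤ r + 1 := fun t => by
    unfold dy; rw [le_div_iff₀ hpos, mul_comm]; push_cast; rfl
  have hI'' : ∀ t, t < dy (p + 1) (r + 1) ↔ 2 ^ (p + 1) * t < r + 1 := fun t => by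
    unfold dy; rw [lt_div_iff₀ hpos, mul_comm]; push_cast; rfl
  simp only [mem_Icc, mem_Ico, hI, hI', hI'', phi_succ, chi_succ, smul_eq_mul, hp2, mul_assoc]
  rcases lt_or_ge r (2 * n) with h | h
  · have h' : (r : ℝ) + 1 ≤ 2 * n := by exact_mod_cast h
    refine ⟨0, 0, fun t ht => ?_, fun t ht => ?_⟩
    · rw [max_eq_left]; · simp
      exact (min_le_left _ _).trans (by linarith [ht.2])
    · rw [if_neg (by intro h; linarith [ht.2, h.1]), if_neg (by intro h; linarith [ht.2, h.1])]
  rcases h.eq_or_lt with h | h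
  · have h' : (r : ℝ) = 2 * n := by exact_mod_cast h.symm
    refine ⟨2 ^ p, -n, fun t ht => ?_, fun t ht => ?_⟩
    · rw [min_eq_left (by linarith [ht.2]), max_eq_right (by linarith [ht.1])]; ring
    · rw [if_pos ⟨by linarith [ht.1], by linarith [ht.2]⟩]
  rcases (Nat.succ_le_of_lt h).eq_or_lt with h | h
  · have h' : (r : ℝ) = 2 * n + 1 := by exact_mod_cast h.symm
    refine ⟨-2 ^ p, n + 1, fun t ht => ?_, fun t ht => ?_⟩
    · rw [min_eq_right (by linarith [ht.1]), max_eq_right (by linarith [ht.2])]; ring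
    · rw [if_neg (by intro h; linarith [ht.1, h.2]),
        if_pos ⟨by linarith [ht.1], by linarith [ht.2]⟩]
  · have h' : (2 * n + 2 : ℝ) ≤ r := by exact_mod_cast h
    refine ⟨0, 0, fun t ht => ?_, fun t ht => ?_⟩
    · rw [max_eq_left]; · simp
      exact (min_le_right _ _).trans (by linarith [ht.1])
    · rw [if_neg (by intro h; linarith [ht.1, h.2]), if_neg (by intro h; linarith [ht.1, h.2])]

lemma continuous_phi (p m : ℕ) : Continuous (phi p m) := by
  rcases m with _ | n
  · rcases p with _ | p
    · rw [funext phi_zero_zero]; exact continuous_id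
    · simpa only [funext (phi_succ_zero p)] using continuous_const
  · simp only [funext (phi_succ p n)]; fun_prop

lemma intervalIntegrable_chi (p m : ℕ) (a b : ℝ) :
    IntervalIntegrable (chi p m) volume a b := by
  have hm : Measurable (chi p m) := by
    unfold chi
    by_cases h : m = 0
    · simp [h]
    · simp only [h, if_false]
      exact Measurable.ite measurableSet_Ico measurable_const
        (Measurable.ite measurableSet_Ico measurable_const measurable_const)
  refine (intervalIntegrable_const (c := (2 : ℝ) ^ p)).mono_fun hm.aestronglyMeasurable ?_
  refine Eventually.of_forall fun t => ?_
  have h1 : (1 : ℝ) ≤ 2 ^ p := one_le_pow₀ (by norm_num)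
  change ‖chi p m t‖ ≤ ‖(2 : ℝ) ^ p‖
  rw [Real.norm_of_nonneg (zero_le_one.trans h1), Real.norm_eq_abs, chi]
  split_ifs <;> simp [h1, zero_le_one.trans h1]

lemma phi_dy (p n k : ℕ) : phi p (n + 1) (dy p k) = 0 := by
  have : (2 : ℝ) ^ p * dy p k = k := by unfold dy; field_simp
  rw [phi_succ, this, max_eq_left]
  rcases Nat.lt_or_ge n k with h | h
  · have : (n + 1 : ℝ) ≤ k := by exact_mod_cast h
    exact (min_le_right _ _).trans (by linarith)
  · have : (k : ℝ) ≤ n := by exact_mod_cast h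
    exact (min_le_left _ _).trans (by linarith)

lemma phi_dy_mid (p n k : ℕ) :
    phi p (n + 1) (dy (p + 1) (2 * k + 1)) = if n = k then 1 / 2 else 0 := by
  have : (2 : ℝ) ^ p * dy (p + 1) (2 * k + 1) = k + 1 / 2 := by
    unfold dy; rw [pow_succ]; push_cast; field_simp
  rw [phi_succ, this]
  split_ifs with h
  · subst h; rw [min_eq_left (by linarith)]; ring_nf; norm_num
  rw [max_eq_left]
  rcases Nat.lt_or_ge n k with h | h
  · have : (n + 1 : ℝ) ≤ k := by exact_mod_cast h
    exact (min_le_right _ _).trans (by linarith)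
  · have : (k + 1 : ℝ) ≤ n := by exact_mod_cast lt_of_le_of_ne h (Ne.symm ‹_›)
    exact (min_le_left _ _).trans (by linarith)

/-! ### Schauder blocks; partial sums as polygonal interpolations -/

section Blocks

variable {E : Type*} [NormedAddCommGroup E] [NormedSpace ℝ E]

/-- The block of level `p` with coefficients `c p m`. -/
def coeffBlock (c : ℕ → ℕ → E) (p : ℕ) (t : ℝ) : E :=
  ∑ m ∈ Finset.range (2 ^ p + 1), phi p m t • c p m

/-- The density of `coeffBlock c p`. -/
def dcoeffBlock (c : ℕ → ℕ → E) (p : ℕ) (t : ℝ) : E :=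
  ∑ m ∈ Finset.range (2 ^ p + 1), chi p m t • c p m

lemma block_natCast (f : ℝ → E) (p : ℕ) : block f (p : ℤ) = coeffBlock (coeff f) p := rfl

lemma coeffBlock_piecewiseAffine (c : ℕ → ℕ → E) (p : ℕ) :
    PiecewiseAffine (p + 1) (coeffBlock c p) (dcoeffBlock c p) :=
  PiecewiseAffine.sum _ fun m _ => (phi_piecewiseAffine p m).smul_const (c p m)

lemma continuous_coeffBlock (c : ℕ → ℕ → E) (p : ℕ) : Continuous (coeffBlock c p) :=
  continuous_finsetSum _ fun m _ => (continuous_phi p m).smul continuous_const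

lemma intervalIntegrable_dcoeffBlock (c : ℕ → ℕ → E) (p : ℕ) (a b : ℝ) :
    IntervalIntegrable (dcoeffBlock c p) volume a b := by
  have : dcoeffBlock c p = ∑ m ∈ Finset.range (2 ^ p + 1), fun t => chi p m t • c p m := by
    ext t; simp [dcoeffBlock]
  rw [this]
  refine IntervalIntegrable.sum _ fun m _ => ?_
  have h := intervalIntegrable_chi p m a b
  exact ⟨h.1.smul_const _, h.2.smul_const _⟩

lemma coeffBlock_dy_succ (c : ℕ → ℕ → E) (p k : ℕ) : coeffBlock c (p + 1) (dy (p + 1) k) = 0 := by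
  refine Finset.sum_eq_zero fun m _ => ?_
  rcases m with _ | n
  · rw [phi_succ_zero, zero_smul]
  · rw [phi_dy, zero_smul]

/-- Tents of level `p` vanish on the grid of level `p`, which contains all coarser grids. Level `0`
is excluded because it also carries the function `t`, which is `1` at the endpoint `1`. -/
lemma coeffBlock_dy {p q : ℕ} (c : ℕ → ℕ → E) (hp : p ≠ 0) (hq : q ≤ p) (k : ℕ) :
    coeffBlock c p (dy q k) = 0 := by
  obtain ⟨j, rfl⟩ := Nat.exists_eq_add_of_le hq
  obtain ⟨r, hr⟩ := Nat.exists_eq_succ_of_ne_zero hp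
  rw [← dy_add q j k, hr]
  exact coeffBlock_dy_succ c r _

lemma coeffBlock_zero_zero (c : ℕ → ℕ → E) (p : ℕ) : coeffBlock c p 0 = 0 := by
  rcases p with _ | p
  · have : phi 0 1 0 = 0 := by rw [phi_succ]; norm_num
    simp [coeffBlock, Finset.sum_range_succ, phi_zero_zero, this]
  · rw [← dy_zero 0]; exact coeffBlock_dy c p.succ_ne_zero (Nat.zero_le _) _

lemma sum_phi_mid (c : ℕ → ℕ → E) {p k : ℕ} (hk : k < 2 ^ p) :
    ∑ n ∈ Finset.range (2 ^ p), phi p (n + 1) (dy (p + 1) (2 * k + 1)) • c p (n + 1) =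
      (1 / 2 : ℝ) • c p (k + 1) := by
  rw [Finset.sum_eq_single k]
  · rw [phi_dy_mid, if_pos rfl]
  · intro n _ hn; rw [phi_dy_mid, if_neg hn, zero_smul]
  · intro h; simp [hk] at h

lemma coeffBlock_mid (c : ℕ → ℕ → E) {p k : ℕ} (hp : p ≠ 0) (hk : k < 2 ^ p) :
    coeffBlock c p (dy (p + 1) (2 * k + 1)) = (1 / 2 : ℝ) • c p (k + 1) := by
  obtain ⟨r, rfl⟩ := Nat.exists_eq_succ_of_ne_zero hp
  rw [coeffBlock, Finset.sum_range_succ', sum_phi_mid c hk, phi_succ_zero, zero_smul, add_zero]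

lemma coeffBlock_zero_one (c : ℕ → ℕ → E) : coeffBlock c 0 1 = c 0 0 := by
  have : phi 0 1 1 = 0 := by rw [phi_succ]; norm_num
  simp [coeffBlock, Finset.sum_range_succ, phi_zero_zero, this]

lemma coeffBlock_zero_half (c : ℕ → ℕ → E) :
    coeffBlock c 0 (dy 1 1) = (1 / 2 : ℝ) • (c 0 0 + c 0 1) := by
  have h := sum_phi_mid c (p := 0) (k := 0) (by norm_num)
  rw [coeffBlock, Finset.sum_range_succ']
  simp only [Nat.mul_zero, Nat.zero_add] at h
  rw [h, phi_zero_zero]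
  have : dy 1 1 = 1 / 2 := by simp [dy]
  rw [this]; module

/-- Biorthogonality: a coarser block is affine on the interval, a finer one vanishes at its
endpoints and midpoint, and the block of the same level contributes its tent. -/
lemma sd_coeffBlock (c : ℕ → ℕ → E) (p : ℕ) {q k : ℕ} (hk : k < 2 ^ q) :
    sd (coeffBlock c p) q k = if p = q then c p (k + 1) else 0 := by
  split_ifs with h
  · subst h
    rcases eq_or_ne p 0 with rfl | hp
    · have hk0 : k = 0 := by simpa using hk
      subst hk0
      unfold sd
      simp only [Nat.mul_zero, Nat.zero_add, dy_zero, dy_zero_one, coeffBlock_zero_half,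
        coeffBlock_zero_zero, coeffBlock_zero_one]
      module
    · unfold sd
      rw [coeffBlock_mid c hp hk, coeffBlock_dy c hp le_rfl, coeffBlock_dy c hp le_rfl]
      module
  · rcases lt_or_gt_of_ne h with h | h
    · exact ((coeffBlock_piecewiseAffine c p).mono h).sd_eq_zero hk
    · unfold sd
      have hp : p ≠ 0 := by omega
      rw [coeffBlock_dy c hp h, coeffBlock_dy c hp h.le, coeffBlock_dy c hp h.le]
      simp

lemma inc_coeffBlock_zero_zero (c : ℕ → ℕ → E) (p : ℕ) :
    inc (coeffBlock c p) 0 0 = if p = 0 then c 0 0 else 0 := by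
  unfold inc
  rw [dy_zero, coeffBlock_zero_zero, dy_zero_one, sub_zero]
  split_ifs with h
  · rw [h, coeffBlock_zero_one]
  · rw [← dy_zero_one, coeffBlock_dy c h (Nat.zero_le _)]

/-- A block is bounded by its coefficients. -/
lemma norm_coeffBlock_le (c : ℕ → ℕ → E) (p : ℕ) {M : ℝ} (h0 : p = 0 → ‖c p 0‖ ≤ M)
    (hM : ∀ k < 2 ^ p, ‖c p (k + 1)‖ ≤ M) {t : ℝ} (ht : t ∈ Icc (0 : ℝ) 1) :
    ‖coeffBlock c p t‖ ≤ M := by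
  have hM0 : 0 ≤ M := (norm_nonneg _).trans (hM 0 (by positivity))
  refine (coeffBlock_piecewiseAffine c p).norm_le (fun k hk => ?_) ht
  rcases eq_or_ne p 0 with rfl | hp
  · have h1 := hM 0 (by norm_num)
    have h2 := h0 rfl
    have : k = 0 ∨ k = 1 ∨ k = 2 := by simp at hk; omega
    rcases this with rfl | rfl | rfl
    · rwa [dy_zero, coeffBlock_zero_zero, norm_zero]
    · rw [Nat.zero_add, coeffBlock_zero_half, norm_smul]
      have := norm_add_le (c 0 0) (c 0 1)
      norm_num
      linarith
    · have : dy (0 + 1) 2 = 1 := by simp [dy]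
      rwa [this, coeffBlock_zero_one]
  · rcases Nat.even_or_odd' k with ⟨l, rfl | rfl⟩
    · rw [dy_succ_two_mul, coeffBlock_dy c hp le_rfl]; simpa
    · have hl : l < 2 ^ p := by rw [pow_succ] at hk; omega
      have := hM l hl
      rw [coeffBlock_mid c hp hl, norm_smul]
      norm_num
      linarith [norm_nonneg (c p (l + 1))]

/-- The partial sum of the Schauder expansion containing the constant block and the blocks of
levels `< n`. -/
def schauderSum (n : ℕ) (f : ℝ → E) (t : ℝ) : E :=
  f 0 + ∑ p ∈ Finset.range n, coeffBlock (coeff f) p t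

/-- The density of `schauderSum n f`. -/
def dschauderSum (n : ℕ) (f : ℝ → E) (t : ℝ) : E :=
  ∑ p ∈ Finset.range n, dcoeffBlock (coeff f) p t

lemma sum_Icc_neg_one (n : ℕ) (g : ℤ → E) :
    ∑ q ∈ Finset.Icc (-1) ((n : ℤ) - 1), g q = g (-1) + ∑ p ∈ Finset.range n, g p := by
  induction n with
  | zero => simp
  | succ n ih =>
    have : Finset.Icc (-1) (((n + 1 : ℕ) : ℤ) - 1) =
        insert (n : ℤ) (Finset.Icc (-1) ((n : ℤ) - 1)) := by
      ext x; simp only [Finset.mem_Icc, Finset.mem_insert]; omega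
    rw [this, Finset.sum_insert (by simp), ih, Finset.sum_range_succ]
    abel

lemma partialSum_natCast_sub_one (n : ℕ) (f : ℝ → E) :
    partialSum ((n : ℤ) - 1) f = schauderSum n f := by
  ext t; exact sum_Icc_neg_one n fun q => block f q t

lemma dpartialSum_natCast_sub_one (n : ℕ) (f : ℝ → E) :
    dpartialSum ((n : ℤ) - 1) f = dschauderSum n f := by
  ext t
  refine (sum_Icc_neg_one n fun q => dblock f q t).trans ?_
  rw [show dblock f (-1) t = 0 from rfl, zero_add]; rfl

lemma partialSum_natCast (n : ℕ) (f : ℝ → E) : partialSum (n : ℤ) f = schauderSum (n + 1) f := by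
  rw [← partialSum_natCast_sub_one]; simp

lemma schauderSum_piecewiseAffine (n : ℕ) (f : ℝ → E) :
    PiecewiseAffine n (schauderSum n f) (dschauderSum n f) := by
  have h := (piecewiseAffine_const n (f 0)).add (PiecewiseAffine.sum (Finset.range n)
    fun p hp => (coeffBlock_piecewiseAffine (coeff f) p).mono (Finset.mem_range.1 hp))
  simp only [zero_add] at h
  exact h

lemma continuous_schauderSum (n : ℕ) (f : ℝ → E) : Continuous (schauderSum n f) :=
  continuous_const.add (continuous_finsetSum _ fun p _ => continuous_coeffBlock _ p)

lemma intervalIntegrable_dschauderSum (n : ℕ) (f : ℝ → E) (a b : ℝ) :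
    IntervalIntegrable (dschauderSum n f) volume a b := by
  have : dschauderSum n f = ∑ p ∈ Finset.range n, dcoeffBlock (coeff f) p := by
    ext t; simp [dschauderSum]
  rw [this]
  exact IntervalIntegrable.sum _ fun p _ => intervalIntegrable_dcoeffBlock _ p a b

lemma schauderSum_zero_right (n : ℕ) (f : ℝ → E) : schauderSum n f 0 = f 0 := by
  simp [schauderSum, coeffBlock_zero_zero]

lemma sd_schauderSum (n : ℕ) (f : ℝ → E) {q k : ℕ} (hk : k < 2 ^ q) :
    sd (schauderSum n f) q k = if q < n then sd f q k else 0 := by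
  unfold schauderSum
  rw [sd_add, sd_const, sd_sum, zero_add]
  simp only [sd_coeffBlock _ _ hk, Finset.sum_ite_eq', Finset.mem_range, coeff_succ]

lemma inc_schauderSum_zero_zero (n : ℕ) (f : ℝ → E) :
    inc (schauderSum n f) 0 0 = if n = 0 then 0 else inc f 0 0 := by
  unfold schauderSum
  rw [inc_add, inc_const, inc_sum, zero_add]
  simp only [inc_coeffBlock_zero_zero, Finset.sum_ite_eq', Finset.mem_range, coeff_zero_zero]
  rcases n with _ | n <;> simp

/-- The second difference recovers the midpoint value from the endpoint values, so the grid values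
follow level by level. -/
lemma eq_of_sd_eq {f g : ℝ → E} (q : ℕ) (h0 : f 0 = g 0) (h1 : inc f 0 0 = inc g 0 0)
    (h : ∀ p < q, ∀ k < 2 ^ p, sd f p k = sd g p k) {k : ℕ} (hk : k ≤ 2 ^ q) :
    f (dy q k) = g (dy q k) := by
  induction q generalizing k with
  | zero =>
    have : k = 0 ∨ k = 1 := by simp at hk; omega
    rcases this with rfl | rfl
    · rw [dy_zero, h0]
    · unfold inc at h1
      rw [dy_zero, h0] at h1
      exact sub_left_injective h1
  | succ q ih =>
    have ih' := fun {k} => ih (fun p hp => h p (by omega)) (k := k)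
    rcases Nat.even_or_odd' k with ⟨l, rfl | rfl⟩
    · rw [dy_succ_two_mul]; exact ih' (by rw [pow_succ] at hk; omega)
    · have hl : l < 2 ^ q := by rw [pow_succ] at hk; omega
      rw [apply_mid f, apply_mid g, ih' hl.le, ih' hl, h q (by omega) l hl]

/-- The partial sums interpolate `f` at the dyadic points. -/
lemma schauderSum_dy {n q k : ℕ} (f : ℝ → E) (hn : n ≠ 0) (hq : q ≤ n) (hk : k ≤ 2 ^ q) :
    schauderSum n f (dy q k) = f (dy q k) :=
  eq_of_sd_eq q (schauderSum_zero_right n f) (by rw [inc_schauderSum_zero_zero, if_neg hn])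
    (fun p hp k hk => by rw [sd_schauderSum n f hk, if_pos (by omega)]) hk

lemma inc_schauderSum {n q k : ℕ} (f : ℝ → E) (hn : n ≠ 0) (hq : q ≤ n) (hk : k < 2 ^ q) :
    inc (schauderSum n f) q k = inc f q k := by
  unfold inc; rw [schauderSum_dy f hn hq hk, schauderSum_dy f hn hq hk.le]

lemma coeff_schauderSum {n p m : ℕ} (f : ℝ → E) (hn : n ≠ 0) (hm : m ≤ 2 ^ p) :
    coeff (schauderSum n f) p m = if p < n then coeff f p m else 0 := by
  rcases m with _ | k
  · rcases p with _ | p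
    · rw [coeff_zero_zero, inc_schauderSum_zero_zero, coeff_zero_zero, if_neg hn,
        if_pos (Nat.pos_of_ne_zero hn)]
    · simp [coeff_succ_zero]
  · rw [coeff_succ, coeff_succ, sd_schauderSum n f hm]

lemma coeffBlock_schauderSum {n : ℕ} (f : ℝ → E) (hn : n ≠ 0) (p : ℕ) (t : ℝ) :
    coeffBlock (coeff (schauderSum n f)) p t = if p < n then coeffBlock (coeff f) p t else 0 := by
  unfold coeffBlock
  have h : ∀ m ∈ Finset.range (2 ^ p + 1), coeff (schauderSum n f) p m =
      if p < n then coeff f p m else 0 :=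
    fun m hm => coeff_schauderSum f hn (Finset.mem_range_succ_iff.1 hm)
  split_ifs with hp
  · exact Finset.sum_congr rfl fun m hm => by rw [h m hm, if_pos hp]
  · exact Finset.sum_eq_zero fun m hm => by rw [h m hm, if_neg hp, smul_zero]

lemma dcoeffBlock_schauderSum {n : ℕ} (f : ℝ → E) (hn : n ≠ 0) (p : ℕ) (t : ℝ) :
    dcoeffBlock (coeff (schauderSum n f)) p t =
      if p < n then dcoeffBlock (coeff f) p t else 0 := by
  unfold dcoeffBlock
  have h : ∀ m ∈ Finset.range (2 ^ p + 1), coeff (schauderSum n f) p m =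
      if p < n then coeff f p m else 0 :=
    fun m hm => coeff_schauderSum f hn (Finset.mem_range_succ_iff.1 hm)
  split_ifs with hp
  · exact Finset.sum_congr rfl fun m hm => by rw [h m hm, if_pos hp]
  · exact Finset.sum_eq_zero fun m hm => by rw [h m hm, if_neg hp, smul_zero]

lemma dschauderSum_schauderSum {n r : ℕ} (f : ℝ → E) (hn : n ≠ 0) (hr : r ≤ n) :
    dschauderSum r (schauderSum n f) = dschauderSum r f := by
  ext t
  refine Finset.sum_congr rfl fun p hp => ?_
  rw [dcoeffBlock_schauderSum f hn, if_pos ((Finset.mem_range.1 hp).trans_le hr)]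

end Blocks

/-! ### Exact integration of piecewise affine functions -/

section Trapezoid

variable {E F G : Type*} [NormedAddCommGroup E] [NormedSpace ℝ E]
  [NormedAddCommGroup F] [NormedSpace ℝ F] [NormedAddCommGroup G] [NormedSpace ℝ G]

/-- The trapezoid rule is exact for piecewise affine functions. -/
lemma integral_piecewiseAffine [CompleteSpace G] (B : E →L[ℝ] F →L[ℝ] G) {q k : ℕ}
    {g dg : ℝ → E} {w dw : ℝ → F}
    (hg : PiecewiseAffine q g dg) (hw : PiecewiseAffine q w dw) (hk : k < 2 ^ q) :
    ∫ s in dy q k..dy q (k + 1), B (g s) (dw s) =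
      (1 / 2 : ℝ) • B (g (dy q k) + g (dy q (k + 1))) (inc w q k) := by
  obtain ⟨a, b, h1, -⟩ := hg k hk
  obtain ⟨a', b', h1', h2'⟩ := hw k hk
  have hlt := dy_lt_succ q k
  have hcongr : ∫ s in dy q k..dy q (k + 1), B (g s) (dw s) =
      ∫ s in dy q k..dy q (k + 1), (s • B a a' + B b a') := by
    refine intervalIntegral.integral_congr_ae ?_
    -- The slope is only prescribed on the half-open interval closed on the left, whereas the
    -- interval integral runs over the one closed on the right; the two differ by a null set.
    have hne : ∀ᵐ s : ℝ, s ≠ dy q (k + 1) := by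
      simp [ae_iff]
    filter_upwards [hne] with s hs hmem
    rw [uIoc_of_le hlt.le] at hmem
    rw [h1 s ⟨hmem.1.le, hmem.2⟩, h2' s ⟨hmem.1.le, lt_of_le_of_ne hmem.2 hs⟩]
    simp
  rw [hcongr, intervalIntegral.integral_add
      ((by fun_prop : Continuous fun s : ℝ => s • B a a').intervalIntegrable _ _)
      (continuous_const.intervalIntegrable _ _),
    intervalIntegral.integral_smul_const, intervalIntegral.integral_const, integral_id]
  unfold inc
  rw [h1 _ ⟨le_rfl, hlt.le⟩, h1 _ ⟨hlt.le, le_rfl⟩, h1' _ ⟨le_rfl, hlt.le⟩,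
    h1' _ ⟨hlt.le, le_rfl⟩]
  simp only [map_add, map_sub, map_smul, add_apply,
    smul_apply]
  module

lemma intervalIntegrable_bilin (B : E →L[ℝ] F →L[ℝ] G) {g : ℝ → E} {dw : ℝ → F}
    (hg : Continuous g) {a b : ℝ} (hw : IntervalIntegrable dw volume a b) :
    IntervalIntegrable (fun s => B (g s) (dw s)) volume a b := by
  rw [intervalIntegrable_iff] at hw ⊢
  obtain ⟨C, hC⟩ := (isCompact_uIcc (a := a) (b := b)).exists_bound_of_continuousOn
    hg.continuousOn
  refine Integrable.mono' (g := fun s => ‖B‖ * C * ‖dw s‖) (hw.norm.const_mul _) ?_ ?_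
  · exact B.aestronglyMeasurable_comp₂ hg.aestronglyMeasurable hw.1
  · refine (ae_restrict_iff' measurableSet_uIoc).2 (Eventually.of_forall fun s hs => ?_)
    refine (B.le_opNorm₂ _ _).trans ?_
    gcongr
    exact hC s (uIoc_subset_uIcc hs)

lemma inc_integral {g : ℝ → G} (hg : ∀ a b, IntervalIntegrable g volume a b) (q k : ℕ) :
    inc (fun t => ∫ s in (0 : ℝ)..t, g s) q k = ∫ s in dy q k..dy q (k + 1), g s :=
  intervalIntegral.integral_interval_sub_left (hg _ _) (hg _ _)

end Trapezoid

/-! ### Scalar recursions and geometric sums -/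

/-- A quantity that is halved from one dyadic level to the next, up to an error of order `r ^ q`
with `1 / 2 < r`, is of order `r ^ q`. -/
lemma halving_recursion {r K : ℝ} (hr : 1 / 2 < r) (hr1 : r ≤ 1) (hK : 0 ≤ K) {u : ℕ → ℕ → ℝ}
    (h0 : u 0 0 ≤ K)
    (h : ∀ q k, k < 2 ^ q → u (q + 1) (2 * k) ≤ 1 / 2 * u q k + K * r ^ q ∧
      u (q + 1) (2 * k + 1) ≤ 1 / 2 * u q k + K * r ^ q) (q k : ℕ) (hk : k < 2 ^ q) :
    u q k ≤ 1 / (r - 1 / 2) * K * r ^ q := by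
  have hpos : 0 < r - 1 / 2 := by linarith
  -- The constant `c = 1 / (r - 1 / 2)` is the fixed point of the recursion, `c / 2 + 1 = c * r`;
  -- this is where `r > 1 / 2` enters.
  have hC : 1 / 2 * (1 / (r - 1 / 2)) + 1 = 1 / (r - 1 / 2) * r := by
    linear_combination -(one_div_mul_cancel hpos.ne')
  have hC1 : 1 ≤ 1 / (r - 1 / 2) := by rw [le_div_iff₀ hpos]; linarith
  induction q generalizing k with
  | zero =>
    have : k = 0 := by simpa using hk
    subst this
    nlinarith
  | succ q ih =>
    obtain ⟨l, hl, hkl⟩ := exists_half hk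
    have h1 := ih l hl
    have h2 : 1 / 2 * u q l + K * r ^ q ≤ 1 / (r - 1 / 2) * K * r ^ (q + 1) := by
      calc 1 / 2 * u q l + K * r ^ q
          ≤ 1 / 2 * (1 / (r - 1 / 2) * K * r ^ q) + K * r ^ q := by linarith
        _ = (1 / 2 * (1 / (r - 1 / 2)) + 1) * (K * r ^ q) := by ring
        _ = _ := by rw [hC]; ring
    rcases hkl with rfl | rfl
    · exact (h q l hl).1.trans h2
    · exact (h q l hl).2.trans h2

/-- The factor `1 / 4` comes from products of two increments of functions of level `p`, each halved
at every further subdivision. The constant `c` solves `c / 4 + ρ = c * ρ`. -/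
lemma sum_quarter_pow_le {ρ : ℝ} (hρ : 1 / 4 < ρ) (q : ℕ) :
    ∑ p ∈ Finset.range (q + 1), (1 / 4 : ℝ) ^ (q - p) * ρ ^ p ≤ ρ / (ρ - 1 / 4) * ρ ^ q := by
  have hpos : 0 < ρ - 1 / 4 := by linarith
  induction q with
  | zero =>
    simp only [zero_add, Finset.sum_range_one, Nat.sub_self, pow_zero, mul_one]
    rw [le_div_iff₀ hpos]; linarith
  | succ q ih =>
    rw [Finset.sum_range_succ]
    have : ∑ p ∈ Finset.range (q + 1), (1 / 4 : ℝ) ^ (q + 1 - p) * ρ ^ p =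
        1 / 4 * ∑ p ∈ Finset.range (q + 1), (1 / 4 : ℝ) ^ (q - p) * ρ ^ p := by
      rw [Finset.mul_sum]
      refine Finset.sum_congr rfl fun p hp => ?_
      rw [Nat.succ_sub (Finset.mem_range_succ_iff.1 hp), pow_succ]; ring
    rw [this, Nat.sub_self, pow_zero, one_mul]
    have hC : 1 / 4 * (ρ / (ρ - 1 / 4)) + ρ = ρ / (ρ - 1 / 4) * ρ := by
      linear_combination -(div_mul_cancel₀ ρ hpos.ne')
    calc _ ≤ 1 / 4 * (ρ / (ρ - 1 / 4) * ρ ^ q) + ρ ^ (q + 1) := by linarith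
      _ = (1 / 4 * (ρ / (ρ - 1 / 4)) + ρ) * ρ ^ q := by ring
      _ = _ := by rw [hC]; ring

/-! ### From coefficient bounds to bounds on dyadic increments and values -/

section Bounds

variable {E F : Type*} [NormedAddCommGroup E] [NormedSpace ℝ E]
  [NormedAddCommGroup F] [NormedSpace ℝ F]

/-- The Schauder coefficients of `f` of level `q` are bounded by `K * r ^ q`. -/
structure SBound (r K : ℝ) (f : ℝ → E) : Prop where
  zero : ‖f 0‖ ≤ K
  one : ‖inc f 0 0‖ ≤ K
  sd : ∀ q k, k < 2 ^ q → ‖sd f q k‖ ≤ K * r ^ q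

variable {r K : ℝ} {f : ℝ → E}

lemma SBound.nonneg (h : SBound r K f) : 0 ≤ K := (norm_nonneg _).trans h.zero

lemma SBound.norm_inc_le (h : SBound r K f) (hr : 1 / 2 < r) (hr1 : r ≤ 1) {q k : ℕ}
    (hk : k < 2 ^ q) : ‖inc f q k‖ ≤ 1 / (r - 1 / 2) * K * r ^ q := by
  have hK := h.nonneg
  refine halving_recursion hr hr1 hK (u := fun q k => ‖inc f q k‖) h.one (fun q k hk => ?_) q k hk
  have h1 := h.sd q k hk
  have h2 : 0 ≤ K * r ^ q := by positivity
  constructor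
  · rw [inc_left, norm_smul]
    have := norm_add_le (inc f q k) (Schauder.sd f q k)
    norm_num; linarith
  · rw [inc_right, norm_smul]
    have := norm_sub_le (inc f q k) (Schauder.sd f q k)
    norm_num; linarith

lemma SBound.norm_dy_le (h : SBound r K f) (hr : 0 < r) (hr1 : r < 1) {q k : ℕ}
    (hk : k ≤ 2 ^ q) : ‖f (dy q k)‖ ≤ (2 + 1 / (1 - r)) * K := by
  have hK := h.nonneg
  have hpos : 0 < 1 - r := by linarith
  -- The claim is strengthened by the tail of the geometric series, so that each level can spend its
  -- own term `K * r ^ q`.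
  suffices ‖f (dy q k)‖ ≤ (2 + 1 / (1 - r)) * K - 1 / (1 - r) * K * r ^ q by
    refine this.trans ?_
    have : 0 ≤ 1 / (1 - r) * K * r ^ q := by positivity
    linarith
  induction q generalizing k with
  | zero =>
    have h0 := h.zero
    have h1 := h.one
    have : k = 0 ∨ k = 1 := by simp at hk; omega
    rcases this with rfl | rfl
    · rw [dy_zero]; linarith [h0]
    · have : f (dy 0 1) = f 0 + inc f 0 0 := by unfold inc; rw [dy_zero]; module
      rw [this]
      have := norm_add_le (f 0) (inc f 0 0)
      linarith
  | succ q ih =>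
    have hstep : 1 / (1 - r) * K * r ^ q = K * r ^ q + 1 / (1 - r) * K * r ^ (q + 1) := by
      field_simp; ring
    have hp : 0 ≤ K * r ^ q := by positivity
    rcases Nat.even_or_odd' k with ⟨l, rfl | rfl⟩
    · rw [dy_succ_two_mul]
      have := ih (k := l) (by rw [pow_succ] at hk; omega)
      linarith
    · have hl : l < 2 ^ q := by rw [pow_succ] at hk; omega
      have h1 := ih hl.le
      have h2 := ih (k := l + 1) hl
      have h3 := h.sd q l hl
      rw [apply_mid f, norm_smul, Real.norm_of_nonneg (by norm_num : (0 : ℝ) ≤ 1 / 2)]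
      have := norm_add₃_le (a := f (dy q l)) (b := f (dy q (l + 1))) (c := Schauder.sd f q l)
      linarith

lemma SBound.schauderSum (h : SBound r K f) (hr : 0 ≤ r) (n : ℕ) : SBound r K (schauderSum n f) where
  zero := by rw [schauderSum_zero_right]; exact h.zero
  one := by
    rw [inc_schauderSum_zero_zero]; split_ifs
    · simpa using h.nonneg
    · exact h.one
  sd q k hk := by
    rw [sd_schauderSum n f hk]; split_ifs
    · exact h.sd q k hk
    · have := h.nonneg
      rw [norm_zero]; positivity

/-- Subdividing an interval on which `g` is affine splits the increment evenly. -/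
lemma norm_inc_add_le_of_piecewiseAffine {q k : ℕ} {M : ℝ} {g dg : ℝ → E}
    (hg : PiecewiseAffine q g dg) (h : ∀ k < 2 ^ q, ‖inc g q k‖ ≤ M) (j : ℕ)
    (hk : k < 2 ^ (q + j)) : ‖inc g (q + j) k‖ ≤ (1 / 2) ^ j * M := by
  induction j generalizing k with
  | zero => simpa using h k hk
  | succ j ih =>
    obtain ⟨l, hl, rfl | rfl⟩ := exists_half hk
    · have h1 := ih hl
      rw [← add_assoc, inc_left, (hg.mono (Nat.le_add_right q j)).sd_eq_zero hl, norm_smul,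
        pow_succ]
      norm_num at h1 ⊢; linarith
    · have h1 := ih hl
      rw [← add_assoc, inc_right, (hg.mono (Nat.le_add_right q j)).sd_eq_zero hl, norm_smul,
        pow_succ]
      norm_num at h1 ⊢; linarith

lemma SBound.norm_inc_schauderSum_le (h : SBound r K f) (hr : 1 / 2 < r) (hr1 : r ≤ 1)
    (p j : ℕ) {k : ℕ} (hk : k < 2 ^ (p + j)) :
    ‖inc (Schauder.schauderSum p f) (p + j) k‖ ≤ (1 / 2) ^ j * (1 / (r - 1 / 2) * K * r ^ p) :=
  norm_inc_add_le_of_piecewiseAffine (schauderSum_piecewiseAffine p f)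
    (fun _ hk => (h.schauderSum (by linarith) p).norm_inc_le hr hr1 hk) j hk

/-- The block is affine only from level `p + 1` on, so halving starts one level late; this accounts
for the factor `2`. -/
lemma SBound.norm_inc_coeffBlock_le (h : SBound r K f) (hr : 0 ≤ r)
    (p j : ℕ) {k : ℕ} (hk : k < 2 ^ (p + j)) :
    ‖inc (coeffBlock (coeff f) p) (p + j) k‖ ≤ (1 / 2) ^ j * (2 * K * r ^ p) := by
  have hK : 0 ≤ K * r ^ p := mul_nonneg h.nonneg (by positivity)
  have h0 : ∀ k < 2 ^ p, ‖inc (coeffBlock (coeff f) p) p k‖ ≤ K * r ^ p := by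
    intro k hk
    rcases eq_or_ne p 0 with rfl | hp
    · have hk0 : k = 0 := by simpa using hk
      rw [hk0, inc_coeffBlock_zero_zero, if_pos rfl, coeff_zero_zero]
      simpa using h.one
    · unfold inc
      rw [coeffBlock_dy _ hp le_rfl, coeffBlock_dy _ hp le_rfl]
      simpa using hK
  have h1 : ∀ k < 2 ^ (p + 1), ‖inc (coeffBlock (coeff f) p) (p + 1) k‖ ≤ K * r ^ p := by
    intro k hk
    obtain ⟨l, hl, hkl⟩ := exists_half hk
    have h2 := h0 l hl
    have h3 := h.sd p l hl
    rcases hkl with rfl | rfl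
    · rw [inc_left, sd_coeffBlock _ _ hl, if_pos rfl, coeff_succ, norm_smul]
      have := norm_add_le (inc (coeffBlock (coeff f) p) p l) (Schauder.sd f p l)
      norm_num; linarith
    · rw [inc_right, sd_coeffBlock _ _ hl, if_pos rfl, coeff_succ, norm_smul]
      have := norm_sub_le (inc (coeffBlock (coeff f) p) p l) (Schauder.sd f p l)
      norm_num; linarith
  rcases j with _ | j
  · have := h0 k hk
    simp only [pow_zero, one_mul, add_zero]; linarith
  · have h2 : k < 2 ^ (p + 1 + j) := by rwa [add_assoc, add_comm 1 j]
    have := norm_inc_add_le_of_piecewiseAffine (coeffBlock_piecewiseAffine (coeff f) p) h1 j h2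
    rw [add_assoc, add_comm 1 j] at this
    refine this.trans (le_of_eq ?_)
    rw [pow_succ]; ring

/-- These are the products of increments of low frequencies of `f` and blocks of `w` that occur both
in the paraproduct and in the Lévy area. Each term decays like `(1 / 4) ^ (q - p) * (r * s) ^ p`, so
the finest level dominates since `r * s > 1 / 4`. -/
lemma sum_norm_inc_mul_norm_inc_le {s L : ℝ} {w : ℝ → F} (hf : SBound r K f) (hw : SBound s L w)
    (hr : 1 / 2 < r) (hr1 : r ≤ 1) (hs : 1 / 2 < s) {q k : ℕ} (hk : k < 2 ^ q) :
    ∑ p ∈ Finset.range (q + 1),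
        ‖inc (schauderSum p f) q k‖ * ‖inc (coeffBlock (coeff w) p) q k‖ ≤
      2 / (r - 1 / 2) * (r * s / (r * s - 1 / 4)) * (K * L) * (r * s) ^ q := by
  have hK := hf.nonneg
  have hL := hw.nonneg
  have hr' : 0 < r - 1 / 2 := by linarith
  have hrs : 1 / 4 < r * s := by nlinarith
  have hr0 : 0 < r := by linarith
  have hs0 : 0 < s := by linarith
  have h1 : ∀ p ∈ Finset.range (q + 1),
      ‖inc (schauderSum p f) q k‖ * ‖inc (coeffBlock (coeff w) p) q k‖ ≤
      2 / (r - 1 / 2) * (K * L) * ((1 / 4) ^ (q - p) * (r * s) ^ p) := by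
    intro p hp
    obtain ⟨j, rfl⟩ := Nat.exists_eq_add_of_le (Finset.mem_range_succ_iff.1 hp)
    rw [Nat.add_sub_cancel_left]
    refine (mul_le_mul (hf.norm_inc_schauderSum_le hr hr1 p j hk)
      (hw.norm_inc_coeffBlock_le hs0.le p j hk) (norm_nonneg _) (by positivity)).trans
      (le_of_eq ?_)
    have : (1 / 4 : ℝ) ^ j = (1 / 2) ^ j * (1 / 2) ^ j := by rw [← mul_pow]; norm_num
    rw [this, mul_pow]; ring
  refine (Finset.sum_le_sum h1).trans ?_
  rw [← Finset.mul_sum]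
  refine (mul_le_mul_of_nonneg_left (sum_quarter_pow_le hrs q) (by positivity)).trans
    (le_of_eq (by ring))

end Bounds

/-! ### Functions with prescribed Schauder coefficients -/

section Synthesis

variable {E : Type*} [NormedAddCommGroup E] [NormedSpace ℝ E]

/-- The sum of a Schauder series. -/
def schauderSeries (c : ℕ → ℕ → E) (t : ℝ) : E := ∑' p : ℕ, coeffBlock c p t

lemma schauderSeries_dy (c : ℕ → ℕ → E) {n q : ℕ} (hn : n ≠ 0) (hq : q ≤ n) (k : ℕ) :
    schauderSeries c (dy q k) = ∑ p ∈ Finset.range n, coeffBlock c p (dy q k) := by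
  refine tsum_eq_sum fun p hp => ?_
  have : n ≤ p := by simpa using hp
  exact coeffBlock_dy c (by omega) (hq.trans this) k

lemma schauderSeries_zero_right (c : ℕ → ℕ → E) : schauderSeries c 0 = 0 := by
  simp [schauderSeries, coeffBlock_zero_zero]

lemma inc_schauderSeries_zero_zero (c : ℕ → ℕ → E) : inc (schauderSeries c) 0 0 = c 0 0 := by
  unfold inc
  rw [dy_zero, schauderSeries_zero_right, schauderSeries_dy c one_ne_zero zero_le_one]
  simp [dy_zero_one, coeffBlock_zero_one]

lemma sd_schauderSeries (c : ℕ → ℕ → E) {q k : ℕ} (hk : k < 2 ^ q) :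
    sd (schauderSeries c) q k = c q (k + 1) := by
  have h1 : sd (schauderSeries c) q k =
      sd (fun t => ∑ p ∈ Finset.range (q + 1), coeffBlock c p t) q k := by
    unfold sd
    rw [schauderSeries_dy c q.succ_ne_zero le_rfl, schauderSeries_dy c q.succ_ne_zero q.le_succ,
      schauderSeries_dy c q.succ_ne_zero q.le_succ]
  rw [h1, sd_sum]
  simp [sd_coeffBlock c _ hk]

lemma continuousOn_schauderSeries [CompleteSpace E] {c : ℕ → ℕ → E} {r K : ℝ} (hr : 0 ≤ r)
    (hr1 : r < 1) (h0 : ‖c 0 0‖ ≤ K) (h : ∀ q k, k < 2 ^ q → ‖c q (k + 1)‖ ≤ K * r ^ q) :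
    ContinuousOn (schauderSeries c) (Icc 0 1) := by
  refine continuousOn_tsum (u := fun p => K * r ^ p)
    (fun p => (continuous_coeffBlock c p).continuousOn)
    ((summable_geometric_of_lt_one hr hr1).mul_left K) fun p t ht => ?_
  refine norm_coeffBlock_le c p ?_ (h p) ht
  rintro rfl
  simpa using h0

end Synthesis

/-! ### Schauder coefficients of the paraproduct -/

section Paraproduct

variable {E F : Type*} [NormedAddCommGroup E] [NormedSpace ℝ E]
  [NormedAddCommGroup F] [NormedSpace ℝ F]

lemma paraproduct_eq (f : ℝ → E →L[ℝ] F) (w : ℝ → E) (t : ℝ) :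
    paraproduct f w t = ∑' p : ℕ, (schauderSum p f t) (coeffBlock (coeff w) p t) := by
  unfold paraproduct
  simp only [partialSum_natCast_sub_one, block_natCast]

lemma paraproduct_dy (f : ℝ → E →L[ℝ] F) (w : ℝ → E) {n q : ℕ} (hn : n ≠ 0) (hq : q ≤ n)
    (k : ℕ) : paraproduct f w (dy q k) =
      ∑ p ∈ Finset.range n, (schauderSum p f (dy q k)) (coeffBlock (coeff w) p (dy q k)) := by
  rw [paraproduct_eq]
  refine tsum_eq_sum fun p hp => ?_
  have : n ≤ p := by simpa using hp
  rw [coeffBlock_dy _ (by omega) (hq.trans this) k, map_zero]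

lemma paraproduct_zero_right (f : ℝ → E →L[ℝ] F) (w : ℝ → E) : paraproduct f w 0 = 0 := by
  simp [paraproduct_eq, coeffBlock_zero_zero]

lemma inc_paraproduct_zero_zero (f : ℝ → E →L[ℝ] F) (w : ℝ → E) :
    inc (paraproduct f w) 0 0 = f 0 (inc w 0 0) := by
  have h : paraproduct f w (dy 0 (0 + 1)) = f 0 (inc w 0 0) := by
    rw [paraproduct_dy f w one_ne_zero zero_le_one]
    simp [dy_zero_one, coeffBlock_zero_one, coeff_zero_zero, schauderSum]
  unfold inc
  rw [h, dy_zero, paraproduct_zero_right, sub_zero]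
  rw [inc, dy_zero]

/-- Product rule for second differences when the first factor is affine on the interval, so that its
own second difference drops out. -/
lemma sd_clm_apply {q k : ℕ} {g dg : ℝ → E →L[ℝ] F} (hg : PiecewiseAffine q g dg) (w : ℝ → E)
    (hk : k < 2 ^ q) : sd (fun t => g t (w t)) q k =
      g (dy (q + 1) (2 * k + 1)) (sd w q k) - (1 / 2 : ℝ) • inc g q k (inc w q k) := by
  have h := hg.sd_eq_zero hk
  have h1 := apply_mid g q k
  rw [h, add_zero] at h1
  simp only [inc, sd]
  rw [h1]
  simp only [map_sub, map_smul, sub_apply, add_apply, smul_apply]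
  module

lemma norm_schauderSum_mid_sub_le (f : ℝ → E) {q k : ℕ} (hk : k < 2 ^ q) :
    ‖schauderSum q f (dy (q + 1) (2 * k + 1)) - f (dy q k)‖ ≤ ‖inc f q k‖ := by
  rcases eq_or_ne q 0 with rfl | hq
  · have hk0 : k = 0 := by simpa using hk
    subst hk0
    simp [schauderSum, dy_zero]
  · rw [apply_mid (schauderSum q f), (schauderSum_piecewiseAffine q f).sd_eq_zero hk,
      schauderSum_dy f hq le_rfl hk.le, schauderSum_dy f hq le_rfl hk]
    have : (1 / 2 : ℝ) • (f (dy q k) + f (dy q (k + 1)) + 0) - f (dy q k) =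
        (1 / 2 : ℝ) • inc f q k := by unfold inc; module
    rw [this, norm_smul]
    norm_num
    linarith [norm_nonneg (inc f q k)]

/-- The Schauder coefficients of `π_<(f, w)` are those of `w` multiplied by `f`, up to an error of
the order given by the sum of the two regularities. -/
lemma norm_sd_paraproduct_sub_le {r s K L : ℝ} {f : ℝ → E →L[ℝ] F} {w : ℝ → E}
    (hf : SBound r K f) (hw : SBound s L w) (hr : 1 / 2 < r) (hr1 : r ≤ 1) (hs : 1 / 2 < s)
    {q k : ℕ} (hk : k < 2 ^ q) :
    ‖sd (paraproduct f w) q k - f (dy q k) (sd w q k)‖ ≤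
      (1 / (r - 1 / 2) + 1 / (r - 1 / 2) * (r * s / (r * s - 1 / 4))) * (K * L) * (r * s) ^ q := by
  -- Only the three points of the grid of level `q + 1` matter, and blocks of level `> q` vanish
  -- there.
  have hsd : sd (paraproduct f w) q k =
      ∑ p ∈ Finset.range (q + 1), sd (fun t => schauderSum p f t (coeffBlock (coeff w) p t)) q k := by
    rw [← sd_sum]
    unfold sd
    rw [paraproduct_dy f w q.succ_ne_zero le_rfl, paraproduct_dy f w q.succ_ne_zero q.le_succ,
      paraproduct_dy f w q.succ_ne_zero q.le_succ]
  -- Only the block of level `q` has a second difference at level `q`; it carries the main term, and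
  -- the remaining products of increments are errors.
  have hterm : ∀ p ∈ Finset.range (q + 1),
      sd (fun t => schauderSum p f t (coeffBlock (coeff w) p t)) q k =
        (if p = q then schauderSum q f (dy (q + 1) (2 * k + 1)) (sd w q k) else 0) -
          (1 / 2 : ℝ) • inc (schauderSum p f) q k (inc (coeffBlock (coeff w) p) q k) := by
    intro p hp
    rw [sd_clm_apply ((schauderSum_piecewiseAffine p f).mono (Finset.mem_range_succ_iff.1 hp)) _ hk,
      sd_coeffBlock _ _ hk]
    split_ifs with h
    · rw [h, coeff_succ]
    · rw [map_zero]
  rw [hsd, Finset.sum_congr rfl hterm, Finset.sum_sub_distrib, Finset.sum_ite_eq',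
    if_pos (by simp), ← Finset.smul_sum, sub_right_comm, ← sub_apply]
  refine (norm_sub_le _ _).trans ?_
  have h1 : ‖(schauderSum q f (dy (q + 1) (2 * k + 1)) - f (dy q k)) (sd w q k)‖ ≤
      1 / (r - 1 / 2) * (K * L) * (r * s) ^ q := by
    refine (ContinuousLinearMap.le_opNorm _ _).trans ?_
    refine (mul_le_mul ((norm_schauderSum_mid_sub_le f hk).trans (hf.norm_inc_le hr hr1 hk))
      (hw.sd q k hk) (norm_nonneg _) ?_).trans (le_of_eq ?_)
    · exact (norm_nonneg _).trans (hf.norm_inc_le hr hr1 hk)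
    · rw [mul_pow]; ring
  have h2 : ‖(1 / 2 : ℝ) • ∑ p ∈ Finset.range (q + 1),
      inc (schauderSum p f) q k (inc (coeffBlock (coeff w) p) q k)‖ ≤
      1 / (r - 1 / 2) * (r * s / (r * s - 1 / 4)) * (K * L) * (r * s) ^ q := by
    rw [norm_smul]
    have h3 : ‖∑ p ∈ Finset.range (q + 1),
        inc (schauderSum p f) q k (inc (coeffBlock (coeff w) p) q k)‖ ≤ _ :=
      (norm_sum_le _ _).trans ((Finset.sum_le_sum fun p _ =>
        ContinuousLinearMap.le_opNorm _ _).trans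
        (sum_norm_inc_mul_norm_inc_le hf hw hr hr1 hs hk))
    calc _ ≤ ‖(1 / 2 : ℝ)‖ * _ := mul_le_mul_of_nonneg_left h3 (norm_nonneg _)
      _ = _ := by norm_num; ring
  linarith

lemma SBound.norm_schauderSum_le {r K : ℝ} {f : ℝ → E} (hf : SBound r K f) (hr : 0 < r)
    (hr1 : r < 1) (n : ℕ) {t : ℝ} (ht : t ∈ Icc (0 : ℝ) 1) :
    ‖Schauder.schauderSum n f t‖ ≤ (2 + 1 / (1 - r)) * K :=
  (schauderSum_piecewiseAffine n f).norm_le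
    (fun _ hk => (hf.schauderSum hr.le n).norm_dy_le hr hr1 hk) ht

lemma SBound.norm_coeffBlock_le {r K : ℝ} {f : ℝ → E} (hf : SBound r K f) (p : ℕ) {t : ℝ}
    (ht : t ∈ Icc (0 : ℝ) 1) : ‖coeffBlock (coeff f) p t‖ ≤ K * r ^ p := by
  refine Schauder.norm_coeffBlock_le _ p ?_ (fun k hk => ?_) ht
  · rintro rfl
    rw [coeff_zero_zero, pow_zero, mul_one]; exact hf.one
  · rw [coeff_succ]; exact hf.sd p k hk

lemma continuousOn_paraproduct [CompleteSpace F] {r s K L : ℝ} {f : ℝ → E →L[ℝ] F} {w : ℝ → E}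
    (hf : SBound r K f) (hw : SBound s L w) (hr : 0 < r) (hr1 : r < 1) (hs : 0 < s)
    (hs1 : s < 1) : ContinuousOn (paraproduct f w) (Icc 0 1) := by
  have : paraproduct f w = fun t => ∑' p : ℕ, (schauderSum p f t) (coeffBlock (coeff w) p t) :=
    funext (paraproduct_eq f w)
  rw [this]
  refine continuousOn_tsum (u := fun p => (2 + 1 / (1 - r)) * K * (L * s ^ p))
    (fun p => ((continuous_schauderSum p f).clm_apply (continuous_coeffBlock _ p)).continuousOn)
    (((summable_geometric_of_lt_one hs.le hs1).mul_left L).mul_left _) fun p t ht => ?_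
  refine (ContinuousLinearMap.le_opNorm _ _).trans ?_
  exact mul_le_mul (hf.norm_schauderSum_le hr hr1 p ht) (hw.norm_coeffBlock_le p ht)
    (norm_nonneg _) ((norm_nonneg _).trans (hf.norm_schauderSum_le hr hr1 p ht))

end Paraproduct

/-! ### The Lévy area on dyadic intervals -/

section Levy

/-- The `p`-th term of the series defining the Lévy area. -/
def levyTerm (v w : ℝ → ℝ) (p : ℕ) (t : ℝ) : ℝ :=
  (∫ s in (0 : ℝ)..t, coeffBlock (coeff v) p s * dschauderSum p w s) -
    ∫ s in (0 : ℝ)..t, dschauderSum p v s * coeffBlock (coeff w) p s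

lemma levyTerm_zero (v w : ℝ → ℝ) (t : ℝ) : levyTerm v w 0 t = 0 := by
  simp [levyTerm, dschauderSum]

lemma levyTerm_schauderSum {n : ℕ} (v w : ℝ → ℝ) (hn : n ≠ 0) (p : ℕ) (t : ℝ) :
    levyTerm (schauderSum n v) (schauderSum n w) p t = if p < n then levyTerm v w p t else 0 := by
  unfold levyTerm
  simp only [coeffBlock_schauderSum _ hn]
  split_ifs with h
  · rw [dschauderSum_schauderSum _ hn h.le, dschauderSum_schauderSum _ hn h.le]
  · simp

lemma levyArea_eq (v w : ℝ → ℝ) (t : ℝ) : levyArea v w t = ∑' p : ℕ, levyTerm v w p t := by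
  unfold levyArea levyTerm
  simp only [dpartialSum_natCast_sub_one, block_natCast]

lemma levyArea_schauderSum {n : ℕ} (v w : ℝ → ℝ) (hn : n ≠ 0) (t : ℝ) :
    levyArea (schauderSum n v) (schauderSum n w) t =
      ∑ p ∈ Finset.range n, levyTerm v w p t := by
  rw [levyArea_eq]
  simp only [levyTerm_schauderSum v w hn]
  rw [tsum_eq_sum (s := Finset.range n)]
  · exact Finset.sum_congr rfl fun p hp => if_pos (Finset.mem_range.1 hp)
  · exact fun p hp => if_neg (by simpa using hp)

/-- Since `p < q`, both factors are affine on the interval, and the trapezoid rule is exact. -/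
lemma inc_levyTerm (v w : ℝ → ℝ) {p q k : ℕ} (hpq : p < q) (hk : k < 2 ^ q) :
    inc (levyTerm v w p) q k =
      1 / 2 * ((coeffBlock (coeff v) p (dy q k) + coeffBlock (coeff v) p (dy q (k + 1))) *
        inc (schauderSum p w) q k) -
      1 / 2 * (inc (schauderSum p v) q k *
        (coeffBlock (coeff w) p (dy q k) + coeffBlock (coeff w) p (dy q (k + 1)))) := by
  have hi : ∀ (f g : ℝ → ℝ) (a b : ℝ), IntervalIntegrable
      (fun s => coeffBlock (coeff f) p s * dschauderSum p g s) volume a b := fun f g a b =>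
    intervalIntegrable_bilin (ContinuousLinearMap.mul ℝ ℝ) (continuous_coeffBlock _ p)
      (intervalIntegrable_dschauderSum p g a b)
  have ht : ∀ f g : ℝ → ℝ, inc (fun t => ∫ s in (0 : ℝ)..t,
      coeffBlock (coeff f) p s * dschauderSum p g s) q k = 1 / 2 *
      ((coeffBlock (coeff f) p (dy q k) + coeffBlock (coeff f) p (dy q (k + 1))) *
        inc (schauderSum p g) q k) := fun f g => by
    rw [inc_integral (hi f g)]
    exact integral_piecewiseAffine (ContinuousLinearMap.mul ℝ ℝ)
      ((coeffBlock_piecewiseAffine (coeff f) p).mono hpq)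
      ((schauderSum_piecewiseAffine p g).mono hpq.le) hk
  unfold levyTerm
  simp only [mul_comm (dschauderSum p v _)]
  rw [inc_sub, ht, ht]
  ring

lemma inc_schauderSum_halves {p q k : ℕ} (w : ℝ → ℝ) (hpq : p ≤ q) (hk : k < 2 ^ q) :
    inc (schauderSum p w) (q + 1) (2 * k) = 1 / 2 * inc (schauderSum p w) q k ∧
      inc (schauderSum p w) (q + 1) (2 * k + 1) = 1 / 2 * inc (schauderSum p w) q k := by
  rw [inc_left, inc_right, ((schauderSum_piecewiseAffine p w).mono hpq).sd_eq_zero hk]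
  simp

/-- For `p ≤ q` the partial sum has equal increments over the two halves, so the midpoint values of
the blocks cancel and only products of increments remain. -/
lemma sd_levyTerm (v w : ℝ → ℝ) {p q k : ℕ} (hpq : p ≤ q) (hk : k < 2 ^ q) :
    sd (levyTerm v w p) q k =
      -(1 / 4) * (inc (coeffBlock (coeff v) p) q k * inc (schauderSum p w) q k -
        inc (schauderSum p v) q k * inc (coeffBlock (coeff w) p) q k) := by
  have hk1 := two_mul_lt_pow hk
  rw [sd_eq, inc_levyTerm v w (Nat.lt_succ_of_le hpq) (by omega),
    inc_levyTerm v w (Nat.lt_succ_of_le hpq) hk1, (inc_schauderSum_halves w hpq hk).1,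
    (inc_schauderSum_halves w hpq hk).2, (inc_schauderSum_halves v hpq hk).1,
    (inc_schauderSum_halves v hpq hk).2, dy_succ_two_mul, dy_succ_two_mul_add_two]
  unfold inc
  ring

/-- The contribution of one dyadic interval to the Lévy area. -/
def localArea (v w : ℝ → ℝ) (q k : ℕ) : ℝ :=
  1 / 4 * (sd v q k * inc w q k - inc v q k * sd w q k)

/-- The block of level `q` is here a single tent of height `sd / 2`, integrated against a constant
slope. For `q = 0` the left side vanishes, because the partial sum below level `0` is constant,
while `localArea` need not. -/
lemma inc_levyTerm_self (v w : ℝ → ℝ) {q k : ℕ} (hq : q ≠ 0) (hk : k < 2 ^ q) :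
    inc (levyTerm v w q) q k = localArea v w q k := by
  have hk1 := two_mul_lt_pow hk
  rw [inc_split, inc_levyTerm v w (Nat.lt_succ_self q) (by omega),
    inc_levyTerm v w (Nat.lt_succ_self q) hk1, (inc_schauderSum_halves w le_rfl hk).1,
    (inc_schauderSum_halves w le_rfl hk).2, (inc_schauderSum_halves v le_rfl hk).1,
    (inc_schauderSum_halves v le_rfl hk).2, dy_succ_two_mul, dy_succ_two_mul_add_two,
    coeffBlock_mid _ hq hk, coeffBlock_mid _ hq hk, coeffBlock_dy _ hq le_rfl,
    coeffBlock_dy _ hq le_rfl, coeffBlock_dy _ hq le_rfl, coeffBlock_dy _ hq le_rfl,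
    inc_schauderSum v hq le_rfl hk, inc_schauderSum w hq le_rfl hk, coeff_succ, coeff_succ]
  unfold localArea
  simp only [smul_eq_mul]
  ring

/-- The increments of the Lévy area `A` without the contributions of the levels `< q`. -/
def area (v w A : ℝ → ℝ) (q k : ℕ) : ℝ :=
  inc A q k - ∑ p ∈ Finset.range q, inc (levyTerm v w p) q k +
    -- The Lévy term of level `0` is zero, so `A` lacks the local area of the whole interval; adding
    -- it makes the splitting identity valid from level `0` on.
    if q = 0 then localArea v w 0 0 else 0

/-- Discrete form of Chen's relation. The local area is minus the additivity defect of the trapezoid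
rule for `∫ v dw`, which is why adding the area repairs that rule. -/
lemma area_split (v w A : ℝ → ℝ) {q k : ℕ} (hk : k < 2 ^ q) :
    area v w A q k =
      localArea v w q k + area v w A (q + 1) (2 * k) + area v w A (q + 1) (2 * k + 1) := by
  unfold area
  rw [inc_split A q k, if_neg q.succ_ne_zero]
  simp only [inc_split _ q k]
  rw [Finset.sum_range_succ, Finset.sum_range_succ, Finset.sum_add_distrib]
  have h := inc_split (levyTerm v w q) q k
  rcases eq_or_ne q 0 with rfl | hq
  · have hk0 : k = 0 := by simpa using hk
    subst hk0
    have h0 : levyTerm v w 0 = fun _ => 0 := funext (levyTerm_zero v w)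
    rw [h0, inc_const, inc_const, if_pos rfl]
    ring
  · rw [inc_levyTerm_self v w hq hk] at h
    rw [if_neg hq, h]
    ring

lemma area_left_sub_right (v w A : ℝ → ℝ) (q k : ℕ) :
    area v w A (q + 1) (2 * k) - area v w A (q + 1) (2 * k + 1) =
      sd A q k - ∑ p ∈ Finset.range (q + 1), sd (levyTerm v w p) q k := by
  unfold area
  rw [if_neg q.succ_ne_zero]
  simp only [sd_eq _ q k]
  rw [Finset.sum_sub_distrib]
  ring

/-- A truncated path has no Lévy terms of level `≥ n`, so subtracting the levels `< q` leaves
nothing. -/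
lemma area_schauderSum {n : ℕ} (v w : ℝ → ℝ) (hn : n ≠ 0) {q : ℕ} (hq : n ≤ q) (k : ℕ) :
    area (schauderSum n v) (schauderSum n w)
      (levyArea (schauderSum n v) (schauderSum n w)) q k = 0 := by
  have h1 : levyArea (schauderSum n v) (schauderSum n w) =
      fun t => ∑ p ∈ Finset.range n, levyTerm v w p t := funext (levyArea_schauderSum v w hn)
  have h2 : ∀ p, levyTerm (schauderSum n v) (schauderSum n w) p =
      if p < n then levyTerm v w p else fun _ => 0 := fun p => by
    ext t; rw [levyTerm_schauderSum v w hn]; split_ifs <;> rfl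
  unfold area
  rw [h1, inc_sum, if_neg (by omega), add_zero, sub_eq_zero]
  refine Finset.sum_subset_zero_on_sdiff (by simpa using hq) (fun p hp => ?_) fun p hp => ?_
  · rw [h2, if_neg (by simpa using (Finset.mem_sdiff.1 hp).2), inc_const]
  · rw [h2, if_pos (Finset.mem_range.1 hp)]

lemma area_schauderSum_eq {n : ℕ} (v w A : ℝ → ℝ) (hn : n ≠ 0) {q : ℕ} (hq : q ≤ n) (k : ℕ) :
    area (schauderSum n v) (schauderSum n w) A q k = area v w A q k := by
  have h2 : ∀ p < n, levyTerm (schauderSum n v) (schauderSum n w) p = levyTerm v w p :=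
    fun p hp => by ext t; rw [levyTerm_schauderSum v w hn, if_pos hp]
  have h3 : localArea (schauderSum n v) (schauderSum n w) 0 0 = localArea v w 0 0 := by
    unfold localArea
    rw [sd_schauderSum _ _ (by simp), sd_schauderSum _ _ (by simp),
      inc_schauderSum_zero_zero, inc_schauderSum_zero_zero, if_neg hn, if_neg hn,
      if_pos (by omega), if_pos (by omega)]
  unfold area
  rw [h3]
  congr 2
  exact Finset.sum_congr rfl fun p hp => by rw [h2 p ((Finset.mem_range.1 hp).trans_le hq)]

lemma abs_localArea_le {r K : ℝ} {v w : ℝ → ℝ} (hv : SBound r K v) (hw : SBound r K w)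
    (hr : 1 / 2 < r) (hr1 : r ≤ 1) {q k : ℕ} (hk : k < 2 ^ q) :
    |localArea v w q k| ≤ 1 / (r - 1 / 2) * K ^ 2 * (r ^ 2) ^ q := by
  have h1 := hv.sd q k hk
  have h2 := hw.sd q k hk
  have h3 := hv.norm_inc_le hr hr1 hk
  have h4 := hw.norm_inc_le hr hr1 hk
  have h5 : |sd v q k * inc w q k| ≤ (K * r ^ q) * (1 / (r - 1 / 2) * K * r ^ q) := by
    rw [abs_mul]
    exact mul_le_mul h1 h4 (abs_nonneg _) ((norm_nonneg _).trans h1)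
  have h6 : |inc v q k * sd w q k| ≤ (1 / (r - 1 / 2) * K * r ^ q) * (K * r ^ q) := by
    rw [abs_mul]
    exact mul_le_mul h3 h2 (abs_nonneg _) ((norm_nonneg _).trans h3)
  have h7 := abs_sub (sd v q k * inc w q k) (inc v q k * sd w q k)
  have h8 : (K * r ^ q) * (1 / (r - 1 / 2) * K * r ^ q) = 1 / (r - 1 / 2) * K ^ 2 * (r ^ 2) ^ q := by
    rw [← pow_mul, mul_comm 2 q, pow_mul]; ring
  have h9 := (abs_nonneg _).trans h5
  unfold localArea
  rw [abs_mul, abs_of_pos (by norm_num : (0 : ℝ) < 1 / 4)]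
  linarith

/-- A constant for the bound of the differences of the areas of adjacent intervals. -/
def areaConst (r : ℝ) : ℝ := 1 / 2 * (2 / (r - 1 / 2) * (r * r / (r * r - 1 / 4)))

lemma areaConst_nonneg {r : ℝ} (hr : 1 / 2 < r) : 0 ≤ areaConst r := by
  have h1 : 0 < r - 1 / 2 := by linarith
  have h2 : 0 < r * r - 1 / 4 := by nlinarith
  have h3 : 0 < r := by linarith
  unfold areaConst; positivity

lemma abs_area_left_sub_right_le {r K L : ℝ} {v w A : ℝ → ℝ} (hv : SBound r K v)
    (hw : SBound r K w) (hA : ∀ q k, k < 2 ^ q → |sd A q k| ≤ L * (r ^ 2) ^ q)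
    (hr : 1 / 2 < r) (hr1 : r ≤ 1) {q k : ℕ} (hk : k < 2 ^ q) :
    |area v w A (q + 1) (2 * k) - area v w A (q + 1) (2 * k + 1)| ≤
      (L + areaConst r * K ^ 2) * (r ^ 2) ^ q := by
  rw [area_left_sub_right]
  have h1 := sum_norm_inc_mul_norm_inc_le hw hv hr hr1 hr hk
  have h2 := sum_norm_inc_mul_norm_inc_le hv hw hr hr1 hr hk
  have h3 : |∑ p ∈ Finset.range (q + 1), sd (levyTerm v w p) q k| ≤
      ∑ p ∈ Finset.range (q + 1), (1 / 4 *
        (‖inc (schauderSum p w) q k‖ * ‖inc (coeffBlock (coeff v) p) q k‖) + 1 / 4 *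
        (‖inc (schauderSum p v) q k‖ * ‖inc (coeffBlock (coeff w) p) q k‖)) := by
    refine (Finset.abs_sum_le_sum_abs _ _).trans (Finset.sum_le_sum fun p hp => ?_)
    rw [sd_levyTerm v w (Finset.mem_range_succ_iff.1 hp) hk, abs_mul, abs_neg,
      abs_of_pos (by norm_num : (0 : ℝ) < 1 / 4), ← norm_mul, ← norm_mul, Real.norm_eq_abs,
      Real.norm_eq_abs, ← mul_add]
    refine mul_le_mul_of_nonneg_left ((abs_sub _ _).trans (le_of_eq ?_)) (by norm_num)
    rw [mul_comm (inc (coeffBlock (coeff v) p) q k)]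
  rw [Finset.sum_add_distrib, ← Finset.mul_sum, ← Finset.mul_sum] at h3
  have h4 := hA q k hk
  have h5 := abs_sub (sd A q k) (∑ p ∈ Finset.range (q + 1), sd (levyTerm v w p) q k)
  have h6 : (L + areaConst r * K ^ 2) * (r ^ 2) ^ q = L * (r ^ 2) ^ q + 1 / 2 *
      (2 / (r - 1 / 2) * (r * r / (r * r - 1 / 4)) * (K * K) * (r * r) ^ q) := by
    unfold areaConst; rw [← sq]; ring
  linarith

/-- The areas of the two halves are known through their sum (the parent area minus the local area)
and their difference (controlled by the coefficients of `A`). This yields a halving recursion from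
the coarsest level downwards. It needs a rate `z > 1 / 2`, so `z` may have to exceed `r ^ 2`, in
particular when `r ^ 2 = 1 / 2`. -/
lemma abs_area_le {r z K L : ℝ} {v w A : ℝ → ℝ} (hv : SBound r K v) (hw : SBound r K w)
    (hA : SBound (r ^ 2) L A) (hr : 1 / 2 < r) (hr1 : r ≤ 1) (hz : 1 / 2 < z) (hz1 : z ≤ 1)
    (hrz : r ^ 2 ≤ z) {q k : ℕ} (hk : k < 2 ^ q) :
    |area v w A q k| ≤
      1 / (z - 1 / 2) * (L + (areaConst r + 1 / (r - 1 / 2)) * K ^ 2) * z ^ q := by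
  have hL := hA.nonneg
  have hK := hv.nonneg
  have hc := areaConst_nonneg hr
  have hr' : 0 < r - 1 / 2 := by linarith
  refine halving_recursion hz hz1 (by positivity) (u := fun q k => |area v w A q k|) ?_ ?_ q k hk
  · have h1 := abs_localArea_le hv hw hr hr1 (q := 0) (k := 0) (by simp)
    have h2 := hA.one
    have h3 := abs_add_le (inc A 0 0) (localArea v w 0 0)
    simp only [area, Finset.range_zero, Finset.sum_empty, sub_zero, if_true]
    rw [Real.norm_eq_abs] at h2
    rw [pow_zero, mul_one] at h1
    have h4 : 0 ≤ areaConst r * K ^ 2 := by positivity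
    linarith
  · intro q k hk
    have h1 := abs_localArea_le hv hw hr hr1 hk
    have h2 := abs_area_left_sub_right_le hv hw hA.sd hr hr1 hk
    have h3 := area_split v w A hk
    have h4 : (r ^ 2) ^ q ≤ z ^ q := pow_le_pow_left₀ (by positivity) hrz q
    have h5 := mul_le_mul_of_nonneg_left h4
      (by positivity : 0 ≤ L + (areaConst r + 1 / (r - 1 / 2)) * K ^ 2)
    set a := area v w A q k
    set b := area v w A (q + 1) (2 * k)
    set c := area v w A (q + 1) (2 * k + 1)
    set l := localArea v w q k
    have h6 : |b - c| + |l| ≤ (L + (areaConst r + 1 / (r - 1 / 2)) * K ^ 2) * z ^ q := by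
      linarith
    have h7 : 0 ≤ |b - c| + |l| := by positivity
    have h8 : b = 1 / 2 * (a + (b - c) - l) := by linarith
    have h9 : c = 1 / 2 * (a - (b - c) - l) := by linarith
    have habs : ∀ x y w : ℝ, |1 / 2 * (x + y - w)| ≤ 1 / 2 * |x| + 1 / 2 * (|y| + |w|) := by
      intro x y w
      rw [abs_mul, abs_of_pos (by norm_num : (0 : ℝ) < 1 / 2)]
      linarith [abs_sub (x + y) w, abs_add_le x y]
    have h10 := habs a (b - c) l
    have h11 := habs a (-(b - c)) l
    rw [abs_neg, ← sub_eq_add_neg] at h11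
    rw [← h8] at h10
    rw [← h9] at h11
    constructor <;> linarith

end Levy

/-! ### The dyadic sewing lemma -/

section Sewing

variable {F : Type*} [NormedAddCommGroup F] [NormedSpace ℝ F]

/-- The defect of additivity of a function of dyadic intervals. -/
def defect (X : ℕ → ℕ → F) (q k : ℕ) : F := X q k - X (q + 1) (2 * k) - X (q + 1) (2 * k + 1)

lemma norm_le_of_defect {X : ℕ → ℕ → F} {q k : ℕ} {a b : ℝ} (h : ‖defect X q k‖ ≤ a)
    (h1 : ‖X (q + 1) (2 * k)‖ ≤ b) (h2 : ‖X (q + 1) (2 * k + 1)‖ ≤ b) :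
    ‖X q k‖ ≤ 2 * b + a := by
  have : X q k = X (q + 1) (2 * k) + X (q + 1) (2 * k + 1) + defect X q k := by
    unfold defect; abel
  rw [this]
  linarith [norm_add₃_le (a := X (q + 1) (2 * k)) (b := X (q + 1) (2 * k + 1)) (c := defect X q k)]

lemma sewing_const {θ : ℝ} (h : θ < 1 / 2) :
    2 * θ * (1 / (1 - 2 * θ)) + 1 = 1 / (1 - 2 * θ) := by
  have : 1 - 2 * θ ≠ 0 := by linarith
  linear_combination -(one_div_mul_cancel this)

/-- An almost additive function of dyadic intervals which vanishes on fine scales is small. -/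
lemma norm_le_of_defect_of_eq_zero {θ K : ℝ} (hθ : 0 ≤ θ) (hθ1 : θ < 1 / 2) (hK : 0 ≤ K)
    {X : ℕ → ℕ → F} (hX : ∀ q k, k < 2 ^ q → ‖defect X q k‖ ≤ K * θ ^ q) {n : ℕ}
    (h0 : ∀ q k, n ≤ q → k < 2 ^ q → X q k = 0) (q k : ℕ) (hk : k < 2 ^ q) :
    ‖X q k‖ ≤ 1 / (1 - 2 * θ) * K * θ ^ q := by
  have hpos : 0 < 1 - 2 * θ := by linarith
  -- Induction on the number `j` of levels left before `X` vanishes. The two halves together cost a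
  -- factor `2 * θ < 1`, and `1 / (1 - 2 * θ)` is the sum of the geometric series.
  have key : ∀ j q k, n ≤ q + j → k < 2 ^ q → ‖X q k‖ ≤ 1 / (1 - 2 * θ) * K * θ ^ q := by
    intro j
    induction j with
    | zero => intro q k hq hk; rw [h0 q k hq hk, norm_zero]; positivity
    | succ j ih =>
      intro q k hq hk
      have hk1 := two_mul_lt_pow hk
      refine (norm_le_of_defect (hX q k hk) (ih (q + 1) (2 * k) (by omega) (by omega))
        (ih (q + 1) (2 * k + 1) (by omega) hk1)).trans (le_of_eq ?_)
      rw [pow_succ]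
      linear_combination (K * θ ^ q) * sewing_const hθ1
  exact key n q k (by omega) hk

/-- The bound of an almost additive function of dyadic intervals depends on its defect only. -/
lemma norm_le_of_defect_of_norm_le {θ K K' : ℝ} (hθ : 0 ≤ θ) (hθ1 : θ < 1 / 2)
    {X : ℕ → ℕ → F} (hX : ∀ q k, k < 2 ^ q → ‖defect X q k‖ ≤ K * θ ^ q)
    (h0 : ∀ q k, k < 2 ^ q → ‖X q k‖ ≤ K' * θ ^ q) (hK : 0 ≤ K) (q k : ℕ) (hk : k < 2 ^ q) :
    ‖X q k‖ ≤ 1 / (1 - 2 * θ) * K * θ ^ q := by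
  have hpos : 0 < 1 - 2 * θ := by linarith
  -- Each refinement multiplies the a priori constant `K'` by `2 * θ`, so it disappears in the limit
  -- and only the defect constant `K` survives.
  have key : ∀ j q k, k < 2 ^ q →
      ‖X q k‖ ≤ (1 / (1 - 2 * θ) * K + (2 * θ) ^ j * K') * θ ^ q := by
    intro j
    induction j with
    | zero =>
      intro q k hk
      refine (h0 q k hk).trans (mul_le_mul_of_nonneg_right ?_ (by positivity))
      have : 0 ≤ 1 / (1 - 2 * θ) * K := by positivity
      linarith
    | succ j ih =>
      intro q k hk
      have hk1 := two_mul_lt_pow hk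
      refine (norm_le_of_defect (hX q k hk) (ih (q + 1) (2 * k) (by omega))
        (ih (q + 1) (2 * k + 1) hk1)).trans (le_of_eq ?_)
      rw [pow_succ, pow_succ]
      linear_combination (K * θ ^ q) * sewing_const hθ1
  have hlim : Tendsto (fun j : ℕ => (1 / (1 - 2 * θ) * K + (2 * θ) ^ j * K') * θ ^ q) atTop
      (𝓝 ((1 / (1 - 2 * θ) * K + 0 * K') * θ ^ q)) :=
    (((tendsto_pow_atTop_nhds_zero_of_lt_one (by positivity) (by linarith)).mul_const K').const_add
      _).mul_const _
  rw [zero_mul, add_zero] at hlim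
  exact ge_of_tendsto' hlim fun j => key j q k hk

lemma cauchySeq_of_approx {u : ℕ → F}
    (h : ∀ ε > 0, ∃ b : ℕ → F, CauchySeq b ∧ ∀ n, ‖u n - b n‖ ≤ ε) : CauchySeq u := by
  rw [Metric.cauchySeq_iff]
  intro ε hε
  obtain ⟨b, hb, hub⟩ := h (ε / 4) (by positivity)
  obtain ⟨N, hN⟩ := Metric.cauchySeq_iff.1 hb (ε / 4) (by positivity)
  refine ⟨N, fun m hm n hn => ?_⟩
  have h1 := hN m hm n hn
  have h2 := hub m
  have h3 := hub n
  rw [← dist_eq_norm] at h2 h3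
  have h4 := dist_triangle4 (u m) (b m) (b n) (u n)
  rw [dist_comm (b n)] at h4
  linarith

/-- The sum of `X` over the `2 ^ j` subintervals `j` levels further. -/
def refineSum (X : ℕ → ℕ → F) : ℕ → ℕ → ℕ → F
  | 0 => X
  | j + 1 => fun q k => refineSum X j (q + 1) (2 * k) + refineSum X j (q + 1) (2 * k + 1)

/-- Convergence of additive functions of dyadic intervals which are approximated by convergent
almost additive ones. -/
lemma exists_sewing_limit [CompleteSpace F] {θ K K' : ℝ} (hθ : 0 ≤ θ) (hθ1 : θ < 1 / 2)
    (hK : 0 ≤ K) (hK' : 0 ≤ K') {J X : ℕ → ℕ → ℕ → F} {Y : ℕ → ℕ → F}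
    (hJ : ∀ n q k, defect (J n) q k = 0)
    (hJX : ∀ n q k, n < q → k < 2 ^ q → J n q k = X n q k)
    (hX : ∀ n q k, k < 2 ^ q → ‖defect (X n) q k‖ ≤ K' * θ ^ q)
    (hXY : ∀ q k, k < 2 ^ q → Tendsto (fun n => X n q k) atTop (𝓝 (Y q k)))
    (hY : ∀ q k, k < 2 ^ q → ‖defect Y q k‖ ≤ K * θ ^ q) :
    (∀ n q k, k < 2 ^ q → ‖J n q k - X n q k‖ ≤ 1 / (1 - 2 * θ) * K' * θ ^ q) ∧
    ∃ j : ℕ → ℕ → F, (∀ q k, k < 2 ^ q → Tendsto (fun n => J n q k) atTop (𝓝 (j q k))) ∧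
      ∀ q k, k < 2 ^ q → ‖j q k - Y q k‖ ≤ 1 / (1 - 2 * θ) * K * θ ^ q := by
  have hpos : 0 < 1 - 2 * θ := by linarith
  have hbound : ∀ n q k, k < 2 ^ q →
      ‖J n q k - X n q k‖ ≤ 1 / (1 - 2 * θ) * K' * θ ^ q := by
    intro n
    refine norm_le_of_defect_of_eq_zero hθ hθ1 hK' (X := fun q k => J n q k - X n q k) (n := n + 1)
      (fun q k hk => ?_) fun q k hq hk => sub_eq_zero.2 (hJX n q k hq hk)
    have : defect (fun q k => J n q k - X n q k) q k = defect (J n) q k - defect (X n) q k := by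
      simp only [defect]; abel
    rw [this, hJ, zero_sub, norm_neg]
    exact hX n q k hk
  -- Additivity of `J n` allows summing its error over the `2 ^ j` subintervals. The result is small
  -- uniformly in `n`, while for fixed `j` the refined sum of `X n` converges; hence `J n q k` is
  -- Cauchy.
  have happrox : ∀ n j q k, k < 2 ^ q → ‖J n q k - refineSum (X n) j q k‖ ≤
      (2 * θ) ^ j * (1 / (1 - 2 * θ) * K' * θ ^ q) := by
    intro n j
    induction j with
    | zero => intro q k hk; simpa [refineSum] using hbound n q k hk
    | succ j ih =>
      intro q k hk
      have hk1 := two_mul_lt_pow hk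
      have h1 := ih (q + 1) (2 * k) (by omega)
      have h2 := ih (q + 1) (2 * k + 1) hk1
      have h3 := hJ n q k
      have : J n q k - refineSum (X n) (j + 1) q k =
          (J n (q + 1) (2 * k) - refineSum (X n) j (q + 1) (2 * k)) +
          (J n (q + 1) (2 * k + 1) - refineSum (X n) j (q + 1) (2 * k + 1)) +
          defect (J n) q k := by
        simp only [refineSum, defect]; abel
      rw [this, h3, add_zero]
      refine (norm_add_le _ _).trans ((add_le_add h1 h2).trans (le_of_eq ?_))
      rw [pow_succ, pow_succ]; ring
  have hconv : ∀ j q k, k < 2 ^ q →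
      ∃ y, Tendsto (fun n => refineSum (X n) j q k) atTop (𝓝 y) := by
    intro j
    induction j with
    | zero => exact fun q k hk => ⟨_, hXY q k hk⟩
    | succ j ih =>
      intro q k hk
      have hk1 := two_mul_lt_pow hk
      obtain ⟨y, hy⟩ := ih (q + 1) (2 * k) (by omega)
      obtain ⟨y', hy'⟩ := ih (q + 1) (2 * k + 1) hk1
      exact ⟨_, hy.add hy'⟩
  have hlim : ∀ q k, k < 2 ^ q → ∃ y, Tendsto (fun n => J n q k) atTop (𝓝 y) := by
    intro q k hk
    refine cauchySeq_tendsto_of_complete (cauchySeq_of_approx fun ε hε => ?_)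
    have h0 : Tendsto (fun j : ℕ => (2 * θ) ^ j * (1 / (1 - 2 * θ) * K' * θ ^ q)) atTop
        (𝓝 (0 * (1 / (1 - 2 * θ) * K' * θ ^ q))) :=
      (tendsto_pow_atTop_nhds_zero_of_lt_one (by positivity) (by linarith)).mul_const _
    rw [zero_mul] at h0
    obtain ⟨j, hj⟩ := (h0.eventually (ge_mem_nhds hε)).exists
    obtain ⟨y, hy⟩ := hconv j q k hk
    exact ⟨_, hy.cauchySeq, fun n => (happrox n j q k hk).trans hj⟩
  refine ⟨hbound, ?_⟩
  choose! j hj using hlim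
  refine ⟨j, hj, ?_⟩
  -- The passage to the limit only gives the constant `K'` of the approximations. It serves as the a
  -- priori bound and is then improved to the constant `K` of the limiting germ.
  refine norm_le_of_defect_of_norm_le hθ hθ1 (X := fun q k => j q k - Y q k)
    (K' := 1 / (1 - 2 * θ) * K') (fun q k hk => ?_) (fun q k hk => ?_) hK
  · have h1 : defect j q k = 0 := by
      have hk1 := two_mul_lt_pow hk
      have := ((hj q k hk).sub (hj (q + 1) (2 * k) (by omega))).sub (hj (q + 1) (2 * k + 1) hk1)
      exact tendsto_nhds_unique this (by simpa [defect] using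
        (tendsto_const_nhds (x := (0 : F))).congr fun n => (hJ n q k).symm)
    have : defect (fun q k => j q k - Y q k) q k = defect j q k - defect Y q k := by
      simp only [defect]; abel
    rw [this, h1, zero_sub, norm_neg]
    exact hY q k hk
  · exact le_of_tendsto' ((hj q k hk).sub (hXY q k hk)).norm fun n => hbound n q k hk

end Sewing

/-! ### The trapezoid germ and controlled paths -/

section Germ

variable {E F : Type*} [NormedAddCommGroup E] [NormedSpace ℝ E]
  [NormedAddCommGroup F] [NormedSpace ℝ F]

/-- The trapezoid rule for `∫ f dv` on a dyadic interval. -/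
def trapezoid (f : ℝ → E →L[ℝ] F) (v : ℝ → E) (q k : ℕ) : F :=
  (1 / 2 : ℝ) • (f (dy q k) + f (dy q (k + 1))) (inc v q k)

/-- The defect is antisymmetric in `f` and `v`. Its generic size is the product of the two
regularities, which is summable over subintervals only above regularity `1 / 2`. -/
lemma defect_trapezoid (f : ℝ → E →L[ℝ] F) (v : ℝ → E) (q k : ℕ) :
    defect (trapezoid f v) q k =
      (1 / 4 : ℝ) • (inc f q k (sd v q k) - sd f q k (inc v q k)) := by
  unfold defect trapezoid
  rw [inc_left v, inc_right v, dy_succ_two_mul, dy_succ_two_mul_add_two, apply_mid f, inc.eq_1 f]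
  simp only [map_add, map_sub, map_smul, add_apply, sub_apply, smul_apply]
  module

lemma trapezoid_left_sub_right (f : ℝ → E →L[ℝ] F) (v : ℝ → E) (q k : ℕ) :
    trapezoid f v (q + 1) (2 * k) - trapezoid f v (q + 1) (2 * k + 1) - f (dy q k) (sd v q k) =
      (1 / 2 : ℝ) • inc f (q + 1) (2 * k) (inc v (q + 1) (2 * k)) -
        (1 / 2 : ℝ) • (inc f (q + 1) (2 * k) + inc f q k) (inc v (q + 1) (2 * k + 1)) := by
  unfold trapezoid
  rw [sd_eq v]
  simp only [inc, map_sub, add_apply, sub_apply, dy_succ_two_mul,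
    dy_succ_two_mul_add_two]
  module

variable {x y K L : ℝ} {f : ℝ → E →L[ℝ] F} {v : ℝ → E}

lemma SBound.norm_inc_succ_le {G : Type*} [NormedAddCommGroup G] [NormedSpace ℝ G] {g : ℝ → G}
    (hg : SBound x K g) (hx : 1 / 2 < x)
    (hx1 : x ≤ 1) {q k : ℕ} (hk : k < 2 ^ (q + 1)) :
    ‖inc g (q + 1) k‖ ≤ 1 / (x - 1 / 2) * K * x ^ q := by
  have hK := hg.nonneg
  have hx' : 0 < x - 1 / 2 := by linarith
  have hx0 : 0 < x := by linarith
  refine (hg.norm_inc_le hx hx1 hk).trans ?_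
  rw [pow_succ]
  refine mul_le_mul_of_nonneg_left ?_ (by positivity)
  exact mul_le_of_le_one_right (by positivity) hx1

lemma norm_trapezoid_left_sub_right_le (hf : SBound x K f) (hv : SBound x L v) (hx : 1 / 2 < x)
    (hx1 : x ≤ 1) {q k : ℕ} (hk : k < 2 ^ q) :
    ‖trapezoid f v (q + 1) (2 * k) - trapezoid f v (q + 1) (2 * k + 1) - f (dy q k) (sd v q k)‖ ≤
      3 / 2 * (1 / (x - 1 / 2)) ^ 2 * (K * L) * (x ^ 2) ^ q := by
  have hk1 := two_mul_lt_pow hk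
  rw [trapezoid_left_sub_right]
  have h1 := hf.norm_inc_succ_le hx hx1 (q := q) (k := 2 * k) (by omega)
  have h2 := hf.norm_inc_le hx hx1 hk
  have h3 := hv.norm_inc_succ_le hx hx1 (q := q) (k := 2 * k) (by omega)
  have h4 := hv.norm_inc_succ_le hx hx1 hk1
  set c := 1 / (x - 1 / 2)
  have h5 := (inc f (q + 1) (2 * k)).le_of_opNorm_le_of_le h1 h3
  have h6 := (inc f (q + 1) (2 * k) + inc f q k).le_of_opNorm_le_of_le
    ((norm_add_le _ _).trans (add_le_add h1 h2)) h4
  refine (norm_sub_le _ _).trans ?_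
  rw [norm_smul, norm_smul, Real.norm_of_nonneg (by norm_num : (0 : ℝ) ≤ 1 / 2)]
  have h7 : 3 / 2 * c ^ 2 * (K * L) * (x ^ 2) ^ q =
      3 / 2 * ((c * K * x ^ q) * (c * L * x ^ q)) := by rw [← pow_mul, mul_comm 2 q, pow_mul]; ring
  rw [h7]
  linarith

lemma norm_trapezoid_zero_le (hf : SBound x K f) (hv : SBound x L v) :
    ‖trapezoid f v 0 0‖ ≤ 3 / 2 * (K * L) := by
  have h1 := hf.zero
  have h2 := hf.one
  have h3 : f (dy 0 0) + f (dy 0 (0 + 1)) = f 0 + f 0 + inc f 0 0 := by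
    unfold inc; rw [dy_zero]; abel
  unfold trapezoid
  rw [h3, norm_smul, Real.norm_of_nonneg (by norm_num : (0 : ℝ) ≤ 1 / 2)]
  have := (f 0 + f 0 + inc f 0 0).le_of_opNorm_le_of_le
    (norm_add₃_le.trans (add_le_add (add_le_add h1 h1) h2)) hv.one
  linarith

/-- The estimates on an approximation `X` of the integral `∫ f dv` over dyadic intervals which
allow to construct the integral and to show that it is paracontrolled. -/
structure GermBound (θ x M : ℝ) (f : ℝ → E →L[ℝ] F) (v : ℝ → E) (X : ℕ → ℕ → F) : Prop where
  defect : ∀ q k, k < 2 ^ q → ‖defect X q k‖ ≤ M * θ ^ q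
  sd : ∀ q k, k < 2 ^ q →
    ‖X (q + 1) (2 * k) - X (q + 1) (2 * k + 1) - f (dy q k) (sd v q k)‖ ≤ M * (x ^ 2) ^ q
  zero : ‖X 0 0‖ ≤ M

/-- The Young case: no derivative and no area are needed for these estimates. They become useful for
sewing when `x ^ 2 < 1 / 2`. -/
lemma germBound_trapezoid (hf : SBound x K f) (hv : SBound x L v) (hx : 1 / 2 < x)
    (hx1 : x ≤ 1) : GermBound (x ^ 2) x
      ((3 / 2 * (1 / (x - 1 / 2)) ^ 2 + 1 / (x - 1 / 2) + 3 / 2) * (K * L)) f v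
      (trapezoid f v) := by
  have hK := hf.nonneg
  have hL := hv.nonneg
  have hx' : 0 < x - 1 / 2 := by linarith
  have hx0 : 0 < x := by linarith
  constructor
  · intro q k hk
    rw [defect_trapezoid, norm_smul, Real.norm_of_nonneg (by norm_num : (0 : ℝ) ≤ 1 / 4)]
    have h1 := (inc f q k).le_of_opNorm_le_of_le (hf.norm_inc_le hx hx1 hk) (hv.sd q k hk)
    have h2 := (Schauder.sd f q k).le_of_opNorm_le_of_le (hf.sd q k hk) (hv.norm_inc_le hx hx1 hk)
    have h3 := norm_sub_le (inc f q k (Schauder.sd v q k)) (Schauder.sd f q k (inc v q k))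
    set c := 1 / (x - 1 / 2)
    have h4 : (3 / 2 * c ^ 2 + c + 3 / 2) * (K * L) * (x ^ 2) ^ q =
      (3 / 2 * c ^ 2 + c + 3 / 2) * (K * x ^ q * (L * x ^ q)) := by
      rw [← pow_mul, mul_comm 2 q, pow_mul]; ring
    rw [h4]
    have h5 : 0 ≤ c := by positivity
    have h6 : 0 ≤ K * x ^ q * (L * x ^ q) := by positivity
    nlinarith [mul_nonneg h5 h6, mul_nonneg (sq_nonneg c) h6]
  · intro q k hk
    refine (norm_trapezoid_left_sub_right_le hf hv hx hx1 hk).trans ?_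
    have : 0 ≤ 1 / (x - 1 / 2) + 3 / 2 := by positivity
    gcongr
    linarith
  · refine (norm_trapezoid_zero_le hf hv).trans ?_
    have : 0 ≤ 3 / 2 * (1 / (x - 1 / 2)) ^ 2 + 1 / (x - 1 / 2) := by positivity
    gcongr
    linarith

/-- `f` is controlled by `v` with derivative `f'` on the level of the Schauder coefficients. -/
structure Controlled {G : Type*} [NormedAddCommGroup G] [NormedSpace ℝ G] (ρ R : ℝ) (v : ℝ → E)
    (f : ℝ → G) (f' : ℝ → E →L[ℝ] G) : Prop where
  one : ‖inc f 0 0 - f' 0 (inc v 0 0)‖ ≤ R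
  sd : ∀ q k, k < 2 ^ q → ‖sd f q k - f' (dy q k) (sd v q k)‖ ≤ R * ρ ^ q

lemma Controlled.nonneg {G : Type*} [NormedAddCommGroup G] [NormedSpace ℝ G] {ρ R : ℝ} {f : ℝ → G}
    {f' : ℝ → E →L[ℝ] G} (h : Controlled ρ R v f f') : 0 ≤ R := (norm_nonneg _).trans h.one

lemma Controlled.schauderSum {G : Type*} [NormedAddCommGroup G] [NormedSpace ℝ G] {ρ R : ℝ}
    {f : ℝ → G} {f' : ℝ → E →L[ℝ] G} (h : Controlled ρ R v f f') (hρ : 0 ≤ ρ) {n : ℕ}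
    (hn : n ≠ 0) : Controlled ρ R (schauderSum n v) (schauderSum n f) f' where
  one := by
    rw [inc_schauderSum_zero_zero, inc_schauderSum_zero_zero, if_neg hn, if_neg hn]
    exact h.one
  sd q k hk := by
    rw [sd_schauderSum _ _ hk, sd_schauderSum _ _ hk]
    split_ifs
    · exact h.sd q k hk
    · have := h.nonneg
      rw [map_zero, sub_zero, norm_zero]; positivity

/-- Controlled paths satisfy the increment expansion of rough path theory. -/
lemma Controlled.norm_inc_sub_le {G : Type*} [NormedAddCommGroup G] [NormedSpace ℝ G]
    {R K' : ℝ} {f : ℝ → G} {f' : ℝ → E →L[ℝ] G}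
    (h : Controlled (x * y) R v f f') (hf' : SBound y K' f') (hv : SBound x L v)
    (hx : 1 / 2 < x) (hx1 : x ≤ 1) (hy : 1 / 2 < y) (hy1 : y ≤ 1) (hxy : 1 / 2 < x * y)
    {q k : ℕ} (hk : k < 2 ^ q) :
    ‖inc f q k - f' (dy q k) (inc v q k)‖ ≤ 1 / (x * y - 1 / 2) *
      (R + 1 / (y - 1 / 2) * (1 / (x - 1 / 2) + 1) * (K' * L)) * (x * y) ^ q := by
  have hR := h.nonneg
  have hK := hf'.nonneg
  have hL := hv.nonneg
  have hx' : 0 < x - 1 / 2 := by linarith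
  have hy' : 0 < y - 1 / 2 := by linarith
  have hx0 : 0 < x := by linarith
  have hy0 : 0 < y := by linarith
  refine halving_recursion hxy (mul_le_one₀ hx1 hy0.le hy1) (by positivity)
    (u := fun q k => ‖inc f q k - f' (dy q k) (inc v q k)‖) ?_ (fun q k hk => ?_) q k hk
  · have h1 := h.one
    have h2 : 0 ≤ 1 / (y - 1 / 2) * (1 / (x - 1 / 2) + 1) * (K' * L) := by positivity
    simp only [dy_zero]
    linarith
  have h1 := h.sd q k hk
  have h2 := hf'.norm_inc_succ_le hy hy1 (q := q) (k := 2 * k) (by have := two_mul_lt_pow hk; omega)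
  have h3 := (norm_sub_le _ _).trans (add_le_add (hv.norm_inc_le hx hx1 hk) (hv.sd q k hk))
  have h4 := (inc f' (q + 1) (2 * k)).le_of_opNorm_le_of_le h2 h3
  have h5 : (R + 1 / (y - 1 / 2) * (1 / (x - 1 / 2) + 1) * (K' * L)) * (x * y) ^ q =
      R * (x * y) ^ q + 1 / (y - 1 / 2) * K' * y ^ q *
        (1 / (x - 1 / 2) * L * x ^ q + L * x ^ q) := by rw [mul_pow]; ring
  have h6 := (norm_nonneg _).trans h4
  have h7 := (norm_nonneg _).trans h1
  rw [h5]
  constructor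
  · have : inc f (q + 1) (2 * k) - f' (dy (q + 1) (2 * k)) (inc v (q + 1) (2 * k)) =
        (1 / 2 : ℝ) • ((inc f q k - f' (dy q k) (inc v q k)) +
          (Schauder.sd f q k - f' (dy q k) (Schauder.sd v q k))) := by
      rw [inc_left, inc_left, dy_succ_two_mul]
      simp only [map_add, map_smul]; module
    rw [this, norm_smul, Real.norm_of_nonneg (by norm_num : (0 : ℝ) ≤ 1 / 2)]
    linarith [norm_add_le (inc f q k - f' (dy q k) (inc v q k))
      (Schauder.sd f q k - f' (dy q k) (Schauder.sd v q k))]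
  -- On the right half the base point moves to the midpoint; the increment of `f'` over the left
  -- half produces the third term.
  · have : inc f (q + 1) (2 * k + 1) - f' (dy (q + 1) (2 * k + 1)) (inc v (q + 1) (2 * k + 1)) =
        (1 / 2 : ℝ) • ((inc f q k - f' (dy q k) (inc v q k)) +
          -(Schauder.sd f q k - f' (dy q k) (Schauder.sd v q k)) +
          -(inc f' (q + 1) (2 * k)) (inc v q k - Schauder.sd v q k)) := by
      rw [inc_right, inc_right, inc.eq_1 f', dy_succ_two_mul]
      simp only [map_sub, map_smul, sub_apply]; module
    rw [this, norm_smul, Real.norm_of_nonneg (by norm_num : (0 : ℝ) ≤ 1 / 2)]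
    have := norm_add₃_le (a := inc f q k - f' (dy q k) (inc v q k))
      (b := -(Schauder.sd f q k - f' (dy q k) (Schauder.sd v q k)))
      (c := -(inc f' (q + 1) (2 * k)) (inc v q k - Schauder.sd v q k))
    rw [norm_neg, norm_neg] at this
    linarith

end Germ

/-! ### Contraction of the second-order derivative with an area matrix -/

section Contraction

variable {d : ℕ} {F : Type*} [NormedAddCommGroup F] [NormedSpace ℝ F]

/-- The contraction of a bilinear map with a matrix. -/
def contract (b : EuclideanSpace ℝ (Fin d) →L[ℝ] EuclideanSpace ℝ (Fin d) →L[ℝ] F)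
    (A : Fin d → Fin d → ℝ) : F :=
  ∑ i, ∑ j, A i j • b (EuclideanSpace.single i 1) (EuclideanSpace.single j 1)

variable (b b' : EuclideanSpace ℝ (Fin d) →L[ℝ] EuclideanSpace ℝ (Fin d) →L[ℝ] F)
  (A A' : Fin d → Fin d → ℝ)

lemma contract_add : contract b (fun i j => A i j + A' i j) = contract b A + contract b A' := by
  simp [contract, add_smul, Finset.sum_add_distrib]

lemma contract_sub : contract b (fun i j => A i j - A' i j) = contract b A - contract b A' := by
  simp [contract, sub_smul, Finset.sum_sub_distrib]

lemma contract_smul (c : ℝ) : contract b (fun i j => c * A i j) = c • contract b A := by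
  simp [contract, mul_smul, Finset.smul_sum]

lemma contract_sub_left : contract (b - b') A = contract b A - contract b' A := by
  simp [contract, smul_sub, Finset.sum_sub_distrib]

lemma contract_outer (v w : EuclideanSpace ℝ (Fin d)) :
    contract b (fun i j => v i * w j) = b v w := by
  have h : ∀ u : EuclideanSpace ℝ (Fin d),
      u = ∑ i, u i • EuclideanSpace.single i (1 : ℝ) := fun u => by
    ext j; simp [Pi.single_apply]
  conv_rhs => rw [h v, h w]
  simp only [map_sum, map_smul, sum_apply, smul_apply, contract, Finset.smul_sum, mul_smul]
  rw [Finset.sum_comm]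
  exact Finset.sum_congr rfl fun _ _ => Finset.sum_congr rfl fun _ _ => smul_comm _ _ _

lemma norm_contract_le {M N : ℝ} (hb : ‖b‖ ≤ N) (hA : ∀ i j, |A i j| ≤ M) :
    ‖contract b A‖ ≤ (d : ℝ) ^ 2 * (N * M) := by
  have h : ∀ i j, ‖A i j • b (EuclideanSpace.single i 1) (EuclideanSpace.single j 1)‖ ≤ N * M := by
    intro i j
    have h1 := (b.le_opNorm₂ (EuclideanSpace.single i 1) (EuclideanSpace.single j 1)).trans
      (mul_le_mul_of_nonneg_right (mul_le_mul_of_nonneg_right hb (norm_nonneg _)) (norm_nonneg _))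
    simp only [PiLp.norm_single, norm_one, mul_one] at h1
    rw [norm_smul, mul_comm N]
    exact mul_le_mul (hA i j) h1 (norm_nonneg _) ((abs_nonneg _).trans (hA i j))
  refine (norm_sum_le _ _).trans ((Finset.sum_le_sum fun i _ => (norm_sum_le _ _).trans
    (Finset.sum_le_sum fun j _ => h i j)).trans (le_of_eq ?_))
  simp; ring

end Contraction

/-! ### The trapezoid germ corrected by the area -/

section AreaGerm

variable {d : ℕ} {F : Type*} [NormedAddCommGroup F] [NormedSpace ℝ F]

/-- The matrix of areas of a path. -/
def areaMatrix (v : ℝ → EuclideanSpace ℝ (Fin d)) (A : ℝ → EuclideanSpace ℝ (Fin d × Fin d))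
    (q k : ℕ) (i j : Fin d) : ℝ :=
  area (fun t => v t i) (fun t => v t j) (fun t => A t (i, j)) q k

/-- The trapezoid rule for `∫ f dv` corrected by the area of `v`. -/
def areaGerm (v : ℝ → EuclideanSpace ℝ (Fin d)) (A : ℝ → EuclideanSpace ℝ (Fin d × Fin d))
    (f : ℝ → EuclideanSpace ℝ (Fin d) →L[ℝ] F)
    (f' : ℝ → EuclideanSpace ℝ (Fin d) →L[ℝ] EuclideanSpace ℝ (Fin d) →L[ℝ] F)
    (q k : ℕ) : F :=
  trapezoid f v q k + contract (f' (dy q k)) (areaMatrix v A q k)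

variable {v : ℝ → EuclideanSpace ℝ (Fin d)} {A : ℝ → EuclideanSpace ℝ (Fin d × Fin d)}
  {f : ℝ → EuclideanSpace ℝ (Fin d) →L[ℝ] F}
  {f' : ℝ → EuclideanSpace ℝ (Fin d) →L[ℝ] EuclideanSpace ℝ (Fin d) →L[ℝ] F}
  {x y z K K' L R a : ℝ}

lemma SBound.apply {ι : Type*} [Fintype ι] {r : ℝ} {v : ℝ → EuclideanSpace ℝ ι}
    (h : SBound r K v) (i : ι) : SBound r K (fun t => v t i) where
  zero := (PiLp.norm_apply_le _ i).trans h.zero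
  one := (PiLp.norm_apply_le (inc v 0 0) i).trans h.one
  sd q k hk := (PiLp.norm_apply_le (Schauder.sd v q k) i).trans (h.sd q k hk)

lemma areaMatrix_split {q k : ℕ} (hk : k < 2 ^ q) : areaMatrix v A q k = fun i j =>
    1 / 4 * (sd v q k i * inc v q k j - inc v q k i * sd v q k j) + areaMatrix v A (q + 1) (2 * k) i j
      + areaMatrix v A (q + 1) (2 * k + 1) i j := by
  ext i j
  exact area_split _ _ _ hk

/-- The local area in `areaMatrix_split` cancels the trapezoid defect of the linear part `f' v` of
`f`. What remains involves the remainders of the expansion of `f`, of order `x * y`, multiplied by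
`v`, and the variation of `f'` multiplied by the area. -/
lemma defect_areaGerm {q k : ℕ} (hk : k < 2 ^ q) : defect (areaGerm v A f f') q k =
    (1 / 4 : ℝ) • ((inc f q k - f' (dy q k) (inc v q k)) (sd v q k) -
      (sd f q k - f' (dy q k) (sd v q k)) (inc v q k)) -
      contract (inc f' (q + 1) (2 * k)) (areaMatrix v A (q + 1) (2 * k + 1)) := by
  have h : defect (areaGerm v A f f') q k = defect (trapezoid f v) q k +
      contract (f' (dy q k)) (areaMatrix v A q k) -
      contract (f' (dy (q + 1) (2 * k))) (areaMatrix v A (q + 1) (2 * k)) -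
      contract (f' (dy (q + 1) (2 * k + 1))) (areaMatrix v A (q + 1) (2 * k + 1)) := by
    unfold defect areaGerm; abel
  rw [h, defect_trapezoid, areaMatrix_split hk, contract_add, contract_add, contract_smul,
    contract_sub, contract_outer, contract_outer, inc.eq_1 f', contract_sub_left, dy_succ_two_mul]
  simp only [sub_apply]
  module

/-- The constant in the estimates for `areaMatrix`. -/
def areaBound (x z K L : ℝ) : ℝ :=
  (1 / (z - 1 / 2) + 1) * ((areaConst x + 1 / (x - 1 / 2) + 1) * (L + K ^ 2))

lemma abs_areaMatrix_le (hv : SBound x K v) (hA : SBound (x ^ 2) L A) (hx : 1 / 2 < x)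
    (hx1 : x ≤ 1) (hz : 1 / 2 < z) (hz1 : z ≤ 1) (hxz : x ^ 2 ≤ z) {q k : ℕ} (hk : k < 2 ^ q)
    (i j : Fin d) : |areaMatrix v A q k i j| ≤ areaBound x z K L * z ^ q := by
  refine (abs_area_le (hv.apply i) (hv.apply j) (hA.apply (i, j)) hx hx1 hz hz1 hxz hk).trans ?_
  have h1 := areaConst_nonneg hx
  have h2 := hA.nonneg
  have hx' : 0 < x - 1 / 2 := by linarith
  have hz' : 0 < z - 1 / 2 := by linarith
  unfold areaBound
  refine mul_le_mul_of_nonneg_right (mul_le_mul (by linarith) ?_ (by positivity) (by positivity))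
    (by positivity)
  have : 0 ≤ (areaConst x + 1 / (x - 1 / 2)) * L := by positivity
  nlinarith [sq_nonneg K]

lemma abs_areaMatrix_left_sub_right_le (hv : SBound x K v) (hA : SBound (x ^ 2) L A)
    (hx : 1 / 2 < x) (hx1 : x ≤ 1) (hz : 1 / 2 < z) {q k : ℕ} (hk : k < 2 ^ q)
    (i j : Fin d) :
    |areaMatrix v A (q + 1) (2 * k) i j - areaMatrix v A (q + 1) (2 * k + 1) i j| ≤
      areaBound x z K L * (x ^ 2) ^ q := by
  refine (abs_area_left_sub_right_le (hv.apply i) (hv.apply j) (hA.apply (i, j)).sd hx hx1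
    hk).trans (mul_le_mul_of_nonneg_right ?_ (by positivity))
  have h1 := areaConst_nonneg hx
  have h2 := hA.nonneg
  have hx' : 0 < x - 1 / 2 := by linarith
  have hz' : 0 < z - 1 / 2 := by linarith
  have h3 : 0 ≤ (areaConst x + 1 / (x - 1 / 2) + 1) * (L + K ^ 2) := by positivity
  have h4 : 0 ≤ 1 / (z - 1 / 2) * ((areaConst x + 1 / (x - 1 / 2) + 1) * (L + K ^ 2)) := by
    positivity
  have h5 : 0 ≤ (areaConst x + 1 / (x - 1 / 2)) * L := by positivity
  have h6 : 0 ≤ 1 / (x - 1 / 2) * K ^ 2 := by positivity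
  unfold areaBound
  nlinarith [sq_nonneg K]

end AreaGerm

/-! ### Estimates, convergence and choice of the germ -/

section AreaGerm

variable {d : ℕ} {F : Type*} [NormedAddCommGroup F] [NormedSpace ℝ F]

-- Here `z` is the decay rate of the area, so the defect decays at the rate `z * y` of (area) times
-- (increment of `f'`). The other defect terms have rate `x ^ 2 * y ≤ z * y`. The condition `z * y ≤
-- x ^ 2` makes the variation of `f'` negligible in the comparison with `f (sd v)`.
set_option maxHeartbeats 800000 in
lemma germBound_areaGerm (d : ℕ) {x y z : ℝ} (hx : 1 / 2 < x) (hxy : x ≤ y) (hy1 : y < 1)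
    (hxy' : 1 / 2 < x * y) (hz : 1 / 2 < z) (hz1 : z ≤ 1) (hxz : x ^ 2 ≤ z)
    (hzy : z * y ≤ x ^ 2) :
    ∃ C, 0 ≤ C ∧ ∀ (v : ℝ → EuclideanSpace ℝ (Fin d)) (A : ℝ → EuclideanSpace ℝ (Fin d × Fin d))
      (f : ℝ → EuclideanSpace ℝ (Fin d) →L[ℝ] F)
      (f' : ℝ → EuclideanSpace ℝ (Fin d) →L[ℝ] EuclideanSpace ℝ (Fin d) →L[ℝ] F)
      (K K' L R a : ℝ), SBound x K f → SBound x L v → SBound y K' f' →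
      Controlled (x * y) R v f f' → SBound (x ^ 2) a A →
      GermBound (z * y) x (C * (K * L + (R + K' * L) * L + K' * (a + L ^ 2))) f v
        (areaGerm v A f f') := by
  have hx0 : 0 < x := by linarith
  have hy0 : 0 < y := by linarith
  have hz0 : 0 < z := by linarith
  have hx1 : x ≤ 1 := by linarith
  obtain ⟨cx, hcx, hcx0⟩ : ∃ c, c = 1 / (x - 1 / 2) ∧ 0 ≤ c :=
    ⟨_, rfl, one_div_nonneg.2 (by linarith)⟩
  obtain ⟨cy, hcy, hcy0⟩ : ∃ c, c = 1 / (y - 1 / 2) ∧ 0 ≤ c :=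
    ⟨_, rfl, one_div_nonneg.2 (by linarith)⟩
  obtain ⟨cp, hcp, hcp0⟩ : ∃ c, c = 1 / (x * y - 1 / 2) ∧ 0 ≤ c :=
    ⟨_, rfl, one_div_nonneg.2 (by linarith)⟩
  obtain ⟨cs, hcs, hcs0⟩ : ∃ c, c = 2 + 1 / (1 - y) ∧ 0 ≤ c :=
    ⟨_, rfl, add_nonneg zero_le_two (one_div_nonneg.2 (by linarith))⟩
  obtain ⟨cb, hcb, hcb0⟩ : ∃ c, c = (1 / (z - 1 / 2) + 1) * (areaConst x + 1 / (x - 1 / 2) + 1) ∧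
      0 ≤ c := by
    have h1 := areaConst_nonneg hx
    have h2 : 0 < z - 1 / 2 := by linarith
    have h3 : 0 < x - 1 / 2 := by linarith
    exact ⟨_, rfl, by positivity⟩
  have hD : (0 : ℝ) ≤ (d : ℝ) ^ 2 := by positivity
  refine ⟨(1 / 4 * (cp * (1 + cy * (cx + 1)) + cx) + d ^ 2 * (cy * cb)) +
    (3 / 2 * cx ^ 2 + d ^ 2 * (cs * cb) + d ^ 2 * (cy * cb)) + (3 / 2 + d ^ 2 * cb),
    by positivity, ?_⟩
  intro v A f f' K K' L R a hf hv hf' hc hA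
  have hK := hf.nonneg
  have hK' := hf'.nonneg
  have hL := hv.nonneg
  have hR := hc.nonneg
  have ha := hA.nonneg
  -- The summands of `S` measure the trapezoid rule for `f` and `v`, the remainder of `f` multiplied
  -- by `v`, and `f'` multiplied by the area.
  obtain ⟨S, hS⟩ : ∃ S, S = K * L + (R + K' * L) * L + K' * (a + L ^ 2) := ⟨_, rfl⟩
  have h1 : 0 ≤ K * L := by positivity
  have h2 : 0 ≤ R * L := by positivity
  have h3 : 0 ≤ K' * L * L := by positivity
  have h4 : 0 ≤ K' * (a + L ^ 2) := by positivity
  have hS0 : 0 ≤ S := by rw [hS]; positivity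
  have hS1 : K * L ≤ S := by linarith
  have hS2 : R * L ≤ S := by linarith
  have hS3 : K' * L * L ≤ S := by linarith
  have hS4 : K' * (a + L ^ 2) ≤ S := by linarith
  obtain ⟨b, hb⟩ : ∃ b, b = areaBound x z L a := ⟨_, rfl⟩
  have hb' : b = cb * (a + L ^ 2) := by rw [hb, hcb, areaBound]; ring
  have hb0 : 0 ≤ b := by rw [hb']; positivity
  have hA1 : ∀ {q k : ℕ}, k < 2 ^ q → ∀ i j, |areaMatrix v A q k i j| ≤ b * z ^ q :=
    fun hk i j => hb ▸ abs_areaMatrix_le hv hA hx hx1 hz hz1 hxz hk i j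
  have hA2 : ∀ {q k : ℕ}, k < 2 ^ q →
      ‖contract (inc f' (q + 1) (2 * k)) (areaMatrix v A (q + 1) (2 * k + 1))‖ ≤
      d ^ 2 * (cy * cb) * S * (z * y) ^ q := by
    intro q k hk
    have hk1 := two_mul_lt_pow hk
    have h5 := hf'.norm_inc_succ_le (by linarith) hy1.le (q := q) (k := 2 * k) (by omega)
    rw [← hcy] at h5
    have h6 : ∀ i j, |areaMatrix v A (q + 1) (2 * k + 1) i j| ≤ b * z ^ q := fun i j => by
      refine (hA1 hk1 i j).trans (mul_le_mul_of_nonneg_left ?_ hb0)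
      exact pow_le_pow_of_le_one hz0.le hz1 q.le_succ
    refine (norm_contract_le _ _ h5 h6).trans ?_
    have : (d : ℝ) ^ 2 * (cy * K' * y ^ q * (b * z ^ q)) =
        d ^ 2 * (cy * cb) * (K' * (a + L ^ 2)) * (z * y) ^ q := by rw [hb', mul_pow]; ring
    rw [this]
    gcongr
  rw [← hS]
  constructor
  · intro q k hk
    have h5 := hc.norm_inc_sub_le hf' hv hx hx1 (by linarith) hy1.le hxy' hk
    rw [← hcp, ← hcx, ← hcy] at h5
    have h6 := (inc f q k - f' (dy q k) (inc v q k)).le_of_opNorm_le_of_le h5 (hv.sd q k hk)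
    have h7 := (Schauder.sd f q k - f' (dy q k) (Schauder.sd v q k)).le_of_opNorm_le_of_le
      (hc.sd q k hk) (hv.norm_inc_le hx hx1 hk)
    rw [← hcx] at h7
    rw [defect_areaGerm hk]
    refine (norm_sub_le _ _).trans ((add_le_add
      (b := 1 / 4 * (cp * (1 + cy * (cx + 1)) + cx) * S * (z * y) ^ q) ?_ (hA2 hk)).trans ?_)
    · rw [norm_smul, Real.norm_of_nonneg (by norm_num : (0 : ℝ) ≤ 1 / 4)]
      have h8 : (x * y) ^ q * x ^ q ≤ (z * y) ^ q := by
        rw [← mul_pow]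
        refine pow_le_pow_left₀ (by positivity) ?_ q
        nlinarith
      have h9 : cp * (R + cy * (cx + 1) * (K' * L)) * (x * y) ^ q * (L * x ^ q) ≤
          cp * (1 + cy * (cx + 1)) * S * (z * y) ^ q := by
        have : cp * (R + cy * (cx + 1) * (K' * L)) * (x * y) ^ q * (L * x ^ q) =
          (cp * (R * L + cy * (cx + 1) * (K' * L * L))) * ((x * y) ^ q * x ^ q) := by ring
        rw [this]
        refine mul_le_mul ?_ h8 (by positivity) (by positivity)
        rw [mul_assoc cp]
        refine mul_le_mul_of_nonneg_left ?_ hcp0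
        have := mul_le_mul_of_nonneg_left hS3 (by positivity : 0 ≤ cy * (cx + 1))
        linarith
      have h10 : R * (x * y) ^ q * (cx * L * x ^ q) ≤ cx * S * (z * y) ^ q := by
        have : R * (x * y) ^ q * (cx * L * x ^ q) = cx * (R * L) * ((x * y) ^ q * x ^ q) := by ring
        rw [this]
        exact mul_le_mul (mul_le_mul_of_nonneg_left hS2 hcx0) h8 (by positivity) (by positivity)
      have h11 := norm_sub_le ((inc f q k - f' (dy q k) (inc v q k)) (Schauder.sd v q k))
        ((Schauder.sd f q k - f' (dy q k) (Schauder.sd v q k)) (inc v q k))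
      linarith
    · have : 0 ≤ ((3 / 2 * cx ^ 2 + d ^ 2 * (cs * cb) + d ^ 2 * (cy * cb)) +
        (3 / 2 + d ^ 2 * cb)) * S * (z * y) ^ q := by positivity
      linarith
  · intro q k hk
    have h5 := norm_trapezoid_left_sub_right_le hf hv hx hx1 hk
    rw [← hcx] at h5
    have h6 := hf'.norm_dy_le hy0 hy1 hk.le
    rw [← hcs] at h6
    have h7 := norm_contract_le _ (fun i j => areaMatrix v A (q + 1) (2 * k) i j -
      areaMatrix v A (q + 1) (2 * k + 1) i j) h6
      fun i j => hb ▸ abs_areaMatrix_left_sub_right_le hv hA hx hx1 hz hk i j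
    rw [contract_sub] at h7
    have h8 : areaGerm v A f f' (q + 1) (2 * k) - areaGerm v A f f' (q + 1) (2 * k + 1) -
        f (dy q k) (Schauder.sd v q k) =
        (trapezoid f v (q + 1) (2 * k) - trapezoid f v (q + 1) (2 * k + 1) -
          f (dy q k) (Schauder.sd v q k)) +
        (contract (f' (dy q k)) (areaMatrix v A (q + 1) (2 * k)) -
          contract (f' (dy q k)) (areaMatrix v A (q + 1) (2 * k + 1))) -
        contract (inc f' (q + 1) (2 * k)) (areaMatrix v A (q + 1) (2 * k + 1)) := by
      unfold areaGerm
      rw [inc.eq_1 f', contract_sub_left, dy_succ_two_mul]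
      abel
    have h9 : d ^ 2 * (cy * cb) * S * (z * y) ^ q ≤ d ^ 2 * (cy * cb) * S * (x ^ 2) ^ q := by
      gcongr
    have h10 : 3 / 2 * cx ^ 2 * (K * L) * (x ^ 2) ^ q ≤ 3 / 2 * cx ^ 2 * S * (x ^ 2) ^ q := by
      gcongr
    have h11 : (d : ℝ) ^ 2 * (cs * K' * (b * (x ^ 2) ^ q)) ≤ d ^ 2 * (cs * cb) * S * (x ^ 2) ^ q := by
      have : (d : ℝ) ^ 2 * (cs * K' * (b * (x ^ 2) ^ q)) =
        d ^ 2 * (cs * cb) * (K' * (a + L ^ 2)) * (x ^ 2) ^ q := by rw [hb']; ring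
      rw [this]
      gcongr
    have h12 : 0 ≤ (1 / 4 * (cp * (1 + cy * (cx + 1)) + cx) + d ^ 2 * (cy * cb) +
        (3 / 2 + d ^ 2 * cb)) * S * (x ^ 2) ^ q := by positivity
    rw [h8]
    have h13 := norm_sub_le ((trapezoid f v (q + 1) (2 * k) - trapezoid f v (q + 1) (2 * k + 1) -
          f (dy q k) (Schauder.sd v q k)) +
        (contract (f' (dy q k)) (areaMatrix v A (q + 1) (2 * k)) -
          contract (f' (dy q k)) (areaMatrix v A (q + 1) (2 * k + 1))))
        (contract (inc f' (q + 1) (2 * k)) (areaMatrix v A (q + 1) (2 * k + 1)))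
    have h14 := norm_add_le (trapezoid f v (q + 1) (2 * k) - trapezoid f v (q + 1) (2 * k + 1) -
          f (dy q k) (Schauder.sd v q k))
        (contract (f' (dy q k)) (areaMatrix v A (q + 1) (2 * k)) -
          contract (f' (dy q k)) (areaMatrix v A (q + 1) (2 * k + 1)))
    have h15 := hA2 hk
    linarith
  · have h5 := norm_trapezoid_zero_le hf hv
    have h6 := norm_contract_le _ _ hf'.zero (hA1 (q := 0) (k := 0) (by simp))
    have h7 := norm_add_le (trapezoid f v 0 0) (contract (f' 0) (areaMatrix v A 0 0))
    have h8 : (d : ℝ) ^ 2 * (K' * (b * z ^ 0)) ≤ d ^ 2 * cb * S := by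
      have : (d : ℝ) ^ 2 * (K' * (b * z ^ 0)) = d ^ 2 * cb * (K' * (a + L ^ 2)) := by
        rw [hb', pow_zero]; ring
      rw [this]
      gcongr
    have h9 : 0 ≤ (1 / 4 * (cp * (1 + cy * (cx + 1)) + cx) + d ^ 2 * (cy * cb) +
        (3 / 2 * cx ^ 2 + d ^ 2 * (cs * cb) + d ^ 2 * (cy * cb))) * S := by positivity
    unfold areaGerm
    rw [dy_zero]
    linarith

lemma schauderSum_apply {ι : Type*} [Fintype ι] (n : ℕ) (v : ℝ → EuclideanSpace ℝ ι) (i : ι) :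
    (fun t => schauderSum n v t i) = schauderSum n (fun t => v t i) := by
  ext t
  have h : ∀ p m, coeff (fun t => v t i) p m = coeff v p m i := fun p m => by
    unfold coeff; split_ifs <;> rfl
  simp [schauderSum, coeffBlock, h, WithLp.ofLp_sum]

lemma trapezoid_schauderSum {E : Type*} [NormedAddCommGroup E] [NormedSpace ℝ E]
    (f : ℝ → E →L[ℝ] F) (v : ℝ → E) {n q k : ℕ} (hn : n ≠ 0) (hq : q ≤ n) (hk : k < 2 ^ q) :
    trapezoid (schauderSum n f) (schauderSum n v) q k = trapezoid f v q k := by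
  unfold trapezoid
  rw [inc_schauderSum v hn hq hk, schauderSum_dy f hn hq hk, schauderSum_dy f hn hq hk.le]

lemma areaMatrix_schauderSum (v : ℝ → EuclideanSpace ℝ (Fin d)) {n q : ℕ} (hn : n ≠ 0)
    (hq : n ≤ q) (k : ℕ) :
    areaMatrix (schauderSum n v) (levyMatrix (schauderSum n v) (schauderSum n v)) q k =
      fun _ _ => 0 := by
  ext i j
  unfold areaMatrix levyMatrix
  simp only [schauderSum_apply]
  exact area_schauderSum _ _ hn hq k

lemma areaGerm_schauderSum (v : ℝ → EuclideanSpace ℝ (Fin d))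
    (f : ℝ → EuclideanSpace ℝ (Fin d) →L[ℝ] F)
    (f' : ℝ → EuclideanSpace ℝ (Fin d) →L[ℝ] EuclideanSpace ℝ (Fin d) →L[ℝ] F)
    {n q : ℕ} (hn : n ≠ 0) (hq : n ≤ q) (k : ℕ) :
    areaGerm (schauderSum n v) (levyMatrix (schauderSum n v) (schauderSum n v))
      (schauderSum n f) f' q k = trapezoid (schauderSum n f) (schauderSum n v) q k := by
  unfold areaGerm
  rw [areaMatrix_schauderSum v hn hq]
  simp [contract]

/-- On a fixed interval, once `n` is large the values of `f` and `v` and the Lévy terms below level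
`q` are no longer affected by truncation. Only the increment of the Lévy area still varies, and
convergence at the two endpoints suffices. -/
lemma tendsto_areaGerm {v : ℝ → EuclideanSpace ℝ (Fin d)}
    {A : ℝ → EuclideanSpace ℝ (Fin d × Fin d)}
    (hA : ∀ t ∈ Icc (0 : ℝ) 1, Tendsto (fun n : ℕ =>
      levyMatrix (schauderSum (n + 1) v) (schauderSum (n + 1) v) t) atTop (𝓝 (A t)))
    (f : ℝ → EuclideanSpace ℝ (Fin d) →L[ℝ] F)
    (f' : ℝ → EuclideanSpace ℝ (Fin d) →L[ℝ] EuclideanSpace ℝ (Fin d) →L[ℝ] F)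
    {q k : ℕ} (hk : k < 2 ^ q) :
    Tendsto (fun n : ℕ => areaGerm (schauderSum (n + 1) v)
      (levyMatrix (schauderSum (n + 1) v) (schauderSum (n + 1) v)) (schauderSum (n + 1) f) f' q k)
      atTop (𝓝 (areaGerm v A f f' q k)) := by
  unfold areaGerm
  refine Tendsto.add ?_ ?_
  · refine tendsto_const_nhds.congr' ?_
    filter_upwards [eventually_ge_atTop q] with n hn
    rw [trapezoid_schauderSum f v n.succ_ne_zero (by omega) hk]
  · unfold contract
    refine tendsto_finsetSum _ fun i _ => tendsto_finsetSum _ fun j _ => Tendsto.smul_const ?_ _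
    have h1 : ∀ t ∈ Icc (0 : ℝ) 1, Tendsto (fun n : ℕ =>
        levyMatrix (schauderSum (n + 1) v) (schauderSum (n + 1) v) t (i, j)) atTop
        (𝓝 (A t (i, j))) := fun t ht =>
      ((EuclideanSpace.proj (i, j) : EuclideanSpace ℝ (Fin d × Fin d) →L[ℝ] ℝ).continuous.tendsto
        _).comp (hA t ht)
    have h2 := (h1 _ (dy_mem (q := q) hk)).sub (h1 _ (dy_mem hk.le))
    have h3 : Tendsto (fun n : ℕ => area (fun t => v t i) (fun t => v t j)
        (fun t => levyMatrix (schauderSum (n + 1) v) (schauderSum (n + 1) v) t (i, j)) q k) atTop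
        (𝓝 (areaMatrix v A q k i j)) := (h2.sub_const _).add_const _
    refine h3.congr' ?_
    filter_upwards [eventually_ge_atTop q] with n hn
    unfold areaMatrix
    simp only [schauderSum_apply]
    rw [area_schauderSum_eq _ _ _ n.succ_ne_zero (by omega)]

/-- Approximations of the integral over dyadic intervals exist in all cases: the trapezoid rule if
the regularity is larger than `1 / 2`, and the trapezoid rule with area correction otherwise. -/
lemma exists_germ (d : ℕ) {x y : ℝ} (hx : 1 / 2 < x) (hxy : x ≤ y) (hy1 : y < 1)
    (h : x ^ 2 * y < 1 / 2) (hne : x * y ≠ 1 / 2) :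
    ∃ θ C, 0 ≤ θ ∧ θ < 1 / 2 ∧ θ ≤ x ^ 2 ∧ 0 ≤ C ∧
    ∃ X : (ℝ → EuclideanSpace ℝ (Fin d)) → (ℝ → EuclideanSpace ℝ (Fin d × Fin d)) →
      (ℝ → EuclideanSpace ℝ (Fin d) →L[ℝ] F) →
      (ℝ → EuclideanSpace ℝ (Fin d) →L[ℝ] EuclideanSpace ℝ (Fin d) →L[ℝ] F) → ℕ → ℕ → F,
    (∀ v A f f' K K' L R a, SBound x K f → SBound x L v → SBound y K' f' →
      Controlled (x * y) R v f f' → SBound (x ^ 2) a A →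
      GermBound θ x (C * (K * L + (R + K' * L) * L + K' * (a + L ^ 2))) f v (X v A f f')) ∧
    (∀ v f f' n q k, n ≠ 0 → n ≤ q → X (schauderSum n v)
      (levyMatrix (schauderSum n v) (schauderSum n v)) (schauderSum n f) f' q k =
        trapezoid (schauderSum n f) (schauderSum n v) q k) ∧
    (∀ v A f f', (∀ t ∈ Icc (0 : ℝ) 1, Tendsto (fun n : ℕ =>
      levyMatrix (schauderSum (n + 1) v) (schauderSum (n + 1) v) t) atTop (𝓝 (A t))) →
      ∀ q k, k < 2 ^ q → Tendsto (fun n : ℕ => X (schauderSum (n + 1) v)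
        (levyMatrix (schauderSum (n + 1) v) (schauderSum (n + 1) v)) (schauderSum (n + 1) f) f' q k)
        atTop (𝓝 (X v A f f' q k))) := by
  have hx1 : x ≤ 1 := by linarith
  have hx' : 0 < x - 1 / 2 := by linarith
  -- The Young case `2α > 1` against the rough case `2α ≤ 1`.
  rcases lt_or_ge (x ^ 2) (1 / 2) with h2 | h2
  · refine ⟨x ^ 2, 3 / 2 * (1 / (x - 1 / 2)) ^ 2 + 1 / (x - 1 / 2) + 3 / 2, sq_nonneg x, h2, le_rfl,
      by positivity, fun v _ f _ => trapezoid f v, ?_, ?_, ?_⟩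
    · intro v A f f' K K' L R a hf hv hf' hc hA
      have hK' := hf'.nonneg
      have hL := hv.nonneg
      have hR := hc.nonneg
      have ha := hA.nonneg
      have h3 : K * L ≤ K * L + (R + K' * L) * L + K' * (a + L ^ 2) := by
        have : 0 ≤ (R + K' * L) * L + K' * (a + L ^ 2) := by positivity
        linarith
      have h4 := germBound_trapezoid hf hv hx hx1
      have h5 := mul_le_mul_of_nonneg_left h3
        (by positivity : 0 ≤ 3 / 2 * (1 / (x - 1 / 2)) ^ 2 + 1 / (x - 1 / 2) + 3 / 2)
      exact ⟨fun q k hk => (h4.defect q k hk).trans (by gcongr),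
        fun q k hk => (h4.sd q k hk).trans (by gcongr), h4.zero.trans h5⟩
    · intros; rfl
    · intro v A f f' _ q k hk
      refine tendsto_const_nhds.congr' ?_
      filter_upwards [eventually_ge_atTop q] with n hn
      rw [trapezoid_schauderSum f v n.succ_ne_zero (by omega) hk]
  · have hy0 : 0 < y := by linarith
    -- Since `y ≥ x`, already `x * y ≥ x ^ 2 ≥ 1 / 2`; the hypothesis `α + β ≠ 1` makes this strict.
    have hxy' : 1 / 2 < x * y := lt_of_le_of_ne (by nlinarith) (Ne.symm hne)
    -- Any `z` strictly between `max (1 / 2) (x ^ 2)` and `1 / (2 * y)` works. The gap is open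
    -- because `y < 1` and `x ^ 2 * y < 1 / 2`.
    obtain ⟨z, hz, hz1, hxz, hzy⟩ : ∃ z, 1 / 2 < z ∧ z ≤ 1 ∧ x ^ 2 ≤ z ∧ z * y < 1 / 2 := by
      have hy2 : 1 / 2 < 1 / (2 * y) := by
        rw [div_lt_div_iff₀ (by norm_num) (by positivity)]; linarith
      have hy3 : 1 / (2 * y) * y = 1 / 2 := by field_simp
      have hy4 : x ^ 2 < 1 / (2 * y) := by rw [lt_div_iff₀ (by positivity)]; linarith
      obtain ⟨z, hz, hz'⟩ := exists_between (max_lt hy2 hy4)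
      have hz2 : z * y < 1 / 2 := by rw [← hy3]; exact mul_lt_mul_of_pos_right hz' hy0
      have hz3 := (le_max_left _ _).trans_lt hz
      exact ⟨z, hz3, by nlinarith, ((le_max_right _ _).trans_lt hz).le, hz2⟩
    obtain ⟨C, hC, hg⟩ := germBound_areaGerm (F := F) d hx hxy hy1 hxy' hz hz1 hxz (by linarith)
    refine ⟨z * y, C, by positivity, hzy, by linarith, hC, areaGerm, hg, ?_, ?_⟩
    · intro v f f' n q k hn hq
      exact areaGerm_schauderSum v f f' hn hq k
    · intro v A f f' hA q k hk
      exact tendsto_areaGerm hA f f' hk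

end AreaGerm

/-! ### Integrals of truncated paths -/

section Integral

variable {E F : Type*} [NormedAddCommGroup E] [NormedSpace ℝ E]
  [NormedAddCommGroup F] [NormedSpace ℝ F]

lemma block_schauderSum {n : ℕ} (f : ℝ → E) (hn : n ≠ 0) (p : ℤ) (t : ℝ) :
    block (schauderSum n f) p t = if p ∈ Finset.Icc (-1) ((n : ℤ) - 1) then block f p t else 0 := by
  rcases p with p | _ | p
  · refine (coeffBlock_schauderSum f hn p t).trans (if_congr ?_ rfl rfl)
    simp only [Int.ofNat_eq_natCast, Finset.mem_Icc]; omega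
  · rw [if_pos (by simp; omega)]
    exact schauderSum_zero_right n f
  · rw [if_neg (by simp only [Finset.mem_Icc]; omega)]
    rfl

lemma dblock_schauderSum {n : ℕ} (f : ℝ → E) (hn : n ≠ 0) (p : ℤ) (t : ℝ) :
    dblock (schauderSum n f) p t =
      if p ∈ Finset.Icc (-1) ((n : ℤ) - 1) then dblock f p t else 0 := by
  rcases p with p | p
  · refine (dcoeffBlock_schauderSum f hn p t).trans (if_congr ?_ rfl rfl)
    simp only [Int.ofNat_eq_natCast, Finset.mem_Icc]; omega
  · split_ifs <;> rfl

lemma continuous_block (f : ℝ → E) (p : ℤ) : Continuous (block f p) := by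
  rcases p with p | _ | p
  · exact continuous_coeffBlock _ p
  · exact continuous_const
  · exact continuous_const

lemma intervalIntegrable_dblock (f : ℝ → E) (p : ℤ) (a b : ℝ) :
    IntervalIntegrable (dblock f p) volume a b := by
  rcases p with p | p
  · exact intervalIntegrable_dcoeffBlock _ p a b
  · exact intervalIntegrable_const (c := (0 : E))

lemma integral_schauderSum {n : ℕ} (f : ℝ → E →L[ℝ] F) (w : ℝ → E) (hn : n ≠ 0) (t : ℝ) :
    integral (schauderSum n f) (schauderSum n w) t =
      ∫ s in (0 : ℝ)..t, (schauderSum n f s) (dschauderSum n w s) := by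
  have hint : ∀ p q : ℤ, IntervalIntegrable (fun s => (block f p s) (dblock w q s)) volume 0 t :=
    fun p q => intervalIntegrable_bilin (ContinuousLinearMap.id ℝ (E →L[ℝ] F))
      (continuous_block f p) (intervalIntegrable_dblock w q 0 t)
  set T := Finset.Icc (-1) ((n : ℤ) - 1) with hT
  have h1 : ∀ s, (schauderSum n f s) (dschauderSum n w s) =
      ∑ pq ∈ T ×ˢ T, (block f pq.1 s) (dblock w pq.2 s) := fun s => by
    rw [← partialSum_natCast_sub_one, ← dpartialSum_natCast_sub_one, partialSum, dpartialSum,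
      Finset.sum_product, sum_apply]
    exact Finset.sum_congr rfl fun p _ => map_sum _ _ _
  simp only [h1]
  rw [intervalIntegral.integral_finsetSum fun pq _ => hint pq.1 pq.2]
  unfold integral
  rw [tsum_eq_sum (s := T ×ˢ T)]
  · refine Finset.sum_congr rfl fun pq hpq => ?_
    obtain ⟨hp, hq⟩ := Finset.mem_product.1 hpq
    simp only [block_schauderSum f hn, dblock_schauderSum w hn, ← hT, if_pos hp, if_pos hq]
  · intro pq hpq
    simp only [block_schauderSum f hn, dblock_schauderSum w hn]
    rw [Finset.mem_product, not_and_or] at hpq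
    rcases hpq with h | h
    · simp [← hT, h]
    · simp [← hT, h]

lemma intervalIntegrable_schauderSum_apply (n : ℕ) (f : ℝ → E →L[ℝ] F) (w : ℝ → E) (a b : ℝ) :
    IntervalIntegrable (fun s => (schauderSum n f s) (dschauderSum n w s)) volume a b :=
  intervalIntegrable_bilin (ContinuousLinearMap.id ℝ (E →L[ℝ] F))
    (continuous_schauderSum n f) (intervalIntegrable_dschauderSum n w a b)

lemma continuous_integral_schauderSum {n : ℕ} (f : ℝ → E →L[ℝ] F) (w : ℝ → E) (hn : n ≠ 0) :
    Continuous (integral (schauderSum n f) (schauderSum n w)) := by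
  rw [funext (integral_schauderSum f w hn)]
  exact intervalIntegral.continuous_primitive (intervalIntegrable_schauderSum_apply n f w) 0

lemma integral_schauderSum_zero_right {n : ℕ} (f : ℝ → E →L[ℝ] F) (w : ℝ → E) (hn : n ≠ 0) :
    integral (schauderSum n f) (schauderSum n w) 0 = 0 := by
  rw [integral_schauderSum f w hn, intervalIntegral.integral_same]

/-- Both truncations are affine on intervals of level `q ≥ n`. This anchors the sewing argument at
fine scales. -/
lemma inc_integral_schauderSum [CompleteSpace F] {n q k : ℕ} (f : ℝ → E →L[ℝ] F) (w : ℝ → E)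
    (hn : n ≠ 0) (hq : n ≤ q) (hk : k < 2 ^ q) :
    inc (integral (schauderSum n f) (schauderSum n w)) q k =
      trapezoid (schauderSum n f) (schauderSum n w) q k := by
  rw [funext (integral_schauderSum f w hn), inc_integral (intervalIntegrable_schauderSum_apply n f w)]
  exact integral_piecewiseAffine (ContinuousLinearMap.id ℝ (E →L[ℝ] F))
    ((schauderSum_piecewiseAffine n f).mono hq) ((schauderSum_piecewiseAffine n w).mono hq) hk

end Integral

/-! ### Passing between paracontrolled paths and coefficient estimates -/

section Construction

variable {E F : Type*} [NormedAddCommGroup E] [NormedSpace ℝ E]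
  [NormedAddCommGroup F] [NormedSpace ℝ F]

lemma SBound.sub {r K K' : ℝ} {f g : ℝ → E} (hf : SBound r K f) (hg : SBound r K' g) :
    SBound r (K + K') (fun t => f t - g t) where
  zero := (norm_sub_le _ _).trans (add_le_add hf.zero hg.zero)
  one := by
    rw [inc_sub]
    exact (norm_sub_le _ _).trans (add_le_add hf.one hg.one)
  sd q k hk := by
    rw [sd_sub, add_mul]
    exact (norm_sub_le _ _).trans (add_le_add (hf.sd q k hk) (hg.sd q k hk))

lemma SBound.mono {r K K' : ℝ} {f : ℝ → E} (hf : SBound r K f) (hr : 0 ≤ r) (h : K ≤ K') :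
    SBound r K' f where
  zero := hf.zero.trans h
  one := hf.one.trans h
  sd q k hk := (hf.sd q k hk).trans (by gcongr)

lemma tendsto_inc {g : ℕ → ℝ → E} {g' : ℝ → E}
    (h : ∀ t ∈ Icc (0 : ℝ) 1, Tendsto (fun n => g n t) atTop (𝓝 (g' t))) {q k : ℕ}
    (hk : k < 2 ^ q) : Tendsto (fun n => inc (g n) q k) atTop (𝓝 (inc g' q k)) :=
  (h _ (dy_mem hk)).sub (h _ (dy_mem hk.le))

lemma tendsto_sd {g : ℕ → ℝ → E} {g' : ℝ → E}
    (h : ∀ t ∈ Icc (0 : ℝ) 1, Tendsto (fun n => g n t) atTop (𝓝 (g' t))) {q k : ℕ}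
    (hk : k < 2 ^ q) : Tendsto (fun n => sd (g n) q k) atTop (𝓝 (sd g' q k)) :=
  (((h _ (dy_mem (two_mul_lt_pow hk).le)).const_smul _).sub (h _ (dy_mem hk.le))).sub
    (h _ (dy_mem hk))

lemma SBound.of_tendsto {r K : ℝ} {g : ℕ → ℝ → E} {g' : ℝ → E} (hg : ∀ n, SBound r K (g n))
    (h : ∀ t ∈ Icc (0 : ℝ) 1, Tendsto (fun n => g n t) atTop (𝓝 (g' t))) : SBound r K g' where
  zero := le_of_tendsto' (h 0 (by simp)).norm fun n => (hg n).zero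
  one := le_of_tendsto' (tendsto_inc h (by simp)).norm fun n => (hg n).one
  sd q k hk := le_of_tendsto' (tendsto_sd h hk).norm fun n => (hg n).sd q k hk

/-- Paracontrolled paths are controlled on the level of the Schauder coefficients. -/
lemma exists_controlled_of_remainder {x y : ℝ} (hx : 1 / 2 < x) (hxy : x ≤ y) (hy1 : y < 1) :
    ∃ C, 1 ≤ C ∧ ∀ (v : ℝ → E) (f : ℝ → F) (f' : ℝ → E →L[ℝ] F) (L K' R : ℝ), SBound x L v →
      SBound y K' f' → SBound (x * y) R (remainder v f f') →
      Controlled (x * y) (C * (R + K' * L)) v f f' ∧ SBound x (C * (R + K' * L)) f := by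
  have hx0 : 0 < x := by linarith
  have hy0 : 0 < y := by linarith
  obtain ⟨cp, hcp, hcp0⟩ : ∃ c, c = 1 / (y - 1 / 2) +
      1 / (y - 1 / 2) * (y * x / (y * x - 1 / 4)) ∧ 0 ≤ c := by
    have h1 : 0 < y - 1 / 2 := by linarith
    have h2 : 0 < y * x - 1 / 4 := by nlinarith
    exact ⟨_, rfl, by positivity⟩
  obtain ⟨cs, hcs, hcs0⟩ : ∃ c, c = 2 + 1 / (1 - y) ∧ 0 ≤ c :=
    ⟨_, rfl, add_nonneg zero_le_two (one_div_nonneg.2 (by linarith))⟩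
  refine ⟨1 + cp + cs, by linarith, fun v f f' L K' R hv hf' hR => ?_⟩
  have hL := hv.nonneg
  have hK' := hf'.nonneg
  have hR0 := hR.nonneg
  have hKL : 0 ≤ K' * L := by positivity
  have hC1 : R + K' * L ≤ (1 + cp + cs) * (R + K' * L) := by
    have : 0 ≤ (cp + cs) * (R + K' * L) := by positivity
    linarith
  have hC2 : R + cp * (K' * L) ≤ (1 + cp + cs) * (R + K' * L) := by
    have : 0 ≤ (cp + cs) * R + (1 + cs) * (K' * L) := by positivity
    linarith
  have hC3 : R + cp * (K' * L) + cs * (K' * L) ≤ (1 + cp + cs) * (R + K' * L) := by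
    have : 0 ≤ (cp + cs) * R + 1 * (K' * L) := by positivity
    linarith
  have hdec : f = fun t => remainder v f f' t + paraproduct f' v t := by
    ext t; simp [remainder]
  have hinc : inc f 0 0 = inc (remainder v f f') 0 0 + f' 0 (inc v 0 0) := by
    conv_lhs => rw [hdec]
    rw [inc_add, inc_paraproduct_zero_zero]
  have hsd : ∀ q k, k < 2 ^ q → ‖sd f q k - f' (dy q k) (sd v q k)‖ ≤
      (R + cp * (K' * L)) * (x * y) ^ q := by
    intro q k hk
    have h1 : sd f q k = sd (remainder v f f') q k + sd (paraproduct f' v) q k := by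
      conv_lhs => rw [hdec]
      rw [sd_add]
    rw [h1, add_sub_assoc]
    -- In the paraproduct the low-frequency factor is `f'`, of rate `y`, and the blocks are those of
    -- `v`, of rate `x`.
    have h2 := norm_sd_paraproduct_sub_le hf' hv (by linarith) hy1.le hx hk
    rw [← hcp, mul_comm y x] at h2
    refine (norm_add_le _ _).trans ((add_le_add (hR.sd q k hk) h2).trans (le_of_eq (by ring)))
  refine ⟨⟨?_, fun q k hk => (hsd q k hk).trans ?_⟩, ⟨?_, ?_, fun q k hk => ?_⟩⟩
  · rw [hinc, add_sub_cancel_right]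
    exact hR.one.trans (le_trans (by linarith) hC1)
  · gcongr
  · have : f 0 = remainder v f f' 0 := by simp [remainder, paraproduct_zero_right]
    rw [this]
    exact hR.zero.trans (le_trans (by linarith) hC1)
  · rw [hinc]
    exact (norm_add_le _ _).trans ((add_le_add hR.one
      ((f' 0).le_of_opNorm_le_of_le hf'.zero hv.one)).trans hC1)
  · have h1 := (f' (dy q k)).le_of_opNorm_le_of_le (hf'.norm_dy_le hy0 hy1 hk.le) (hv.sd q k hk)
    rw [← hcs] at h1
    have h2 : (x * y) ^ q ≤ x ^ q := pow_le_pow_left₀ (by positivity) (by nlinarith) q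
    have h3 : (R + cp * (K' * L)) * (x * y) ^ q ≤ (R + cp * (K' * L)) * x ^ q := by gcongr
    have h4 := norm_add_le (Schauder.sd f q k - f' (dy q k) (Schauder.sd v q k))
      (f' (dy q k) (Schauder.sd v q k))
    rw [sub_add_cancel] at h4
    have h5 := hsd q k hk
    refine le_trans ?_ (mul_le_mul_of_nonneg_right hC3 (by positivity : 0 ≤ x ^ q))
    have h6 : cs * K' * (L * x ^ q) = cs * (K' * L) * x ^ q := by ring
    linarith

/-- The sewing error `θ ^ q` is no worse than `x ^ (2 * q)`, so the local expansion and the coarse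
bound pass from the germ to the integral. -/
lemma GermBound.of_approx {θ x M c : ℝ} {f : ℝ → E →L[ℝ] F} {v : ℝ → E} {X J : ℕ → ℕ → F}
    (h : GermBound θ x M f v X) (hθ : 0 ≤ θ) (hθ1 : θ < 1 / 2) (hθx : θ ≤ x ^ 2) (hc : 0 ≤ c)
    (hJ : ∀ q k, k < 2 ^ q → ‖J q k - X q k‖ ≤ c * M * θ ^ q) :
    (∀ q k, k < 2 ^ q → ‖J (q + 1) (2 * k) - J (q + 1) (2 * k + 1) - f (dy q k) (Schauder.sd v q k)‖
      ≤ (1 + 2 * c) * M * (x ^ 2) ^ q) ∧ ‖J 0 0‖ ≤ (1 + 2 * c) * M := by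
  have hM : 0 ≤ M := (norm_nonneg _).trans h.zero
  have hcM : 0 ≤ c * M := by positivity
  constructor
  · intro q k hk
    have hk1 := two_mul_lt_pow hk
    have h1 := hJ (q + 1) (2 * k) (by omega)
    have h2 := hJ (q + 1) (2 * k + 1) hk1
    have h3 := h.sd q k hk
    have h4 : c * M * θ ^ (q + 1) ≤ c * M * (x ^ 2) ^ q := by
      refine mul_le_mul_of_nonneg_left ?_ hcM
      exact (pow_le_pow_of_le_one hθ (by linarith) q.le_succ).trans (pow_le_pow_left₀ hθ hθx q)
    have h5 : J (q + 1) (2 * k) - J (q + 1) (2 * k + 1) - f (dy q k) (Schauder.sd v q k) =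
      (X (q + 1) (2 * k) - X (q + 1) (2 * k + 1) - f (dy q k) (Schauder.sd v q k)) +
      (J (q + 1) (2 * k) - X (q + 1) (2 * k)) +
      -(J (q + 1) (2 * k + 1) - X (q + 1) (2 * k + 1)) := by abel
    rw [h5]
    refine norm_add₃_le.trans ?_
    rw [norm_neg]
    linarith
  · have h1 := hJ 0 0 (by simp)
    have h2 := norm_add_le (J 0 0 - X 0 0) (X 0 0)
    rw [sub_add_cancel] at h2
    have h3 := h.zero
    rw [pow_zero, mul_one] at h1
    linarith

/-- The main term `f (sd v)` has the regularity of `v` because `f` is bounded on dyadic points; the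
error of rate `x ^ 2` is smaller. -/
lemma SBound.of_controlled {x M K L : ℝ} {f : ℝ → E →L[ℝ] F} {v : ℝ → E} {g : ℝ → F}
    (hf : SBound x K f) (hv : SBound x L v) (hx : 1 / 2 < x) (hx1 : x < 1) (h0 : g 0 = 0)
    (h1 : ‖inc g 0 0‖ ≤ M)
    (h : ∀ q k, k < 2 ^ q → ‖Schauder.sd g q k - f (dy q k) (Schauder.sd v q k)‖ ≤
      M * (x ^ 2) ^ q) : SBound x (M + (2 + 1 / (1 - x)) * (K * L)) g := by
  have hM : 0 ≤ M := (norm_nonneg _).trans h1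
  have hK := hf.nonneg
  have hL := hv.nonneg
  have hx0 : 0 < x := by linarith
  have hx' : 0 < 1 - x := by linarith
  have hKL : 0 ≤ (2 + 1 / (1 - x)) * (K * L) := by positivity
  refine ⟨?_, by linarith, fun q k hk => ?_⟩
  · rw [h0, norm_zero]; linarith
  · have h2 := (f (dy q k)).le_of_opNorm_le_of_le (hf.norm_dy_le hx0 hx1 hk.le) (hv.sd q k hk)
    have h3 : M * (x ^ 2) ^ q ≤ M * x ^ q :=
      mul_le_mul_of_nonneg_left (pow_le_pow_left₀ (by positivity) (by nlinarith) q) hM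
    have h4 := norm_add_le (Schauder.sd g q k - f (dy q k) (Schauder.sd v q k))
      (f (dy q k) (Schauder.sd v q k))
    rw [sub_add_cancel] at h4
    have h5 := h q k hk
    have h6 : (2 + 1 / (1 - x)) * K * (L * x ^ q) = (2 + 1 / (1 - x)) * (K * L) * x ^ q := by ring
    linarith

/-- The second differences of `g` and of the paraproduct have the same main term `f (sd v)`, which
cancels in the remainder. -/
lemma SBound.remainder_of_controlled {x M K L : ℝ} {f : ℝ → E →L[ℝ] F} {v : ℝ → E} {g : ℝ → F}
    (hf : SBound x K f) (hv : SBound x L v) (hx : 1 / 2 < x) (hx1 : x < 1) (h0 : g 0 = 0)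
    (h1 : ‖inc g 0 0‖ ≤ M)
    (h : ∀ q k, k < 2 ^ q → ‖Schauder.sd g q k - f (dy q k) (Schauder.sd v q k)‖ ≤
      M * (x ^ 2) ^ q) :
    SBound (x ^ 2) (M + (1 + (1 / (x - 1 / 2) + 1 / (x - 1 / 2) * (x * x / (x * x - 1 / 4)))) *
      (K * L)) (remainder v g f) := by
  have hM : 0 ≤ M := (norm_nonneg _).trans h1
  have hK := hf.nonneg
  have hL := hv.nonneg
  have hx0 : 0 < x := by linarith
  have hx' : 0 < x - 1 / 2 := by linarith
  have hx2 : 0 < x * x - 1 / 4 := by nlinarith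
  obtain ⟨c, hc, hc0⟩ : ∃ c, c = 1 / (x - 1 / 2) + 1 / (x - 1 / 2) * (x * x / (x * x - 1 / 4)) ∧
    0 ≤ c := ⟨_, rfl, by positivity⟩
  rw [← hc]
  have hKL : 0 ≤ K * L := by positivity
  have hcKL : 0 ≤ c * (K * L) := by positivity
  have hrem : remainder v g f = fun t => g t - paraproduct f v t := rfl
  refine ⟨?_, ?_, fun q k hk => ?_⟩
  · rw [hrem]
    simp only [h0, paraproduct_zero_right, sub_zero, norm_zero]
    positivity
  · rw [hrem, inc_sub, inc_paraproduct_zero_zero]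
    have h2 := (f 0).le_of_opNorm_le_of_le hf.zero hv.one
    have h3 := norm_sub_le (inc g 0 0) (f 0 (inc v 0 0))
    linarith
  · have h2 := norm_sd_paraproduct_sub_le hf hv hx hx1.le hx hk
    rw [← hc, ← sq] at h2
    have h3 := h q k hk
    have h4 : Schauder.sd (remainder v g f) q k =
        (Schauder.sd g q k - f (dy q k) (Schauder.sd v q k)) -
        (Schauder.sd (paraproduct f v) q k - f (dy q k) (Schauder.sd v q k)) := by
      rw [hrem, sd_sub]; abel
    rw [h4]
    refine (norm_sub_le _ _).trans ((add_le_add h3 h2).trans ?_)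
    have h5 : 0 ≤ K * L * (x ^ 2) ^ q := by positivity
    linarith

end Construction

/-! ### Construction of the rough integral -/

section Main

variable {d : ℕ} {F : Type*} [NormedAddCommGroup F] [NormedSpace ℝ F] [CompleteSpace F]

set_option maxHeartbeats 800000 in
/-- Construction of the rough integral, in terms of bounds on Schauder coefficients. -/
lemma exists_integral (d : ℕ) {x y : ℝ} (hx : 1 / 2 < x) (hxy : x ≤ y) (hy1 : y < 1)
    (h : x ^ 2 * y < 1 / 2) (hne : x * y ≠ 1 / 2) :
    ∃ C, 0 ≤ C ∧ ∀ (v : ℝ → EuclideanSpace ℝ (Fin d)) (A : ℝ → EuclideanSpace ℝ (Fin d × Fin d))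
      (f : ℝ → EuclideanSpace ℝ (Fin d) →L[ℝ] F)
      (f' : ℝ → EuclideanSpace ℝ (Fin d) →L[ℝ] EuclideanSpace ℝ (Fin d) →L[ℝ] F)
      (K' L R a a' : ℝ), SBound x L v → SBound y K' f' → SBound (x * y) R (remainder v f f') →
      SBound (x ^ 2) a A →
      (∀ n : ℕ, SBound (x ^ 2) a'
        (levyMatrix (schauderSum (n + 1) v) (schauderSum (n + 1) v))) →
      (∀ t ∈ Icc (0 : ℝ) 1, Tendsto (fun n : ℕ =>
        levyMatrix (schauderSum (n + 1) v) (schauderSum (n + 1) v) t) atTop (𝓝 (A t))) →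
      SBound x (C * ((K' + R) * (1 + L))) f ∧
      ∃ J : ℝ → F, ContinuousOn J (Icc 0 1) ∧ J 0 = 0 ∧
        Tendsto (fun n : ℕ => inc (integral (schauderSum (n + 1) f) (schauderSum (n + 1) v)) 0 0)
          atTop (𝓝 (inc J 0 0)) ∧
        (∀ q k, k < 2 ^ q → Tendsto (fun n : ℕ =>
          sd (integral (schauderSum (n + 1) f) (schauderSum (n + 1) v)) q k) atTop
            (𝓝 (sd J q k))) ∧
        (∃ K, ∀ n : ℕ, SBound x K (integral (schauderSum (n + 1) f) (schauderSum (n + 1) v))) ∧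
        SBound x (C * ((K' + R) * (L + L ^ 2 + a))) J ∧
        SBound (x ^ 2) (C * ((K' + R) * (L + L ^ 2 + a))) (remainder v J f) ∧
        ContinuousOn (paraproduct f v) (Icc 0 1) := by
  have hx0 : 0 < x := by linarith
  have hx1 : x < 1 := by linarith
  obtain ⟨C₁, hC₁, hctrl⟩ := exists_controlled_of_remainder
    (E := EuclideanSpace ℝ (Fin d)) (F := EuclideanSpace ℝ (Fin d) →L[ℝ] F) hx hxy hy1
  obtain ⟨θ, C₂, hθ, hθ1, hθx, hC₂, X, hX, hXn, hXlim⟩ :=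
    exists_germ (F := F) d hx hxy hy1 h hne
  obtain ⟨cθ, hcθ, hcθ0⟩ : ∃ c, c = 1 / (1 - 2 * θ) ∧ 0 ≤ c :=
    ⟨_, rfl, one_div_nonneg.2 (by linarith)⟩
  obtain ⟨cs, hcs, hcs0⟩ : ∃ c, c = 2 + 1 / (1 - x) ∧ 0 ≤ c :=
    ⟨_, rfl, add_nonneg zero_le_two (one_div_nonneg.2 (by linarith))⟩
  obtain ⟨cp, hcp, hcp0⟩ : ∃ c, c = 1 + (1 / (x - 1 / 2) +
      1 / (x - 1 / 2) * (x * x / (x * x - 1 / 4))) ∧ 0 ≤ c := by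
    have h1 : 0 < x - 1 / 2 := by linarith
    have h2 : 0 < x * x - 1 / 4 := by nlinarith
    exact ⟨_, rfl, by positivity⟩
  have hC₁0 : 0 ≤ C₁ := by linarith
  have hcnn : 0 ≤ (1 + 2 * cθ) * (C₂ * (2 * C₁ + 2)) := by positivity
  refine ⟨C₁ + (1 + 2 * cθ) * (C₂ * (2 * C₁ + 2)) + cs * C₁ + cp * C₁, by positivity, ?_⟩
  intro v A f f' K' L R a a' hv hf' hR hA hAn hlim
  have hL := hv.nonneg
  have hK' := hf'.nonneg
  have hR0 := hR.nonneg
  have ha := hA.nonneg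
  have ha' := (hAn 0).nonneg
  obtain ⟨hc, hf⟩ := hctrl v f f' L K' R hv hf' hR
  obtain ⟨K, hK⟩ : ∃ K, K = C₁ * (R + K' * L) := ⟨_, rfl⟩
  rw [← hK] at hc hf
  have hK0 := hf.nonneg
  have hK1 : K ≤ C₁ * ((K' + R) * (1 + L)) := by
    rw [hK]
    refine mul_le_mul_of_nonneg_left ?_ hC₁0
    have : 0 ≤ R * L := by positivity
    linarith
  obtain ⟨N, hN⟩ : ∃ N, N = (K' + R) * (L + L ^ 2 + a) := ⟨_, rfl⟩
  have hN0 : 0 ≤ N := by rw [hN]; positivity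
  have hKL : K * L ≤ C₁ * N := by
    have h1 : 0 ≤ K' * L + R * L ^ 2 + (K' + R) * a := by positivity
    have h2 : K * L = C₁ * (R * L + K' * L ^ 2) := by rw [hK]; ring
    rw [h2, hN]
    refine mul_le_mul_of_nonneg_left (by linarith) hC₁0
  have hS : K * L + (K + K' * L) * L + K' * (a + L ^ 2) ≤ (2 * C₁ + 2) * N := by
    have h1 : 0 ≤ K' * L + R * (L + L ^ 2 + a) := by positivity
    have h2 : 0 ≤ K' * L + K' * a + R * (L + L ^ 2 + a) := by positivity
    linarith
  have hbase : ∀ b, 0 ≤ b → 0 ≤ C₂ * (K * L + (K + K' * L) * L + K' * (b + L ^ 2)) :=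
    fun b hb => by positivity
  obtain ⟨M, hM⟩ : ∃ M, M = C₂ * (K * L + (K + K' * L) * L + K' * (a + L ^ 2)) := ⟨_, rfl⟩
  obtain ⟨M', hM'⟩ : ∃ M, M = C₂ * (K * L + (K + K' * L) * L + K' * (a' + L ^ 2)) := ⟨_, rfl⟩
  have hM0 : 0 ≤ M := hM ▸ hbase a ha
  have hM'0 : 0 ≤ M' := hM' ▸ hbase a' ha'
  have hMN : M ≤ C₂ * (2 * C₁ + 2) * N := by
    rw [hM, mul_assoc]
    exact mul_le_mul_of_nonneg_left hS hC₂
  have hg : GermBound θ x M f v (X v A f f') := hM ▸ hX v A f f' K K' L K a hf hv hf' hc hA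
  -- The derivative `f'` is not truncated: truncating `f` and `v` either keeps or annihilates both
  -- sides of the coefficient relation. The constant `M'` does not depend on `n`, thanks to the
  -- uniform bound `a'` on the approximate areas.
  have hgn : ∀ n : ℕ, GermBound θ x M' (schauderSum (n + 1) f) (schauderSum (n + 1) v)
      (X (schauderSum (n + 1) v) (levyMatrix (schauderSum (n + 1) v) (schauderSum (n + 1) v))
        (schauderSum (n + 1) f) f') := fun n =>
    hM' ▸ hX _ _ _ f' K K' L K a' (hf.schauderSum hx0.le _) (hv.schauderSum hx0.le _) hf'
      (hc.schauderSum (mul_nonneg hx0.le (hx0.le.trans hxy)) n.succ_ne_zero) (hAn n)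
  -- `M'` serves for compactness only; the limit is estimated by `M`, which involves the norm `a` of
  -- the limiting area rather than the supremum.
  obtain ⟨hbound, j, hj, hjX⟩ := exists_sewing_limit hθ hθ1 hM0 hM'0
    (J := fun n => inc (integral (schauderSum (n + 1) f) (schauderSum (n + 1) v)))
    (fun n q k => by unfold defect; rw [inc_split _ q k]; abel)
    (fun n q k hq hk => by
      rw [hXn v f f' (n + 1) q k n.succ_ne_zero hq]
      exact inc_integral_schauderSum f v n.succ_ne_zero hq hk)
    (fun n => (hgn n).defect) (hXlim v A f f' hlim) hg.defect
  rw [← hcθ] at hbound hjX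
  obtain ⟨h1, h2⟩ := hg.of_approx hθ hθ1 hθx hcθ0 hjX
  -- The limiting increments determine the Schauder coefficients: index `0` carries the total
  -- increment, and index `k + 1` the difference of the increments over the two halves. Summing the
  -- series gives `J` at all points, with continuity from coefficient decay.
  obtain ⟨c, hcdef⟩ : ∃ c : ℕ → ℕ → F, c = fun q m =>
    if m = 0 then j 0 0 else j (q + 1) (2 * (m - 1)) - j (q + 1) (2 * (m - 1) + 1) := ⟨_, rfl⟩
  have hc0 : c 0 0 = j 0 0 := by rw [hcdef]; rfl
  have hcs' : ∀ q k, c q (k + 1) = j (q + 1) (2 * k) - j (q + 1) (2 * k + 1) := fun q k => by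
    rw [hcdef]; simp
  have hJ0 := schauderSeries_zero_right c
  have hJ1 : ‖inc (schauderSeries c) 0 0‖ ≤ (1 + 2 * cθ) * M := by
    rw [inc_schauderSeries_zero_zero, hc0]; exact h2
  have hJs : ∀ q k, k < 2 ^ q →
      ‖sd (schauderSeries c) q k - f (dy q k) (sd v q k)‖ ≤ (1 + 2 * cθ) * M * (x ^ 2) ^ q :=
    fun q k hk => by rw [sd_schauderSeries c hk, hcs']; exact h1 q k hk
  have hJ := hf.of_controlled hv hx hx1 hJ0 hJ1 hJs
  have hJr := hf.remainder_of_controlled hv hx hx1 hJ0 hJ1 hJs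
  rw [← hcs] at hJ
  rw [← hcp] at hJr
  have hMN' := mul_le_mul_of_nonneg_left hMN (by positivity : 0 ≤ 1 + 2 * cθ)
  have hcsN := mul_le_mul_of_nonneg_left hKL hcs0
  have hcpN := mul_le_mul_of_nonneg_left hKL hcp0
  have hn1 : 0 ≤ C₁ * N := by positivity
  have hn2 : 0 ≤ cs * (C₁ * N) := by positivity
  have hn3 : 0 ≤ cp * (C₁ * N) := by positivity
  refine ⟨hf.mono hx0.le (hK1.trans (mul_le_mul_of_nonneg_right ?_ (by positivity))),
    schauderSeries c, ?_, hJ0, ?_, ?_, ⟨(1 + 2 * cθ) * M' + cs * (K * L), fun n => ?_⟩, ?_, ?_,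
    continuousOn_paraproduct hf hv hx0 hx1 hx0 hx1⟩
  · have : 0 ≤ cs * C₁ := by positivity
    have : 0 ≤ cp * C₁ := by positivity
    linarith
  · refine continuousOn_schauderSeries (r := x) (K := (1 + 2 * cθ) * M + cs * (K * L)) hx0.le hx1 ?_
      fun q k hk => ?_
    · rw [← inc_schauderSeries_zero_zero c]; exact hJ.one
    · rw [← sd_schauderSeries c hk]; exact hJ.sd q k hk
  · rw [inc_schauderSeries_zero_zero, hc0]
    exact hj 0 0 (by simp)
  · intro q k hk
    have hk1 := two_mul_lt_pow hk
    rw [sd_schauderSeries c hk, hcs']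
    simp only [sd_eq _ q k]
    exact (hj (q + 1) (2 * k) (by omega)).sub (hj (q + 1) (2 * k + 1) hk1)
  · obtain ⟨h3, h4⟩ := (hgn n).of_approx hθ hθ1 hθx hcθ0 (hbound n)
    rw [hcs]
    refine (hf.schauderSum hx0.le (n + 1)).of_controlled (hv.schauderSum hx0.le (n + 1)) hx hx1
      (integral_schauderSum_zero_right f v n.succ_ne_zero) h4 fun q k hk => ?_
    rw [sd_eq (integral _ _)]
    exact h3 q k hk
  · rw [← hN]
    exact hJ.mono hx0.le (by linarith)
  · rw [← hN]
    exact hJr.mono (by positivity) (by linarith)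

end Main

/-! ### Translation between the norms and coefficient bounds -/

section Norm

variable {E : Type*} [NormedAddCommGroup E] [NormedSpace ℝ E] {γ K : ℝ} {f : ℝ → E}

lemma two_rpow_mul_natCast (γ : ℝ) (p : ℕ) :
    (2 : ℝ) ^ ((p : ℝ) * γ) = (((2 : ℝ) ^ (-γ)) ^ p)⁻¹ := by
  rw [← Real.rpow_natCast, ← Real.rpow_mul zero_le_two, ← Real.rpow_neg zero_le_two]
  congr 1; ring

lemma ofReal_two_rpow_mul_enorm_le_iff (hK : 0 ≤ K) (p : ℕ) (e : E) :
    ENNReal.ofReal ((2 : ℝ) ^ ((p : ℝ) * γ)) * ‖e‖ₑ ≤ ENNReal.ofReal K ↔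
      ‖e‖ ≤ K * ((2 : ℝ) ^ (-γ)) ^ p := by
  have hpos : (0 : ℝ) < ((2 : ℝ) ^ (-γ)) ^ p := by positivity
  rw [← ofReal_norm, ← ENNReal.ofReal_mul (by positivity), ENNReal.ofReal_le_ofReal_iff hK,
    two_rpow_mul_natCast, inv_mul_le_iff₀ hpos, mul_comm K]

lemma cnorm_le_iff (hK : 0 ≤ K) : cnorm γ f ≤ ENNReal.ofReal K ↔
    (2 : ℝ) ^ (-γ) * ‖f 0‖ ≤ K ∧ ‖inc f 0 0‖ ≤ K ∧
      ∀ q k, k < 2 ^ q → ‖sd f q k‖ ≤ K * ((2 : ℝ) ^ (-γ)) ^ q := by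
  unfold cnorm
  simp only [sup_le_iff, iSup_le_iff, ofReal_two_rpow_mul_enorm_le_iff hK, Finset.mem_range]
  rw [← ofReal_norm, ← ENNReal.ofReal_mul (by positivity), ENNReal.ofReal_le_ofReal_iff hK]
  refine and_congr_right fun _ => ⟨fun h => ⟨?_, fun q k hk => ?_⟩, fun h q m hm => ?_⟩
  · simpa [coeff_zero_zero] using h 0 0 (by simp)
  · rw [← coeff_succ]; exact h q (k + 1) (by omega)
  · rcases m with _ | k
    · rcases q with _ | q
      · simpa [coeff_zero_zero] using h.1
      · rw [coeff_succ_zero, norm_zero]; positivity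
    · rw [coeff_succ]; exact h.2 q k (by omega)

lemma SBound.cnorm_le (h : SBound ((2 : ℝ) ^ (-γ)) K f) (hγ : 0 ≤ γ) :
    cnorm γ f ≤ ENNReal.ofReal K := by
  refine (cnorm_le_iff h.nonneg).2 ⟨?_, h.one, h.sd⟩
  refine (mul_le_of_le_one_left (norm_nonneg _) ?_).trans h.zero
  exact Real.rpow_le_one_of_one_le_of_nonpos one_le_two (by linarith)

/-- The norm weights `f 0` by `2 ^ (-γ)`, which is at least `1 / 4` for `γ ≤ 2`; this accounts for
the factor `4`. -/
lemma sBound_of_cnorm_lt_top (h : cnorm γ f < ⊤) (hγ : γ ≤ 2) :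
    SBound ((2 : ℝ) ^ (-γ)) (4 * (cnorm γ f).toReal) f := by
  have hK : 0 ≤ (cnorm γ f).toReal := ENNReal.toReal_nonneg
  obtain ⟨h0, h1, h2⟩ := (cnorm_le_iff hK).1 (ENNReal.ofReal_toReal h.ne).ge
  refine ⟨?_, by linarith, fun q k hk => (h2 q k hk).trans ?_⟩
  · have h4 : (1 / 4 : ℝ) ≤ (2 : ℝ) ^ (-γ) := by
      calc (1 / 4 : ℝ) = (2 : ℝ) ^ (-2 : ℝ) := by
            rw [Real.rpow_neg zero_le_two, Real.rpow_two]; norm_num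
        _ ≤ _ := Real.rpow_le_rpow_of_exponent_le one_le_two (by linarith)
    nlinarith [mul_le_mul_of_nonneg_right h4 (norm_nonneg (f 0))]
  · gcongr; linarith

/-- Boundedness in `𝒞^γ` and convergence of the coefficients imply convergence in `𝒞^(γ-ε)`. -/
lemma tendsto_cnorm_of_sBound {ε : ℝ} (hε : 0 < ε) {g : ℕ → ℝ → E}
    (hg : ∀ n, SBound ((2 : ℝ) ^ (-γ)) K (g n)) (h0 : ∀ n, g n 0 = 0)
    (h1 : Tendsto (fun n => inc (g n) 0 0) atTop (𝓝 0))
    (h2 : ∀ q k, k < 2 ^ q → Tendsto (fun n => sd (g n) q k) atTop (𝓝 0)) :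
    Tendsto (fun n => cnorm (γ - ε) (g n)) atTop (𝓝 0) := by
  refine ENNReal.tendsto_nhds_zero.2 fun δ hδ => ?_
  obtain ⟨η, hη, hηδ⟩ : ∃ η : ℝ, 0 < η ∧ ENNReal.ofReal η ≤ δ := by
    rcases eq_or_ne δ ⊤ with rfl | hδ'
    · exact ⟨1, one_pos, le_top⟩
    · exact ⟨δ.toReal, ENNReal.toReal_pos hδ.ne' hδ', ENNReal.ofReal_toReal_le⟩
  set r : ℝ := 2 ^ (-γ) with hr
  set s : ℝ := 2 ^ (-ε) with hs
  have hr0 : 0 < r := by positivity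
  have hs0 : 0 < s := by positivity
  have hs1 : s < 1 := Real.rpow_lt_one_of_one_lt_of_neg one_lt_two (by linarith)
  have hrs : (2 : ℝ) ^ (-(γ - ε)) * s = r := by
    rw [hs, hr, ← Real.rpow_add zero_lt_two]; congr 1; ring
  have htend : Tendsto (fun q : ℕ => K * s ^ q) atTop (𝓝 (K * 0)) :=
    (tendsto_pow_atTop_nhds_zero_of_lt_one hs0.le hs1).const_mul K
  rw [mul_zero] at htend
  -- Levels `≥ Q` are handled by the uniform bound, which gains `s ^ q` when the exponent is lowered
  -- by `ε`. The finitely many remaining coefficients converge individually.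
  obtain ⟨Q, hQ⟩ := eventually_atTop.1 (htend.eventually (ge_mem_nhds hη))
  have hsmall : ∀ᶠ n in atTop, ∀ q ∈ Finset.range Q, ∀ k ∈ Finset.range (2 ^ q),
      ‖sd (g n) q k‖ ≤ η * ((2 : ℝ) ^ (-(γ - ε))) ^ q := by
    simp only [Filter.eventually_all_finset]
    intro q _ k hk
    have := (h2 q k (Finset.mem_range.1 hk)).norm
    rw [norm_zero] at this
    exact this.eventually (ge_mem_nhds (by positivity))
  have h1' := h1.norm
  rw [norm_zero] at h1'
  filter_upwards [hsmall, h1'.eventually (ge_mem_nhds hη)] with n hn hn1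
  refine le_trans ((cnorm_le_iff hη.le).2 ⟨?_, hn1, fun q k hk => ?_⟩) hηδ
  · rw [h0, norm_zero, mul_zero]; exact hη.le
  · rcases lt_or_ge q Q with hq | hq
    · exact hn q (Finset.mem_range.2 hq) k (Finset.mem_range.2 hk)
    · refine ((hg n).sd q k hk).trans ?_
      rw [← hrs, mul_pow]
      have h3 := mul_le_mul_of_nonneg_right (hQ q hq)
        (by positivity : 0 ≤ ((2 : ℝ) ^ (-(γ - ε))) ^ q)
      linarith

lemma SBound.cnorm_lt_top {γ' : ℝ} (h : SBound ((2 : ℝ) ^ (-γ)) K f) (hγ : γ' ≤ γ) :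
    cnorm γ' f < ⊤ := by
  have hK := h.nonneg
  have h1 : (2 : ℝ) ^ (-γ) ≤ (2 : ℝ) ^ (-γ') :=
    Real.rpow_le_rpow_of_exponent_le one_le_two (by linarith)
  have h2 : (0 : ℝ) ≤ 2 ^ (-γ') * K := by positivity
  refine lt_of_le_of_lt ((cnorm_le_iff (K := (2 : ℝ) ^ (-γ') * K + K) (by positivity)).2
    ⟨?_, by linarith [h.one], fun q k hk => (h.sd q k hk).trans ?_⟩) ENNReal.ofReal_lt_top
  · have := mul_le_mul_of_nonneg_left h.zero (by positivity : (0 : ℝ) ≤ 2 ^ (-γ'))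
    linarith
  · exact mul_le_mul (by linarith) (pow_le_pow_left₀ (by positivity) h1 q) (by positivity)
      (by positivity)

end Norm

end Schauder

end

/-! ### The theorem: exponents, limits and constants -/

theorem theorem4p6 (d m : ℕ) (α β : ℝ) (hα : 1 / 3 < α) (hα1 : α < 1)
    (hβ : 0 < β) (hβα : β ≤ α) (hαβ : 1 < 2 * α + β) (hne : α + β ≠ 1) :
    ∃ C : ℝ≥0, ∀ (v : ℝ → EuclideanSpace ℝ (Fin d))
      (A : ℝ → EuclideanSpace ℝ (Fin d × Fin d))
      (f : ℝ → EuclideanSpace ℝ (Fin d) →L[ℝ] EuclideanSpace ℝ (Fin m))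
      (fv : ℝ → EuclideanSpace ℝ (Fin d) →L[ℝ]
        EuclideanSpace ℝ (Fin d) →L[ℝ] EuclideanSpace ℝ (Fin m)),
      Schauder.MemC α v →
      TendstoUniformlyOn
        (fun N : ℕ => Schauder.levyMatrix (Schauder.partialSum N v) (Schauder.partialSum N v))
        A atTop (Set.Icc 0 1) →
      (⨆ N : ℕ, Schauder.cnorm (2 * α)
        (Schauder.levyMatrix (Schauder.partialSum N v) (Schauder.partialSum N v))) < ⊤ →
      Schauder.MemD α β v f fv →
      ∃ J : ℝ → EuclideanSpace ℝ (Fin m),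
        (∀ ε : ℝ, 0 < ε →
          Schauder.TendstoC (α - ε)
            (fun N : ℕ => Schauder.integral (Schauder.partialSum N f) (Schauder.partialSum N v))
            J) ∧
        Schauder.cnorm α J ≤
          C * (Schauder.dnorm α β v f fv *
            (Schauder.cnorm α v + Schauder.cnorm α v ^ 2 + Schauder.cnorm (2 * α) A)) ∧
        Schauder.MemD α α v J f ∧
        Schauder.dnorm α α v J f ≤
          C * (Schauder.dnorm α β v f fv *
            (1 + Schauder.cnorm α v ^ 2 + Schauder.cnorm (2 * α) A)) := by
  open Schauder in
  have hα0 : 0 < α := by linarith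
  obtain ⟨x, hx⟩ : ∃ x : ℝ, x = 2 ^ (-α) := ⟨_, rfl⟩
  obtain ⟨y, hy⟩ : ∃ y : ℝ, y = 2 ^ (-β) := ⟨_, rfl⟩
  have hhalf : (1 / 2 : ℝ) = 2 ^ (-1 : ℝ) := by rw [Real.rpow_neg_one]; norm_num
  have hxy : x * y = 2 ^ (-(α + β)) := by
    rw [hx, hy, ← Real.rpow_add zero_lt_two]; congr 1; ring
  have hx2 : x ^ 2 = 2 ^ (-(2 * α)) := by
    rw [hx, sq, ← Real.rpow_add zero_lt_two]; congr 1; ring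
  have hx2' : x ^ 2 = 2 ^ (-(α + α)) := by rw [hx2]; congr 1; ring
  have hx2y : x ^ 2 * y = 2 ^ (-(2 * α + β)) := by
    rw [hx2, hy, ← Real.rpow_add zero_lt_two]; congr 1; ring
  obtain ⟨C, hC, hmain⟩ := exists_integral (F := EuclideanSpace ℝ (Fin m)) d (x := x) (y := y)
    (by rw [hx, hhalf]; exact Real.rpow_lt_rpow_of_exponent_lt one_lt_two (by linarith))
    (by rw [hx, hy]; exact Real.rpow_le_rpow_of_exponent_le one_le_two (by linarith))
    (by rw [hy]; exact Real.rpow_lt_one_of_one_lt_of_neg one_lt_two (by linarith))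
    (by rw [hx2y, hhalf]; exact Real.rpow_lt_rpow_of_exponent_lt one_lt_two (by linarith))
    (by
      rw [hxy, hhalf]
      intro h
      exact hne (by linarith [(Real.rpow_right_inj zero_lt_two (by norm_num)).1 h]))
  -- Passing from norms to coefficient bounds costs a factor `4` for each quantity, hence `16` for
  -- `L ^ 2`. The products with `K' + R` cost at most `64`, and `128` leaves room for the sum of two
  -- such terms.
  refine ⟨(128 * C).toNNReal, fun v A f fv hv hA hsup hD => ?_⟩
  obtain ⟨hfC, hfv, hrem⟩ := hD
  simp only [partialSum_natCast] at hA hsup ⊢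
  have hlim : ∀ t ∈ Icc (0 : ℝ) 1, Tendsto (fun n : ℕ =>
      levyMatrix (schauderSum (n + 1) v) (schauderSum (n + 1) v) t) atTop (𝓝 (A t)) :=
    fun t ht => hA.tendsto_at ht
  have hAn : ∀ n : ℕ, SBound (x ^ 2) (4 * (⨆ N : ℕ, cnorm (2 * α)
      (levyMatrix (schauderSum (N + 1) v) (schauderSum (N + 1) v))).toReal)
      (levyMatrix (schauderSum (n + 1) v) (schauderSum (n + 1) v)) := by
    intro n
    have h1 := le_iSup (fun N : ℕ => cnorm (2 * α)
      (levyMatrix (schauderSum (N + 1) v) (schauderSum (N + 1) v))) n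
    have h2 := sBound_of_cnorm_lt_top (h1.trans_lt hsup) (by linarith)
    rw [← hx2] at h2
    exact h2.mono (by rw [hx2]; positivity)
      (mul_le_mul_of_nonneg_left (ENNReal.toReal_mono hsup.ne h1) (by norm_num))
  -- Lower semicontinuity: the uniform coefficient bounds pass to the pointwise limit `A`.
  have hA1 : cnorm (2 * α) A < ⊤ :=
    (hx2 ▸ SBound.of_tendsto hAn hlim).cnorm_lt_top le_rfl
  have hA2 := sBound_of_cnorm_lt_top hA1 (by linarith)
  have hv2 := sBound_of_cnorm_lt_top hv.2 (by linarith)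
  have hfv2 := sBound_of_cnorm_lt_top hfv.2 (by linarith)
  have hrem2 := sBound_of_cnorm_lt_top hrem.2 (by linarith)
  rw [← hx2] at hA2
  rw [← hx] at hv2
  rw [← hy] at hfv2
  rw [← hxy] at hrem2
  obtain ⟨hf, J, hJc, hJ0, hJ1, hJs, ⟨K, hJK⟩, hJ, hJr, hπ⟩ :=
    hmain v A f fv _ _ _ _ _ hv2 hfv2 hrem2 hA2 hAn hlim
  obtain ⟨L, hL, hL0⟩ : ∃ L : ℝ, cnorm α v = ENNReal.ofReal L ∧ 0 ≤ L :=
    ⟨_, (ENNReal.ofReal_toReal hv.2.ne).symm, ENNReal.toReal_nonneg⟩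
  obtain ⟨a, ha, ha0⟩ : ∃ a : ℝ, cnorm (2 * α) A = ENNReal.ofReal a ∧ 0 ≤ a :=
    ⟨_, (ENNReal.ofReal_toReal hA1.ne).symm, ENNReal.toReal_nonneg⟩
  obtain ⟨K', hK', hK'0⟩ : ∃ a : ℝ, cnorm β fv = ENNReal.ofReal a ∧ 0 ≤ a :=
    ⟨_, (ENNReal.ofReal_toReal hfv.2.ne).symm, ENNReal.toReal_nonneg⟩
  obtain ⟨R, hR, hR0⟩ : ∃ a : ℝ, cnorm (α + β) (remainder v f fv) = ENNReal.ofReal a ∧ 0 ≤ a :=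
    ⟨_, (ENNReal.ofReal_toReal hrem.2.ne).symm, ENNReal.toReal_nonneg⟩
  rw [hK', hR, hL, ENNReal.toReal_ofReal hK'0, ENNReal.toReal_ofReal hR0,
    ENNReal.toReal_ofReal hL0] at hf
  rw [hK', hR, hL, ha, ENNReal.toReal_ofReal hK'0, ENNReal.toReal_ofReal hR0,
    ENNReal.toReal_ofReal hL0, ENNReal.toReal_ofReal ha0] at hJ hJr
  have hDR : dnorm α β v f fv = ENNReal.ofReal (K' + R) := by
    rw [dnorm, hK', hR, ENNReal.ofReal_add hK'0 hR0]
  have hCR : ((128 * C).toNNReal : ℝ≥0∞) = ENNReal.ofReal (128 * C) := rfl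
  rw [hx] at hJ hJK hf
  rw [hx2'] at hJr
  have hremc : ContinuousOn (remainder v J f) (Icc 0 1) := hJc.sub hπ
  have hD0 : 0 ≤ K' + R := by positivity
  refine ⟨J, fun ε hε => ⟨fun n => ⟨?_, ?_⟩, ⟨hJc, hJ.cnorm_lt_top (by linarith)⟩, ?_⟩, ?_,
    ⟨⟨hJc, hJ.cnorm_lt_top le_rfl⟩, ?_, ⟨hremc, hJr.cnorm_lt_top le_rfl⟩⟩, ?_⟩
  · exact (continuous_integral_schauderSum f v n.succ_ne_zero).continuousOn
  · exact (hJK n).cnorm_lt_top (by linarith)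
  · refine tendsto_cnorm_of_sBound hε (fun n => (hJK n).sub hJ) (fun n => ?_) ?_ fun q k hk => ?_
    · rw [hJ0, sub_zero]
      exact integral_schauderSum_zero_right f v n.succ_ne_zero
    · simp only [inc_sub]
      simpa using hJ1.sub_const (inc J 0 0)
    · simp only [sd_sub]
      simpa using (hJs q k hk).sub_const (sd J q k)
  · refine (hJ.cnorm_le hα0.le).trans ?_
    rw [hDR, hL, ha, hCR, ← ENNReal.ofReal_pow hL0, ← ENNReal.ofReal_add hL0 (by positivity),
      ← ENNReal.ofReal_add (by positivity) ha0, ← ENNReal.ofReal_mul hD0,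
      ← ENNReal.ofReal_mul (by positivity)]
    refine ENNReal.ofReal_le_ofReal ?_
    have h1 : 0 ≤ C * ((K' + R) * (L + a)) := by positivity
    have h2 : 0 ≤ C * ((K' + R) * L ^ 2) := by positivity
    linarith
  · exact hfC
  · refine (add_le_add (hf.cnorm_le hα0.le) (hJr.cnorm_le (by linarith))).trans ?_
    rw [hDR, hL, ha, hCR, ← ENNReal.ofReal_pow hL0, ← ENNReal.ofReal_one,
      ← ENNReal.ofReal_add zero_le_one (by positivity),
      ← ENNReal.ofReal_add (by positivity) ha0, ← ENNReal.ofReal_mul hD0,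
      ← ENNReal.ofReal_mul (by positivity), ← ENNReal.ofReal_add (by positivity) (by positivity)]
    refine ENNReal.ofReal_le_ofReal ?_
    have h1 : 0 ≤ C * (K' + R) := by positivity
    have h2 : 0 ≤ C * (K' + R) * a := by positivity
    -- The second estimate has no linear term in `L` on the right; `2 * L ≤ 1 + L ^ 2` absorbs it.
    have h3 : 0 ≤ C * (K' + R) * (L - 1) ^ 2 := by positivity
    have h4 : 0 ≤ C * (K' + R) * L ^ 2 := by positivity
    linarith
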